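/- **Decay of the effective weights by restriction.** *Setting.* Let $G=(\Lambda,E)$ be a finite undirected graph without self-loops, with $E$ a set of unordered pairs of vertices. For $r\in\mathbb N_0$ let $G_r=(\Lambda_r,E_r)$ be its $2^r$-subdivision: every edge $e=\{v_{e,0},v_{e,1}\}\in E$ is replaced by a series of $2^r$ edges $\{v_{e,2^{-r}(j-1)},v_{e,2^{-r}j}\}$, $1\le j\le 2^r$, through $2^r-1$ new vertices $v_{e,2^{-r}j}$, $1\le j\le 2^r-1$. Thus $\Lambda_0=\Lambda$ and $\Lambda_l\subseteq\Lambda_r$ for $l\le r$. Let $0\le l\le r$. On some probability space with expectation operator $\mathbb E$, let $W=(W_e)_{e\in E_r}$ be i.i.d. almost surely positive random weights, regarded also as a symmetric matrix indexed by $\Lambda_r$ (with $W_{xy}=W_e$ if $e=\{x,y\}\in E_r$ and $W_{xy}=0$ otherwise). Let $\beta=(\beta_v)_{v\in\Lambda_r}$ be a random vector whose conditional law given $W$ is the probability measure $$\nu^W_{\Lambda_r}(d\beta)=\left(\tfrac2\pi\right)^{|\Lambda_r|/2}1_{\{H_\beta>0\}}\frac{e^{-\frac12\langle 1,H_\beta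 1\rangle}}{\sqrt{\det H_\beta}}\,d\beta,\qquad H_\beta=2\operatorname{diag}(\beta)-W,$$ where $H_\beta>0$ means positive definite. With $J=\Lambda_l$ and $I=\Lambda_r\setminus\Lambda_l$, the effective weights on $G_l$ are the entries $$W^{(l)}_{e}=W^{J}_{xy},\quad e=\{x,y\}\in E_l,\qquad\text{of}\qquad W^{J}=W_{JJ}+W_{JI}\,([H_\beta]_{II})^{-1}\,W_{IJ}.$$ (These are the random weights for which the vertex-reinforced jump process on $G_r$ with weights $W$, restricted to $\Lambda_l$ with self-loops removed, is a mixture of vertex-reinforced jump processes on $G_l$.) Put $C_\alpha:=2^{-\alpha}\,\Gamma(\tfrac12-\alpha)/\sqrt\pi$ for $0\le\alpha<\tfrac12$ and $c_2:=\gamma+\log 2$, where $\gamma$ is the Euler–Mascheroni constant. Expectations of non-negative random variables take values in $[0,\infty]$. *Theorem.* For all $\bar e\in E_l$ and $e'\in E_r$: 1. For all $\alpha\in[0,1]$, $$\mathbb E[(W^{(l)}_{\bar e})^\alpha]\le (2^{-\alpha})^{r-l}\,\mathbb E[W_{e'}^\alpha].$$ 2. For all $\alpha\in[0,\tfrac12)$,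 $$\mathbb E[(W^{(l)}_{\bar e})^\alpha]\le\frac1{C_\alpha}\min_{m\in\{l,\dots,r\}}\left(C_\alpha(2^{-\alpha})^{r-m}\,\mathbb E[W_{e'}^\alpha]\right)^{2^{m-l}}.$$ 3. If $\mathbb E[\log W_{e'}]$ exists in $[-\infty,\infty]$, then so does $\mathbb E[\log W^{(l)}_{\bar e}]$, and $$\mathbb E[\log W^{(l)}_{\bar e}]\le\min_{m\in\{l,\dots,r\}}\Bigl(2^{m-l}\bigl(\mathbb E[\log W_{e'}]-(r-m)\log 2+c_2\bigr)-c_2\Bigr);$$ if moreover $\log W_{e'}$ is integrable, then so is $\log W^{(l)}_{\bar e}$. 4. Let $\alpha\in(0,\tfrac12)$ with $\mathbb E[W_{e'}^\alpha]<\infty$, and set $m_0:=r-2-\lfloor\alpha^{-1}\log_2(C_\alpha\mathbb E[W_{e'}^\alpha])\rfloor$. A minimizer in 2 is given by $m=m_0$ if $m_0\in\{l,\dots,r\}$, by $m=l$ if $m_0<l$, and by $m=r$ if $m_0>r$. 5. Let $\log W_{e'}$ be integrable, and set $m_1:=r-2-\lfloor(\log 2)^{-1}(\mathbb E[\log W_{e'}]+c_2)\rfloor$.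 A minimizer in 3 is given by $m=m_1$ if $m_1\in\{l,\dots,r\}$, by $m=l$ if $m_1<l$, and by $m=r$ if $m_1>r$. -/

import Mathlib

open MeasureTheory ProbabilityTheory
open scoped ENNReal

noncomputable section

namespace VRJP

/-! ### The `β`-field and the effective weights of a restriction -/

section Field

variable {Λ : Type*} [Fintype Λ] [DecidableEq Λ]

/-- The matrix `H_β = 2 diag(β) - W`. -/
def hMatrix (W : Matrix Λ Λ ℝ) (β : Λ → ℝ) : Matrix Λ Λ ℝ :=
  Matrix.diagonal (fun i => 2 * β i) - W

open Classical in
/-- The law `ν_Λ^W` of the `β`-field: the measure on `ℝ^Λ` with Lebesgue density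
`(2/π)^(|Λ|/2) 1_{H_β > 0} exp(-⟨1, H_β 1⟩ / 2) / √(det H_β)`. -/
def betaLaw (W : Matrix Λ Λ ℝ) : Measure (Λ → ℝ) :=
  (volume : Measure (Λ → ℝ)).withDensity fun β =>
    if (hMatrix W β).PosDef then
      ENNReal.ofReal
        ((2 / Real.pi) ^ ((Fintype.card Λ : ℝ) / 2)
          * (Real.exp (-(∑ i, ∑ j, hMatrix W β i j) / 2) / Real.sqrt (hMatrix W β).det))
    else 0

open Classical in
/-- The effective weights `W^J(β) = W_JJ + W_JI ([H_β]_II)⁻¹ W_IJ`, where `I = Λ \ J`. They depend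
on `β` only through its restriction to `I`. -/
def effectiveWeights (W : Matrix Λ Λ ℝ) (β : Λ → ℝ) (J : Set Λ) :
    Matrix {x // x ∈ J} {x // x ∈ J} ℝ :=
  let inJ : {x // x ∈ J} → Λ := Subtype.val
  let inI : {x // x ∉ J} → Λ := Subtype.val
  W.submatrix inJ inJ
    + W.submatrix inJ inI * ((hMatrix W β).submatrix inI inI)⁻¹ * W.submatrix inI inJ

end Field

/-! ### Subdivided graphs -/

section Subdivision

variable {V : Type*}

/-- A choice of a direction for every edge `e` of `G`; `tail e` is `v_{e,0}` and `head e` is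
`v_{e,1}`. -/
structure EdgeDirection (G : SimpleGraph V) where
  /-- the vertex `v_{e,0}` -/
  tail : G.edgeSet → V
  /-- the vertex `v_{e,1}` -/
  head : G.edgeSet → V
  ends : ∀ e, s(tail e, head e) = (e : Sym2 V)

/-- The vertex set `Λ_r` of the `2^r`-subdivision `G_r`: the vertices of `G`, and for every edge `e`
of `G` the new vertices `v_{e,2^(-r) j}`, `0 < j < 2^r`. -/
abbrev SubVertex (G : SimpleGraph V) (r : ℕ) : Type _ :=
  V ⊕ (G.edgeSet × {j : ℕ // j ∈ Finset.Ioo 0 (2 ^ r)})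

/-- The edge set `E_r` of `G_r`, where the pair `(e, i)` stands for the edge
`e_{i+1,r} = {v_{e,2^(-r) i}, v_{e,2^(-r) (i+1)}}`, `0 ≤ i < 2^r`. -/
abbrev SubEdge (G : SimpleGraph V) (r : ℕ) : Type _ :=
  G.edgeSet × Fin (2 ^ r)

variable {G : SimpleGraph V}

/-- The vertex `v_{e,2^(-r) j}` of `G_r`, for `0 ≤ j ≤ 2^r`. -/
def EdgeDirection.point (D : EdgeDirection G) (r : ℕ) (e : G.edgeSet) (j : ℕ) : SubVertex G r :=
  if h : j ∈ Finset.Ioo 0 (2 ^ r) then Sum.inr (e, ⟨j, h⟩)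
  else if j = 0 then Sum.inl (D.tail e)
  else Sum.inl (D.head e)

/-- The two end points of an edge of `G_r`. -/
def EdgeDirection.edgeEnds (D : EdgeDirection G) (r : ℕ) (e : SubEdge G r) : Sym2 (SubVertex G r) :=
  s(D.point r e.1 e.2, D.point r e.1 (e.2 + 1))

/-- The symmetric weight matrix on `Λ_r` given by edge weights `w` on `E_r`: the entry at `x, y` is
`w e` if `x, y` are the end points of `e ∈ E_r`, and `0` if they are not joined by an edge. (Different
elements of `E_r` have different end points, so at most one summand is non-zero.) -/
def EdgeDirection.weightMatrix [Fintype V] [DecidableEq V] [DecidableRel G.Adj]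
    (D : EdgeDirection G) (r : ℕ) (w : SubEdge G r → ℝ) :
    Matrix (SubVertex G r) (SubVertex G r) ℝ :=
  fun x y => ∑ e, if D.edgeEnds r e = s(x, y) then w e else 0

/-- `Λ_l` as a subset of `Λ_r`, for `l ≤ r`: the vertex `v_{e,2^(-r) j}` belongs to `Λ_l` if and only
if `2^(r-l)` divides `j`. -/
def coarseVertices (G : SimpleGraph V) (l r : ℕ) : Set (SubVertex G r) :=
  {x | ∀ e j, x = Sum.inr (e, j) → 2 ^ (r - l) ∣ (j : ℕ)}

lemma EdgeDirection.point_mem_coarseVertices (D : EdgeDirection G) (l r : ℕ) (e : G.edgeSet)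
    (i : ℕ) : D.point r e (2 ^ (r - l) * i) ∈ coarseVertices G l r := by
  intro e' j h
  unfold EdgeDirection.point at h
  split_ifs at h with h1 h2
  have h3 : 2 ^ (r - l) * i = (j : ℕ) :=
    congrArg Subtype.val (Prod.ext_iff.1 (Sum.inr.inj h)).2
  exact ⟨i, h3.symm⟩

/-- The vertex `v_{e,2^(-l) i}` of `Λ_l`, as an element of `Λ_l ⊆ Λ_r`. -/
def EdgeDirection.coarsePoint (D : EdgeDirection G) (l r : ℕ) (e : G.edgeSet) (i : ℕ) :
    {x // x ∈ coarseVertices G l r} :=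
  ⟨D.point r e (2 ^ (r - l) * i), D.point_mem_coarseVertices l r e i⟩

/-- The effective weight `W^(l)_e` of the edge `e ∈ E_l`, for edge weights `w` on `G_r` and a
configuration `β` on `Λ_r`: the entry of `W^{Λ_l}(β)` at the two end points of `e`. -/
def EdgeDirection.effectiveEdgeWeight [Fintype V] [DecidableEq V] [DecidableRel G.Adj]
    (D : EdgeDirection G) (l r : ℕ) (w : SubEdge G r → ℝ) (β : SubVertex G r → ℝ)
    (e : SubEdge G l) : ℝ :=
  effectiveWeights (D.weightMatrix r w) β (coarseVertices G l r)
    (D.coarsePoint l r e.1 e.2) (D.coarsePoint l r e.1 (e.2 + 1))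

end Subdivision

/-! ### Expectations, constants and bounds -/

section Expectation

variable {Ω : Type*} [MeasurableSpace Ω]

/-- The expectation of a real random variable exists in `[-∞, ∞]`: its positive part or its negative
part has finite expectation. -/
def HasExpectation (P : Measure Ω) (f : Ω → ℝ) : Prop :=
  ∫⁻ ω, ENNReal.ofReal (f ω) ∂P ≠ ∞ ∨ ∫⁻ ω, ENNReal.ofReal (-f ω) ∂P ≠ ∞

/-- The expectation in `[-∞, ∞]`, that is, the expectation of the positive part minus the expectation
of the negative part (meaningful under `HasExpectation`). -/
def expectation (P : Measure Ω) (f : Ω → ℝ) : EReal :=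
  ((∫⁻ ω, ENNReal.ofReal (f ω) ∂P : ℝ≥0∞) : EReal)
    - ((∫⁻ ω, ENNReal.ofReal (-f ω) ∂P : ℝ≥0∞) : EReal)

end Expectation

/-- `C_α = 2^(-α) Γ(1/2 - α) / √π`. -/
def cAlpha (α : ℝ) : ℝ :=
  (2 : ℝ) ^ (-α) * Real.Gamma (1 / 2 - α) / Real.sqrt Real.pi

/-- `c₂ = γ + log 2`, with the Euler-Mascheroni constant `γ`. -/
def cTwo : ℝ := Real.eulerMascheroniConstant + Real.log 2

/-- `(C_α (2^(-α))^(r-m) M)^(2^(m-l))`, for `l ≤ m ≤ r`. -/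
def momentTerm (α : ℝ) (M : ℝ≥0∞) (l r m : ℕ) : ℝ≥0∞ :=
  (ENNReal.ofReal (cAlpha α) * ENNReal.ofReal ((2 : ℝ) ^ (-α)) ^ (r - m) * M) ^ (2 ^ (m - l))

/-- `2^(m-l) (L - (r-m) log 2 + c₂) - c₂`, for `l ≤ m ≤ r`. -/
def logTerm (L : EReal) (l r m : ℕ) : EReal :=
  (((2 : ℝ) ^ (m - l) : ℝ) : EReal)
      * (L - ((((r - m : ℕ) : ℝ) * Real.log 2 : ℝ) : EReal) + (cTwo : EReal))
    - (cTwo : EReal)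

/-- A minimizer of `f` over `{l, …, r}` is `m₀` if `l ≤ m₀ ≤ r`, it is `l` if `m₀ < l`, and it is `r`
if `m₀ > r`. -/
def MinimizedAt {β : Type*} [Preorder β] (f : ℕ → β) (l r : ℕ) (m₀ : ℤ) : Prop :=
  (∀ m ∈ Set.Icc l r, (m : ℤ) = m₀ → IsMinOn f (Set.Icc l r) m)
    ∧ (m₀ < l → IsMinOn f (Set.Icc l r) l)
    ∧ ((r : ℤ) < m₀ → IsMinOn f (Set.Icc l r) r)

end VRJP

end

/-!
The path of `2 ^ (r - l)` edges of `G_r` which makes up an edge of `G_l` can be reduced one vertex at a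
time. The density of the `β`-field factorizes under a Schur complement
(`betaDensity_hMatrix_sumElim`), and Lebesgue measure is invariant under the shift of the remaining
`β`, so the field on the inner vertices of such a path has a density of the same form, in which the
weights to the end points appear as a boundary vector. Conditionally on the edge weights, the effective
weight depends only on this part of the field (`effectiveEdgeWeight_eq_pathWeight`). If two edges of
weights `a` and `b` are in series, then `h = H_mm` at the middle vertex `m` is a reciprocal inverse
Gaussian variable with parameter `a + b`, and the effective weight is `a b / h`. Cutting a path in its
middle (`pathLaw_eq_seriesLaw`), one finds that, for i.i.d. edge weights of law `μ`, the effective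
weight of a path of `2 ^ k` edges has the law `μ_k`, where `μ_0 = μ` and `μ_(k+1)` is the law of
`a b / h` with independent `a, b` of law `μ_k` (`map_effectiveEdgeWeight`).

The bounds follow from two estimates for one such step. The mean of `a b / h`, given `a` and `b`, is
`a b / (a + b) ≤ √(a b) / 2`, so by concavity the moment of order `α ∈ [0, 1]` decreases by the factor
`2 ^ (-α)`, and the logarithmic moment by `log 2`. On the other hand
`E[h ^ (-α)] ≤ C_α` for every parameter of `h`, where `C_α` is the value for the parameter `0`, so the
moment `M` of order `α < 1 / 2` is replaced by at most `C_α M ^ 2`. Since `C_α` has the derivative `c₂`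
at `α = 0`, the logarithmic moment `L` becomes at most `2 L + c₂`. The combined bounds use the first
estimate `r - m` times and then the second one `m - l` times. Expectations of logarithms may be
infinite, so these inequalities are first proved in the form of inequalities between the integrals of
the positive and negative parts, and each of the two integrals is shown to stay finite if it is so.

Both combined bounds are monotone functions of `2 ^ (m - l) (A - (r - m) δ)` with constants `A` and
`δ > 0`, which decreases in `m` up to the stated minimizer and increases from there on
(`minimizedAt_comp_of_monotone`).
-/

noncomputable section

namespace VRJP

open Matrix

/-! ### Block matrices -/

section Block

variable {m n : Type*} [Fintype m] [Fintype n] [DecidableEq m] [DecidableEq n]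

omit [Fintype n] [DecidableEq n] in
lemma transpose_inv_of_posDef {A : Matrix m m ℝ} (hA : A.PosDef) : A⁻¹ᵀ = A⁻¹ := by
  have := hA.inv.isHermitian
  simpa [IsHermitian] using this

lemma posDef_fromBlocks_iff (A : Matrix m m ℝ) (B : Matrix m n ℝ) (D : Matrix n n ℝ) :
    (fromBlocks A B Bᵀ D).PosDef ↔ A.PosDef ∧ (D - Bᵀ * A⁻¹ * B).PosDef := by
  have key (hA : A.PosDef) :
      (fromBlocks A B Bᵀ D).PosDef ↔ (D - Bᵀ * A⁻¹ * B).PosDef := by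
    have hu := hA.isUnit
    let _ := hu.invertible
    have h1 : (fromBlocks A B Bᵀ D).PosSemidef ↔ (D - Bᵀ * A⁻¹ * B).PosSemidef := by
      simpa using PosDef.fromBlocks₁₁ B D hA
    have h2 : (fromBlocks A B Bᵀ D).det = A.det * (D - Bᵀ * A⁻¹ * B).det := by
      rw [det_fromBlocks₁₁, invOf_eq_nonsing_inv]
    have h3 : A.det ≠ 0 := hA.det_pos.ne'
    constructor
    · intro h
      refine (h1.1 h.posSemidef).posDef_iff_det_ne_zero.2 fun h0 => h.det_pos.ne' ?_
      rw [h2, h0, mul_zero]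
    · intro h
      refine (h1.2 h.posSemidef).posDef_iff_det_ne_zero.2 ?_
      rw [h2]
      exact mul_ne_zero h3 h.det_pos.ne'
  constructor
  · intro h
    have hA : A.PosDef := by
      exact h.submatrix (e := Sum.inl) Sum.inl_injective
    exact ⟨hA, (key hA).1 h⟩
  · rintro ⟨hA, hS⟩
    exact (key hA).2 hS

/-- The bilinear form of the inverse of a block matrix, after elimination of the first block. -/
lemma dotProduct_inv_fromBlocks_mulVec (A : Matrix m m ℝ) (B : Matrix m n ℝ) (D : Matrix n n ℝ)
    (hH : (fromBlocks A B Bᵀ D).PosDef) (u v : m ⊕ n → ℝ) :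
    u ⬝ᵥ (fromBlocks A B Bᵀ D)⁻¹ *ᵥ v =
      (u ∘ Sum.inl) ⬝ᵥ A⁻¹ *ᵥ (v ∘ Sum.inl)
        + (u ∘ Sum.inr - Bᵀ *ᵥ A⁻¹ *ᵥ (u ∘ Sum.inl)) ⬝ᵥ
          (D - Bᵀ * A⁻¹ * B)⁻¹ *ᵥ (v ∘ Sum.inr - Bᵀ *ᵥ A⁻¹ *ᵥ (v ∘ Sum.inl)) := by
  obtain ⟨hA, hS⟩ := (posDef_fromBlocks_iff A B D).1 hH
  set S := D - Bᵀ * A⁻¹ * B with hSdef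
  set u₁ := u ∘ Sum.inl
  set u₂ := u ∘ Sum.inr
  set v₁ := v ∘ Sum.inl
  set v₂ := v ∘ Sum.inr
  have hu : u = Sum.elim u₁ u₂ := (Sum.elim_comp_inl_inr u).symm
  have hv : v = Sum.elim v₁ v₂ := (Sum.elim_comp_inl_inr v).symm
  have hA1 : A * A⁻¹ = 1 := mul_nonsing_inv _ ((isUnit_iff_isUnit_det _).1 hA.isUnit)
  have hS1 : S * S⁻¹ = 1 := mul_nonsing_inv _ ((isUnit_iff_isUnit_det _).1 hS.isUnit)
  have hH1 : (fromBlocks A B Bᵀ D)⁻¹ * fromBlocks A B Bᵀ D = 1 :=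
    nonsing_inv_mul _ ((isUnit_iff_isUnit_det _).1 hH.isUnit)
  have hAt := transpose_inv_of_posDef hA
  -- the solution `z` of `H z = v`
  set z₂ := S⁻¹ *ᵥ (v₂ - Bᵀ *ᵥ A⁻¹ *ᵥ v₁) with hz₂
  set z₁ := A⁻¹ *ᵥ (v₁ - B *ᵥ z₂) with hz₁
  have hz : fromBlocks A B Bᵀ D *ᵥ Sum.elim z₁ z₂ = v := by
    rw [fromBlocks_mulVec, hv]
    simp only [Sum.elim_comp_inl, Sum.elim_comp_inr]
    have hD : D *ᵥ z₂ = v₂ - Bᵀ *ᵥ A⁻¹ *ᵥ v₁ + Bᵀ *ᵥ A⁻¹ *ᵥ B *ᵥ z₂ := by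
      have h1 : S *ᵥ z₂ = v₂ - Bᵀ *ᵥ A⁻¹ *ᵥ v₁ := by
        rw [hz₂, mulVec_mulVec, hS1, one_mulVec]
      have h2 : D = S + Bᵀ * A⁻¹ * B := by simp [hSdef]
      rw [h2, add_mulVec, h1]
      simp [mulVec_mulVec, Matrix.mul_assoc]
    congr 1
    · rw [hz₁, mulVec_mulVec, hA1, one_mulVec, sub_add_cancel]
    · rw [hD, hz₁, mulVec_sub, mulVec_sub]
      abel
  have hz' : (fromBlocks A B Bᵀ D)⁻¹ *ᵥ v = Sum.elim z₁ z₂ := by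
    rw [← hz, mulVec_mulVec, hH1, one_mulVec]
  have ht : (Bᵀ *ᵥ A⁻¹ *ᵥ u₁) ⬝ᵥ z₂ = u₁ ⬝ᵥ A⁻¹ *ᵥ B *ᵥ z₂ := by
    rw [dotProduct_comm, dotProduct_mulVec, ← mulVec_transpose, transpose_transpose,
      dotProduct_mulVec, ← mulVec_transpose, hAt, dotProduct_comm]
  rw [hz', hu, sumElim_dotProduct_sumElim, hz₁, sub_dotProduct, ht, mulVec_sub, dotProduct_sub]
  ring

omit [DecidableEq m] [DecidableEq n] in
lemma sum_sum_eq_dotProduct_mulVec_one (M : Matrix m n ℝ) :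
    ∑ i, ∑ j, M i j = 1 ⬝ᵥ M *ᵥ 1 := by
  simp [dotProduct, mulVec]

end Block

/-! ### The density of the `β`-field with boundary -/

section Density

variable {Λ Λ' m n : Type*} [Fintype Λ] [DecidableEq Λ] [Fintype Λ'] [DecidableEq Λ']
  [Fintype m] [Fintype n] [DecidableEq m] [DecidableEq n]

open Classical in
/-- The density, as a function of the matrix `H = H_β`, of the `β`-field with boundary weights `η`:
`(2/π)^(|Λ|/2) 1_{H > 0} exp(-(⟨1, H 1⟩ - 2 ⟨1, η⟩ + ⟨η, H⁻¹ η⟩) / 2) / √(det H)`. Restrictions of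
the field without boundary have densities of this form, where `η i` is the total weight between `i`
and the vertices outside. -/
def betaDensity (H : Matrix Λ Λ ℝ) (η : Λ → ℝ) : ℝ≥0∞ :=
  if H.PosDef then
    ENNReal.ofReal ((2 / Real.pi) ^ ((Fintype.card Λ : ℝ) / 2)
      * (Real.exp (-(∑ i, ∑ j, H i j - 2 * ∑ i, η i + η ⬝ᵥ H⁻¹ *ᵥ η) / 2) / Real.sqrt H.det))
  else 0

lemma betaLaw_eq (W : Matrix Λ Λ ℝ) :
    betaLaw W = (volume : Measure (Λ → ℝ)).withDensity
      fun β => betaDensity (hMatrix W β) 0 := by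
  unfold betaLaw betaDensity
  simp

lemma dotProduct_inv_submatrix_mulVec (e : Λ' ≃ Λ) (H : Matrix Λ Λ ℝ) (u v : Λ → ℝ) :
    (u ∘ e) ⬝ᵥ (H.submatrix e e)⁻¹ *ᵥ (v ∘ e) = u ⬝ᵥ H⁻¹ *ᵥ v := by
  rw [inv_submatrix_equiv, submatrix_mulVec_equiv, Function.comp_assoc, e.self_comp_symm,
    Function.comp_id, comp_equiv_dotProduct_comp_equiv]

omit [Fintype Λ] [DecidableEq Λ] [Fintype Λ'] [DecidableEq Λ'] in
lemma posDef_submatrix_equiv (e : Λ' ≃ Λ) (H : Matrix Λ Λ ℝ) :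
    (H.submatrix e e).PosDef ↔ H.PosDef := by
  constructor
  · intro h
    simpa using h.submatrix (e := e.symm) e.symm.injective
  · exact fun h => h.submatrix e.injective

lemma betaDensity_submatrix (e : Λ' ≃ Λ) (H : Matrix Λ Λ ℝ) (η : Λ → ℝ) :
    betaDensity (H.submatrix e e) (η ∘ e) = betaDensity H η := by
  have h1 := posDef_submatrix_equiv e H
  have h2 : ∑ i, ∑ j, (H.submatrix e e) i j = ∑ i, ∑ j, H i j := by
    rw [← e.sum_comp]
    exact Finset.sum_congr rfl fun i _ => e.sum_comp (fun j => H (e i) j)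
  have h3 : ∑ i, (η ∘ e) i = ∑ i, η i := e.sum_comp η
  have h4 := dotProduct_inv_submatrix_mulVec e H η η
  unfold betaDensity
  rw [h2, h3, h4, det_submatrix_equiv_self, Fintype.card_congr e]
  by_cases hH : H.PosDef
  · rw [if_pos hH, if_pos (h1.2 hH)]
  · rw [if_neg hH, if_neg (mt h1.1 hH)]

/-- Elimination of a block: the density of the `β`-field factorizes into the density on the first
block and the density, with effective weights, on the second block. -/
lemma betaDensity_fromBlocks (A : Matrix m m ℝ) (B : Matrix m n ℝ) (D : Matrix n n ℝ)
    (η : m ⊕ n → ℝ) :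
    betaDensity (fromBlocks A B Bᵀ D) η =
      betaDensity A (η ∘ Sum.inl - B *ᵥ 1) *
        betaDensity (D - Bᵀ * A⁻¹ * B) (η ∘ Sum.inr - Bᵀ *ᵥ A⁻¹ *ᵥ (η ∘ Sum.inl)) := by
  by_cases hH : (fromBlocks A B Bᵀ D).PosDef
  swap
  · unfold betaDensity
    rw [if_neg hH]
    rw [posDef_fromBlocks_iff] at hH
    by_cases hA : A.PosDef
    · rw [if_neg (c := (D - Bᵀ * A⁻¹ * B).PosDef) fun h => hH ⟨hA, h⟩, mul_zero]
    · rw [if_neg hA, zero_mul]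
  obtain ⟨hA, hS⟩ := (posDef_fromBlocks_iff A B D).1 hH
  have hpi : 0 < 2 / Real.pi := by positivity
  have hdA := hA.det_pos
  have hdS := hS.det_pos
  have hdet : (fromBlocks A B Bᵀ D).det = A.det * (D - Bᵀ * A⁻¹ * B).det := by
    let _ := hA.isUnit.invertible
    rw [det_fromBlocks₁₁, invOf_eq_nonsing_inv]
  have hAt := transpose_inv_of_posDef hA
  have hexp : ∑ i, ∑ j, fromBlocks A B Bᵀ D i j - 2 * ∑ i, η i
        + η ⬝ᵥ (fromBlocks A B Bᵀ D)⁻¹ *ᵥ η =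
      (∑ i, ∑ j, A i j - 2 * ∑ i, (η ∘ Sum.inl - B *ᵥ 1) i
        + (η ∘ Sum.inl - B *ᵥ 1) ⬝ᵥ A⁻¹ *ᵥ (η ∘ Sum.inl - B *ᵥ 1))
      + (∑ i, ∑ j, (D - Bᵀ * A⁻¹ * B) i j
        - 2 * ∑ i, (η ∘ Sum.inr - Bᵀ *ᵥ A⁻¹ *ᵥ (η ∘ Sum.inl)) i
        + (η ∘ Sum.inr - Bᵀ *ᵥ A⁻¹ *ᵥ (η ∘ Sum.inl)) ⬝ᵥ (D - Bᵀ * A⁻¹ * B)⁻¹ *ᵥ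
          (η ∘ Sum.inr - Bᵀ *ᵥ A⁻¹ *ᵥ (η ∘ Sum.inl))) := by
    rw [dotProduct_inv_fromBlocks_mulVec A B D hH η η]
    set η₁ := η ∘ Sum.inl
    set η₂ := η ∘ Sum.inr
    have hs₁ (f : m → ℝ) : ∑ i, f i = 1 ⬝ᵥ f := by simp [dotProduct]
    have hs₂ (f : n → ℝ) : ∑ i, f i = 1 ⬝ᵥ f := by simp [dotProduct]
    have h1 : ∑ i, ∑ j, fromBlocks A B Bᵀ D i j
        = 1 ⬝ᵥ A *ᵥ 1 + 1 ⬝ᵥ B *ᵥ 1 + (1 ⬝ᵥ B *ᵥ 1 + 1 ⬝ᵥ D *ᵥ 1) := by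
      simp only [Fintype.sum_sum_type, fromBlocks_apply₁₁, fromBlocks_apply₁₂,
        fromBlocks_apply₂₁, fromBlocks_apply₂₂, Finset.sum_add_distrib,
        ← sum_sum_eq_dotProduct_mulVec_one, transpose_apply]
      rw [Finset.sum_comm (f := fun (x : n) (y : m) => B y x)]
    have h2 : ∑ i, η i = 1 ⬝ᵥ η₁ + 1 ⬝ᵥ η₂ := by
      simp [Fintype.sum_sum_type, η₁, η₂, dotProduct]
    have h3 : (1 : n → ℝ) ⬝ᵥ Bᵀ *ᵥ A⁻¹ *ᵥ η₁ = η₁ ⬝ᵥ A⁻¹ *ᵥ B *ᵥ 1 := by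
      rw [dotProduct_mulVec, ← mulVec_transpose, transpose_transpose, dotProduct_mulVec,
        ← mulVec_transpose, hAt, dotProduct_comm]
    have h4 : (1 : n → ℝ) ⬝ᵥ (Bᵀ * A⁻¹ * B) *ᵥ 1 = (B *ᵥ 1) ⬝ᵥ A⁻¹ *ᵥ B *ᵥ 1 := by
      rw [← mulVec_mulVec, ← mulVec_mulVec, dotProduct_mulVec, ← mulVec_transpose,
        transpose_transpose]
    have h5 : (B *ᵥ 1) ⬝ᵥ A⁻¹ *ᵥ η₁ = η₁ ⬝ᵥ A⁻¹ *ᵥ B *ᵥ 1 := by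
      rw [dotProduct_mulVec, ← mulVec_transpose, hAt, dotProduct_comm]
    rw [h1, h2, sum_sum_eq_dotProduct_mulVec_one A, hs₁ (η₁ - B *ᵥ 1),
      sum_sum_eq_dotProduct_mulVec_one, hs₂ (η₂ - Bᵀ *ᵥ A⁻¹ *ᵥ η₁)]
    simp only [sub_mulVec, mulVec_sub, dotProduct_sub, sub_dotProduct, h3, h4, h5]
    ring
  unfold betaDensity
  rw [if_pos hH, if_pos hA, if_pos hS, ← ENNReal.ofReal_mul (by positivity), hexp, hdet,
    Real.sqrt_mul hdA.le, neg_add, add_div, Real.exp_add, Fintype.card_sum, Nat.cast_add, add_div,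
    Real.rpow_add hpi]
  congr 1
  field_simp

end Density

end VRJP

namespace VRJP

/-! ### Reciprocal inverse Gaussian variables -/

section ReciprocalInverseGaussian

open Set Real

/-- The density `(2πh)^(-1/2) exp(-(h - η)² / (2h))`, `h > 0`, of the reciprocal inverse Gaussian law
with parameter `η`. It vanishes for `h ≤ 0` because then `√(2πh) = 0`. -/
def rigDensity (η h : ℝ) : ℝ≥0∞ :=
  ENNReal.ofReal ((√(2 * π * h))⁻¹ * exp (-(h - η) ^ 2 / (2 * h)))

lemma rigDensity_of_nonpos (η : ℝ) {h : ℝ} (hh : h ≤ 0) : rigDensity η h = 0 := by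
  have : 2 * π * h ≤ 0 := mul_nonpos_of_nonneg_of_nonpos (by positivity) hh
  simp [rigDensity, Real.sqrt_eq_zero_of_nonpos this]

lemma measurable_rigDensity_uncurry : Measurable fun x : ℝ × ℝ => rigDensity x.1 x.2 := by
  unfold rigDensity
  fun_prop

lemma measurable_rigDensity (η : ℝ) : Measurable (rigDensity η) := by
  unfold rigDensity
  fun_prop

lemma lintegral_mul_rigDensity_eq_setLIntegral (η : ℝ) (F : ℝ → ℝ≥0∞) :
    ∫⁻ h, F h * rigDensity η h = ∫⁻ h in Ioi 0, F h * rigDensity η h := by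
  rw [← lintegral_indicator measurableSet_Ioi]
  congr 1
  ext h
  by_cases hh : 0 < h
  · rw [indicator_of_mem (mem_Ioi.2 hh)]
  · rw [indicator_of_notMem (by simpa using hh), rigDensity_of_nonpos η (not_lt.1 hh), mul_zero]

/-- The substitution `t = (h - η) / √h` turns the Gaussian density into
`(1 + η / h) / 2` times the reciprocal inverse Gaussian density. -/
lemma lintegral_gaussian_eq_lintegral_rigDensity {η : ℝ} (hη : 0 < η) (G : ℝ → ℝ≥0∞) :
    ∫⁻ t, G t * gaussianPDF 0 1 t =
      ∫⁻ h in Ioi 0, ENNReal.ofReal ((1 + η / h) / 2) * G ((h - η) / √h) * rigDensity η h := by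
  have hder : ∀ h ∈ Ioi (0 : ℝ), HasDerivWithinAt (fun h => (h - η) / √h)
      ((1 + η / h) / 2 * (√h)⁻¹) (Ioi 0) h := by
    intro h hh
    have hh : 0 < h := hh
    have hs : 0 < √h := Real.sqrt_pos.2 hh
    have h1 := ((hasDerivAt_id h).sub_const η).div (Real.hasDerivAt_sqrt hh.ne') hs.ne'
    refine (h1.congr_deriv ?_).hasDerivWithinAt
    have h2 : h = √h * √h := (Real.mul_self_sqrt hh.le).symm
    simp only [id]
    field_simp
    nlinarith [Real.sq_sqrt hh.le]
  have hmono : StrictMonoOn (fun h => (h - η) / √h) (Ioi 0) := by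
    intro a ha b hb hab
    have ha : 0 < a := ha
    have hb : 0 < b := hb
    have hsa : 0 < √a := Real.sqrt_pos.2 ha
    have hsab : √a < √b := Real.sqrt_lt_sqrt ha.le hab
    have h1 (x : ℝ) (hx : 0 < x) : (x - η) / √x = √x - η / √x := by
      rw [sub_div, Real.div_sqrt]
    simp only [h1 a ha, h1 b hb]
    have : η / √b < η / √a := div_lt_div_of_pos_left hη hsa hsab
    linarith
  have himg : (fun h => (h - η) / √h) '' Ioi 0 = univ := by
    refine eq_univ_of_forall fun t => ?_
    -- `√h = (t + √(t² + 4η)) / 2` solves `√h - η / √h = t`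
    set s := (t + √(t ^ 2 + 4 * η)) / 2 with hs
    have hq : √(t ^ 2 + 4 * η) ^ 2 = t ^ 2 + 4 * η := Real.sq_sqrt (by positivity)
    have hlt : |t| < √(t ^ 2 + 4 * η) := by
      rw [← Real.sqrt_sq_eq_abs]
      exact Real.sqrt_lt_sqrt (sq_nonneg t) (by linarith)
    have hs0 : 0 < s := by
      have := neg_abs_le t
      rw [hs]
      linarith
    refine ⟨s ^ 2, mem_Ioi.2 (by positivity), ?_⟩
    simp only [Real.sqrt_sq hs0.le]
    rw [div_eq_iff hs0.ne', hs]
    nlinarith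
  rw [← setLIntegral_univ, ← himg,
    lintegral_image_eq_lintegral_abs_deriv_mul measurableSet_Ioi hder hmono.injOn]
  refine setLIntegral_congr_fun measurableSet_Ioi fun h hh => ?_
  have hh : 0 < h := hh
  have hs : 0 < √h := Real.sqrt_pos.2 hh
  have h0 : 0 ≤ (1 + η / h) / 2 := by positivity
  rw [abs_of_nonneg (by positivity), ENNReal.ofReal_mul h0, mul_assoc, mul_assoc]
  congr 1
  rw [mul_left_comm]
  congr 1
  unfold gaussianPDF gaussianPDFReal rigDensity
  rw [← ENNReal.ofReal_mul (by positivity)]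
  congr 1
  rw [Real.sqrt_mul (by positivity) h, mul_inv]
  have h2 : -((h - η) / √h - 0) ^ 2 / (2 * ((1 : NNReal) : ℝ)) = -(h - η) ^ 2 / (2 * h) := by
    rw [sub_zero, div_pow, Real.sq_sqrt hh.le, NNReal.coe_one]
    field_simp
  rw [h2]
  simp only [NNReal.coe_one, mul_one]
  ring

/-- The substitution `h ↦ η² / h`. -/
lemma lintegral_rigDensity_eq_lintegral_inv {η : ℝ} (hη : 0 < η) :
    ∫⁻ h in Ioi 0, rigDensity η h = ∫⁻ h in Ioi 0, ENNReal.ofReal (η / h) * rigDensity η h := by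
  have hder : ∀ h ∈ Ioi (0 : ℝ), HasDerivWithinAt (fun h => η ^ 2 / h)
      (-(η ^ 2 / h ^ 2)) (Ioi 0) h := by
    intro h hh
    have hh : 0 < h := hh
    have h1 := (hasDerivAt_const h (η ^ 2)).div (hasDerivAt_id h) hh.ne'
    refine (h1.congr_deriv ?_).hasDerivWithinAt
    simp [neg_div]
  have hinj : InjOn (fun h => η ^ 2 / h) (Ioi 0) := by
    intro a ha b hb hab
    have ha : 0 < a := ha
    have hb : 0 < b := hb
    have hη2 : η ^ 2 ≠ 0 := by positivity
    simp only at hab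
    rw [div_eq_div_iff ha.ne' hb.ne'] at hab
    exact (mul_left_cancel₀ hη2 hab).symm
  have himg : (fun h => η ^ 2 / h) '' Ioi 0 = Ioi 0 := by
    ext t
    constructor
    · rintro ⟨h, hh, rfl⟩
      have hh : 0 < h := hh
      exact mem_Ioi.2 (by positivity)
    · intro ht
      have ht : 0 < t := ht
      exact ⟨η ^ 2 / t, mem_Ioi.2 (by positivity), by field_simp⟩
  conv_lhs => rw [← himg]
  rw [lintegral_image_eq_lintegral_abs_deriv_mul measurableSet_Ioi hder hinj]
  refine setLIntegral_congr_fun measurableSet_Ioi fun h hh => ?_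
  have hh : 0 < h := hh
  have hs : 0 < √h := Real.sqrt_pos.2 hh
  unfold rigDensity
  rw [abs_neg, abs_of_nonneg (by positivity), ← ENNReal.ofReal_mul (by positivity),
    ← ENNReal.ofReal_mul (by positivity)]
  congr 1
  have h1 : √(2 * π * (η ^ 2 / h)) = η * √(2 * π) / √h := by
    rw [show 2 * π * (η ^ 2 / h) = η ^ 2 * (2 * π) / h by ring, Real.sqrt_div (by positivity),
      Real.sqrt_mul (by positivity), Real.sqrt_sq hη.le]
  have h2 : -(η ^ 2 / h - η) ^ 2 / (2 * (η ^ 2 / h)) = -(h - η) ^ 2 / (2 * h) := by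
    field_simp
    ring
  have h3 : 0 < √(2 * π) := Real.sqrt_pos.2 (by positivity)
  rw [h1, h2, Real.sqrt_mul (by positivity) h]
  field_simp
  rw [Real.sq_sqrt hh.le]

/-- The Gaussian substitution shows that the two integrals add up to `2`, and the inversion
`h ↦ η ^ 2 / h` exchanges them. -/
lemma lintegral_rigDensity_and_inv {η : ℝ} (hη : 0 < η) :
    ∫⁻ h, rigDensity η h = 1 ∧ ∫⁻ h, ENNReal.ofReal (η / h) * rigDensity η h = 1 := by
  have e1 : ∫⁻ h, rigDensity η h = ∫⁻ h in Ioi 0, rigDensity η h := by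
    simpa using lintegral_mul_rigDensity_eq_setLIntegral η (fun _ => 1)
  rw [lintegral_mul_rigDensity_eq_setLIntegral, e1, ← lintegral_rigDensity_eq_lintegral_inv hη]
  have h1 := lintegral_gaussian_eq_lintegral_rigDensity hη (fun _ => 1)
  simp only [one_mul, mul_one, lintegral_gaussianPDF_eq_one 0 one_ne_zero] at h1
  have h2 : ∫⁻ h in Ioi 0, ENNReal.ofReal ((1 + η / h) / 2) * rigDensity η h
      = ∫⁻ h in Ioi 0, (2⁻¹ * rigDensity η h + 2⁻¹ * (ENNReal.ofReal (η / h) * rigDensity η h)) := by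
    refine setLIntegral_congr_fun measurableSet_Ioi fun h hh => ?_
    have hh : 0 < h := hh
    rw [show (1 + η / h) / 2 = 2⁻¹ * 1 + 2⁻¹ * (η / h) by ring,
      ENNReal.ofReal_add (by positivity) (by positivity), ENNReal.ofReal_mul (by positivity),
      ENNReal.ofReal_mul (by positivity), ENNReal.ofReal_inv_of_pos two_pos]
    simp [add_mul, mul_assoc]
  rw [h2, lintegral_add_left ((measurable_rigDensity η).const_mul _),
    lintegral_const_mul _ (measurable_rigDensity η),
    lintegral_const_mul _ (by have := measurable_rigDensity η; fun_prop),
    ← lintegral_rigDensity_eq_lintegral_inv hη, ← add_mul, ENNReal.inv_two_add_inv_two, one_mul]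
    at h1
  exact ⟨h1.symm, h1.symm⟩

lemma lintegral_rigDensity {η : ℝ} (hη : 0 < η) : ∫⁻ h, rigDensity η h = 1 :=
  (lintegral_rigDensity_and_inv hη).1

lemma lintegral_div_mul_rigDensity {η : ℝ} (hη : 0 < η) :
    ∫⁻ h, ENNReal.ofReal (η / h) * rigDensity η h = 1 :=
  (lintegral_rigDensity_and_inv hη).2

/-- The moments of negative order of `2 · Gamma(1/2)`, the limit `η → 0` of the reciprocal inverse
Gaussian law. -/
lemma lintegral_rpow_neg_mul_rigDensity_zero {α : ℝ} (hα : α < 1 / 2) :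
    ∫⁻ h, ENNReal.ofReal (h ^ (-α)) * rigDensity 0 h = ENNReal.ofReal (cAlpha α) := by
  have hG : 0 < Gamma (1 / 2 - α) := Gamma_pos_of_pos (by linarith)
  have h1 : ∫ h in Ioi (0 : ℝ), h ^ ((1 / 2 - α) - 1) * exp (-((1 / 2) * h))
      = (1 / (1 / 2)) ^ (1 / 2 - α) * Gamma (1 / 2 - α) :=
    integral_rpow_mul_exp_neg_mul_Ioi (by linarith) (by norm_num)
  have h2 : IntegrableOn (fun h : ℝ => h ^ ((1 / 2 - α) - 1) * exp (-((1 / 2) * h))) (Ioi 0) := by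
    by_contra h
    rw [IntegrableOn] at h
    rw [integral_undef h] at h1
    have : (0 : ℝ) < (1 / (1 / 2)) ^ (1 / 2 - α) * Gamma (1 / 2 - α) := by positivity
    linarith
  have h3 : ∀ h ∈ Ioi (0 : ℝ), ENNReal.ofReal (h ^ (-α)) * rigDensity 0 h
      = ENNReal.ofReal ((√(2 * π))⁻¹) *
        ENNReal.ofReal (h ^ ((1 / 2 - α) - 1) * exp (-((1 / 2) * h))) := by
    intro h hh
    have hh : 0 < h := hh
    unfold rigDensity
    rw [← ENNReal.ofReal_mul (by positivity), ← ENNReal.ofReal_mul (by positivity)]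
    congr 1
    have h4 : -(h - 0) ^ 2 / (2 * h) = -((1 / 2) * h) := by
      field_simp
      ring
    have h5 : h ^ ((1 / 2 - α) - 1) = h ^ (-α) * (√h)⁻¹ := by
      rw [Real.sqrt_eq_rpow, ← Real.rpow_neg hh.le, ← Real.rpow_add hh]
      congr 1
      ring
    rw [h4, h5, Real.sqrt_mul (by positivity) h, mul_inv]
    ring
  rw [lintegral_mul_rigDensity_eq_setLIntegral, setLIntegral_congr_fun measurableSet_Ioi h3,
    lintegral_const_mul' _ _ ENNReal.ofReal_ne_top,
    ← ofReal_integral_eq_lintegral_ofReal h2, h1, ← ENNReal.ofReal_mul (by positivity)]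
  · congr 1
    unfold cAlpha
    have h6 : (2 : ℝ) ^ (1 / 2 - α) = √2 * 2 ^ (-α) := by
      rw [Real.sqrt_eq_rpow, ← Real.rpow_add two_pos]
      congr 1
    rw [one_div_one_div, h6, Real.sqrt_mul (by norm_num) π]
    have : 0 < √π := Real.sqrt_pos.2 pi_pos
    field_simp
  · refine (ae_restrict_iff' measurableSet_Ioi).2 (.of_forall fun h hh => ?_)
    have hh : 0 < h := hh
    simp only [Pi.zero_apply]
    positivity

lemma cAlpha_zero : cAlpha 0 = 1 := by
  have : 0 < √π := Real.sqrt_pos.2 pi_pos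
  unfold cAlpha
  rw [sub_zero, Gamma_one_half_eq, neg_zero, rpow_zero, one_mul, div_self this.ne']

lemma lintegral_rigDensity_zero : ∫⁻ h, rigDensity 0 h = 1 := by
  have := lintegral_rpow_neg_mul_rigDensity_zero (α := 0) (by norm_num)
  simpa [cAlpha_zero] using this

lemma lintegral_rigDensity_le_one (η : ℝ) : ∫⁻ h, rigDensity η h ≤ 1 := by
  have h1 : ∫⁻ h, rigDensity |η| h = 1 := by
    rcases eq_or_ne η 0 with rfl | hη
    · simpa using lintegral_rigDensity_zero
    · exact lintegral_rigDensity (abs_pos.2 hη)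
  rw [← h1]
  refine lintegral_mono fun h => ?_
  rcases le_or_gt h 0 with hh | hh
  · simp [rigDensity_of_nonpos _ hh]
  unfold rigDensity
  refine ENNReal.ofReal_le_ofReal ?_
  gcongr ?_ * exp (?_ / _)
  have : η * h ≤ |η| * h := mul_le_mul_of_nonneg_right (le_abs_self η) hh.le
  nlinarith [sq_abs η]

end ReciprocalInverseGaussian

end VRJP

namespace VRJP

/-! ### Moments of reciprocal inverse Gaussian variables -/

section ReciprocalInverseGaussianMoments

open Set Real Filter Topology

lemma lintegral_sq_mul_gaussianPDF :
    ∫⁻ t, ENNReal.ofReal (t ^ 2) * gaussianPDF 0 1 t = 1 := by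
  have h1 : ∫⁻ t, ENNReal.ofReal (t ^ 2) ∂(gaussianReal 0 1) = 1 := by
    have h2 := evariance_eq_lintegral_ofReal id (gaussianReal 0 1)
    rw [← (memLp_id_gaussianReal 2).ofReal_variance_eq, variance_id_gaussianReal] at h2
    simpa using h2.symm
  rw [gaussianReal_of_var_ne_zero _ one_ne_zero,
    lintegral_withDensity_eq_lintegral_mul _ (measurable_gaussianPDF 0 1) (by fun_prop)] at h1
  rw [← h1]
  refine lintegral_congr fun t => ?_
  rw [Pi.mul_apply, mul_comm]

/-- A bound, up to a factor `2`, for the mean `1 + η` of the reciprocal inverse Gaussian law. -/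
lemma lintegral_mul_rigDensity_le {η : ℝ} (hη : 0 < η) :
    ∫⁻ h, ENNReal.ofReal h * rigDensity η h ≤ ENNReal.ofReal (2 + 2 * η) := by
  have h1 := lintegral_gaussian_eq_lintegral_rigDensity hη (fun t => ENNReal.ofReal (t ^ 2))
  rw [lintegral_sq_mul_gaussianPDF] at h1
  have hm := measurable_rigDensity η
  have h2 : ∫⁻ h in Ioi 0, ENNReal.ofReal h * rigDensity η h ≤
      ∫⁻ h in Ioi 0, (ENNReal.ofReal (2 * η) * rigDensity η h + 2 * (ENNReal.ofReal
        ((1 + η / h) / 2) * ENNReal.ofReal (((h - η) / √h) ^ 2) * rigDensity η h)) := by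
    refine setLIntegral_mono' measurableSet_Ioi fun h hh => ?_
    have hh : 0 < h := hh
    have h3 : h ≤ 2 * η + 2 * ((1 + η / h) / 2 * ((h - η) / √h) ^ 2) := by
      rw [div_pow, Real.sq_sqrt hh.le]
      have h4 : 2 * η + (h - η) ^ 2 / h = h + η ^ 2 / h := by
        field_simp
        ring
      have h5 : 0 ≤ η / h * ((h - η) ^ 2 / h) := by positivity
      have h6 : 0 ≤ η ^ 2 / h := by positivity
      nlinarith
    have h4 : ENNReal.ofReal h ≤ ENNReal.ofReal (2 * η) + 2 * (ENNReal.ofReal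
        ((1 + η / h) / 2) * ENNReal.ofReal (((h - η) / √h) ^ 2)) := by
      refine (ENNReal.ofReal_le_ofReal h3).trans ?_
      rw [ENNReal.ofReal_add (by positivity) (by positivity),
        ENNReal.ofReal_mul (p := 2) (q := _ * _) two_pos.le,
        ENNReal.ofReal_mul (p := (1 + η / h) / 2) (by positivity), ENNReal.ofReal_ofNat]
    calc ENNReal.ofReal h * rigDensity η h ≤ _ := mul_le_mul_left h4 _
      _ = _ := by rw [add_mul]; ring
  rw [lintegral_mul_rigDensity_eq_setLIntegral]
  refine h2.trans ?_
  rw [lintegral_add_left (by fun_prop), lintegral_const_mul _ (by fun_prop),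
    lintegral_const_mul _ (by fun_prop), ← h1, ENNReal.ofReal_add (by norm_num) (by positivity)]
  have h7 : ∫⁻ h in Ioi 0, rigDensity η h ≤ 1 :=
    (setLIntegral_le_lintegral _ _).trans (lintegral_rigDensity_le_one η)
  calc _ ≤ ENNReal.ofReal (2 * η) * 1 + 2 * 1 := by gcongr
    _ = _ := by simp [add_comm]

/-- The likelihood ratio of the reciprocal inverse Gaussian law with respect to its limit `η = 0`
is increasing, so that a decreasing function has the larger expectation in the limit. -/
lemma lintegral_rpow_neg_mul_rigDensity_le {α η : ℝ} (hα : 0 ≤ α) (hα' : α < 1 / 2) (hη : 0 < η) :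
    ∫⁻ h, ENNReal.ofReal (h ^ (-α)) * rigDensity η h ≤ ENNReal.ofReal (cAlpha α) := by
  -- the two densities agree at `h = η / 2`
  set c := ENNReal.ofReal ((η / 2) ^ (-α)) with hc
  have hpt : ∀ h ∈ Ioi (0 : ℝ),
      ENNReal.ofReal (h ^ (-α)) * rigDensity η h + c * rigDensity 0 h
        ≤ ENNReal.ofReal (h ^ (-α)) * rigDensity 0 h + c * rigDensity η h := by
    intro h hh
    have hh : 0 < h := hh
    have hη2 : 0 < η / 2 := by positivity
    rcases le_total h (η / 2) with hle | hle
    · have h1 : rigDensity η h ≤ rigDensity 0 h := by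
        unfold rigDensity
        refine ENNReal.ofReal_le_ofReal ?_
        gcongr ?_ * exp (?_ / _)
        nlinarith
      have h2 : c ≤ ENNReal.ofReal (h ^ (-α)) :=
        ENNReal.ofReal_le_ofReal (Real.rpow_le_rpow_of_nonpos hh hle (by linarith))
      obtain ⟨d, hd⟩ := exists_add_of_le h1
      rw [hd]
      calc _ = ENNReal.ofReal (h ^ (-α)) * rigDensity η h + c * rigDensity η h + c * d := by ring
        _ ≤ ENNReal.ofReal (h ^ (-α)) * rigDensity η h + c * rigDensity η h
            + ENNReal.ofReal (h ^ (-α)) * d := by gcongr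
        _ = _ := by ring
    · have h1 : rigDensity 0 h ≤ rigDensity η h := by
        unfold rigDensity
        refine ENNReal.ofReal_le_ofReal ?_
        gcongr ?_ * exp (?_ / _)
        nlinarith
      have h2 : ENNReal.ofReal (h ^ (-α)) ≤ c :=
        ENNReal.ofReal_le_ofReal (Real.rpow_le_rpow_of_nonpos hη2 hle (by linarith))
      obtain ⟨d, hd⟩ := exists_add_of_le h1
      rw [hd]
      calc _ = ENNReal.ofReal (h ^ (-α)) * rigDensity 0 h + c * rigDensity 0 h
            + ENNReal.ofReal (h ^ (-α)) * d := by ring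
        _ ≤ ENNReal.ofReal (h ^ (-α)) * rigDensity 0 h + c * rigDensity 0 h + c * d := by gcongr
        _ = _ := by ring
  have hm := measurable_rigDensity η
  have hm0 := measurable_rigDensity 0
  have h1 := setLIntegral_mono' (μ := volume) measurableSet_Ioi hpt
  rw [lintegral_add_right _ (by fun_prop), lintegral_add_right _ (by fun_prop),
    ← lintegral_mul_rigDensity_eq_setLIntegral, ← lintegral_mul_rigDensity_eq_setLIntegral,
    ← lintegral_mul_rigDensity_eq_setLIntegral, ← lintegral_mul_rigDensity_eq_setLIntegral,
    lintegral_const_mul _ hm, lintegral_const_mul _ hm0, lintegral_rigDensity hη,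
    lintegral_rigDensity_zero, lintegral_rpow_neg_mul_rigDensity_zero hα'] at h1
  exact (ENNReal.add_le_add_iff_right (by simp [hc])).1 h1

lemma cAlpha_pos {α : ℝ} (hα : α < 1 / 2) : 0 < cAlpha α := by
  have hG : 0 < Gamma (1 / 2 - α) := Gamma_pos_of_pos (by linarith)
  have : 0 < √π := Real.sqrt_pos.2 pi_pos
  unfold cAlpha
  positivity

lemma hasDerivAt_cAlpha_zero : HasDerivAt cAlpha cTwo 0 := by
  have hπ : 0 < √π := Real.sqrt_pos.2 pi_pos
  have h1 : HasDerivAt (fun α : ℝ => (2 : ℝ) ^ (-α)) (-log 2) 0 := by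
    have := (hasDerivAt_neg (0 : ℝ)).const_rpow (a := 2) two_pos
    simpa using this
  have h2 : HasDerivAt (fun α : ℝ => Gamma (1 / 2 - α))
      (√π * (eulerMascheroniConstant + 2 * log 2)) 0 := by
    have h3 : HasDerivAt (fun α : ℝ => 1 / 2 - α) (-1) 0 := (hasDerivAt_id (0 : ℝ)).const_sub _
    have h4 : HasDerivAt Gamma (-√π * (eulerMascheroniConstant + 2 * log 2)) (1 / 2 - 0) := by
      simpa using hasDerivAt_Gamma_one_half
    refine (h4.comp 0 h3).congr_deriv ?_
    ring
  have h5 := (h1.mul h2).div_const (√π)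
  refine h5.congr_deriv ?_
  rw [sub_zero, Gamma_one_half_eq, neg_zero, rpow_zero, cTwo]
  field_simp
  ring

/-- The constant `c₂` is the derivative of `log C_α` at `α = 0`. -/
lemma exists_log_cAlpha_div_le {ε : ℝ} (hε : 0 < ε) :
    ∃ α, 0 < α ∧ α < 1 / 2 ∧ log (cAlpha α) / α ≤ cTwo + ε := by
  have h1 : HasDerivAt (fun α => log (cAlpha α)) cTwo 0 := by
    have := hasDerivAt_cAlpha_zero.log (by simp [cAlpha_zero])
    simpa [cAlpha_zero] using this
  have h2 := (hasDerivAt_iff_tendsto_slope_zero.1 h1).mono_left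
    (nhdsWithin_mono 0 (fun x (hx : x ∈ Ioi 0) => (ne_of_gt hx)))
  have h3 := h2.eventually (gt_mem_nhds (show cTwo < cTwo + ε by linarith))
  have h4 : ∀ᶠ α : ℝ in 𝓝[>] 0, α ∈ Ioo (0 : ℝ) (1 / 2) := Ioo_mem_nhdsGT (by norm_num)
  obtain ⟨α, ha, hb⟩ := (h3.and h4).exists
  refine ⟨α, hb.1, hb.2, ?_⟩
  simp only [zero_add, cAlpha_zero, log_one, sub_zero, smul_eq_mul] at ha
  rw [div_eq_inv_mul]
  exact ha.le

lemma cTwo_pos : 0 < cTwo := by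
  have h1 := one_half_lt_eulerMascheroniConstant
  have h2 := log_pos one_lt_two
  unfold cTwo
  linarith

end ReciprocalInverseGaussianMoments

end VRJP

namespace VRJP

open Matrix

/-! ### Integration of the `β`-field, block by block -/

section Integration

variable {Λ m n : Type*} [Fintype Λ] [DecidableEq Λ] [Fintype m] [DecidableEq m]
  [Fintype n] [DecidableEq n] {X : Type*} [MeasurableSpace X]

omit [Fintype n] [DecidableEq n] [DecidableEq m] [Fintype m] in
lemma measurable_matrix_det {H : X → Matrix Λ Λ ℝ} (hH : ∀ i j, Measurable fun x => H x i j) :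
    Measurable fun x => (H x).det := by
  have h1 : Measurable fun M : Λ → Λ → ℝ => (Matrix.of M).det :=
    (Continuous.matrix_det (by fun_prop)).measurable
  exact h1.comp (measurable_pi_lambda _ fun i => measurable_pi_lambda _ fun j => hH i j)

lemma measurable_matrix_inv {H : X → Matrix Λ Λ ℝ} (hH : ∀ i j, Measurable fun x => H x i j)
    (i j : Λ) : Measurable fun x => (H x)⁻¹ i j := by
  have h1 : Measurable fun M : Λ → Λ → ℝ => (Matrix.of M).adjugate i j := by
    have : Continuous fun M : Λ → Λ → ℝ => (Matrix.of M).adjugate :=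
      Continuous.matrix_adjugate (by fun_prop)
    exact (this.matrix_elem i j).measurable
  have h2 := h1.comp (measurable_pi_lambda _ fun i => measurable_pi_lambda _ fun j => hH i j)
  have h3 : (fun x => (H x)⁻¹ i j) = fun x => ((H x).det)⁻¹ * (H x).adjugate i j := by
    ext x
    rw [inv_def, Matrix.smul_apply, Ring.inverse_eq_inv', smul_eq_mul]
  rw [h3]
  exact (measurable_matrix_det hH).inv.mul h2

lemma measurableSet_posDef {H : X → Matrix Λ Λ ℝ} (hH : ∀ i j, Measurable fun x => H x i j) :
    MeasurableSet {x | (H x).PosDef} := by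
  have h1 : IsClosed {M : Λ → Λ → ℝ | (Matrix.of M).PosSemidef} := by
    have : {M : Λ → Λ → ℝ | (Matrix.of M).PosSemidef} =
        {M | (Matrix.of M)ᵀ = Matrix.of M} ∩ ⋂ v : Λ → ℝ, {M | 0 ≤ v ⬝ᵥ Matrix.of M *ᵥ v} := by
      ext M
      simp only [Set.mem_ofPred_eq, posSemidef_iff_dotProduct_mulVec, IsHermitian, star_trivial,
        Set.mem_inter_iff, Set.mem_iInter, conjTranspose_eq_transpose_of_trivial]
    rw [this]
    refine IsClosed.inter ?_ (isClosed_iInter fun v => ?_)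
    · exact isClosed_eq (by fun_prop) (by fun_prop)
    · exact isClosed_le (by fun_prop) (by unfold mulVec dotProduct; fun_prop)
  have h2 : MeasurableSet {x | (H x).PosSemidef} :=
    h1.measurableSet.preimage
      (measurable_pi_lambda _ fun i => measurable_pi_lambda _ fun j => hH i j)
  have h3 : {x | (H x).PosDef} = {x | (H x).PosSemidef} ∩ {x | (H x).det ≠ 0} := by
    ext x
    constructor
    · intro (h : (H x).PosDef)
      exact ⟨h.posSemidef, h.det_pos.ne'⟩
    · rintro ⟨h, h'⟩
      exact h.posDef_iff_det_ne_zero.2 h'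
  rw [h3]
  exact h2.inter (measurable_matrix_det hH (measurableSet_singleton 0).compl)

lemma measurable_dotProduct_inv_mulVec {H : X → Matrix Λ Λ ℝ}
    (hH : ∀ i j, Measurable fun x => H x i j) {u v : X → Λ → ℝ} (hu : ∀ i, Measurable fun x => u x i)
    (hv : ∀ i, Measurable fun x => v x i) : Measurable fun x => u x ⬝ᵥ (H x)⁻¹ *ᵥ v x := by
  unfold dotProduct mulVec dotProduct
  exact Finset.measurable_sum _ fun i _ => (hu i).mul
    (Finset.measurable_sum _ fun j _ => (measurable_matrix_inv hH i j).mul (hv j))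

lemma measurable_betaDensity {H : X → Matrix Λ Λ ℝ} (hH : ∀ i j, Measurable fun x => H x i j)
    {η : X → Λ → ℝ} (hη : ∀ i, Measurable fun x => η x i) :
    Measurable fun x => betaDensity (H x) (η x) := by
  have h1 := measurable_dotProduct_inv_mulVec hH hη hη
  have h2 := measurable_matrix_det hH
  have h3 : Measurable fun x => ∑ i, ∑ j, H x i j :=
    Finset.measurable_sum _ fun i _ => Finset.measurable_sum _ fun j _ => hH i j
  have h4 : Measurable fun x => ∑ i, η x i := Finset.measurable_sum _ fun i _ => hη i
  refine Measurable.ite (measurableSet_posDef hH) ?_ measurable_const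
  fun_prop

omit [Fintype Λ] in
lemma measurable_hMatrix {W : X → Matrix Λ Λ ℝ} (hW : ∀ i j, Measurable fun x => W x i j)
    {β : X → Λ → ℝ} (hβ : ∀ i, Measurable fun x => β x i) (i j : Λ) :
    Measurable fun x => hMatrix (W x) (β x) i j := by
  unfold hMatrix
  refine Measurable.sub ?_ (hW i j)
  rcases eq_or_ne i j with rfl | hij
  · simpa using (hβ i).const_mul 2
  · simp [hij]

omit [DecidableEq Λ] [DecidableEq m] [DecidableEq n] in
/-- Fubini's theorem for a splitting of the index set into two parts. -/
lemma lintegral_pi_equiv_sum (e : m ⊕ n ≃ Λ) {F : (Λ → ℝ) → ℝ≥0∞} (hF : Measurable F) :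
    ∫⁻ β, F β = ∫⁻ x : m → ℝ, ∫⁻ y : n → ℝ, F (Sum.elim x y ∘ e.symm) := by
  have h1 := volume_measurePreserving_piCongrLeft (fun _ : Λ => ℝ) e
  have h2 := volume_measurePreserving_sumPiEquivProdPi_symm (fun _ : m ⊕ n => ℝ)
  have h3 := h1.comp h2
  have h4 (x : m → ℝ) (y : n → ℝ) : (MeasurableEquiv.piCongrLeft (fun _ : Λ => ℝ) e)
      ((MeasurableEquiv.sumPiEquivProdPi fun _ : m ⊕ n => ℝ).symm (x, y))
        = Sum.elim x y ∘ e.symm := by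
    ext i
    obtain ⟨i, rfl⟩ := e.surjective i
    rw [MeasurableEquiv.coe_piCongrLeft, Equiv.piCongrLeft_apply_apply]
    rcases i with i | i <;> simp [MeasurableEquiv.sumPiEquivProdPi, Equiv.sumPiEquivProdPi]
  rw [← h3.lintegral_comp hF, Measure.volume_eq_prod,
    lintegral_prod _ (by exact (hF.comp h3.measurable).aemeasurable)]
  simp only [Function.comp_apply, h4]

omit [Fintype m] [Fintype n] [Fintype Λ] in
lemma hMatrix_sumElim_submatrix (e : m ⊕ n ≃ Λ) {W : Matrix Λ Λ ℝ} (hW : W.IsSymm)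
    (x : m → ℝ) (y : n → ℝ) :
    (hMatrix W (Sum.elim x y ∘ e.symm)).submatrix e e =
      fromBlocks (hMatrix (W.submatrix (e ∘ Sum.inl) (e ∘ Sum.inl)) x)
        (-W.submatrix (e ∘ Sum.inl) (e ∘ Sum.inr)) (-W.submatrix (e ∘ Sum.inl) (e ∘ Sum.inr))ᵀ
        (hMatrix (W.submatrix (e ∘ Sum.inr) (e ∘ Sum.inr)) y) := by
  ext i j
  rcases i with i | i <;> rcases j with j | j <;>
    simp [hMatrix, diagonal_apply, hW.apply]

/-- Elimination of a block of vertices: the remaining vertices carry a `β`-field with effective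
weights. -/
lemma betaDensity_hMatrix_sumElim (e : m ⊕ n ≃ Λ) {W : Matrix Λ Λ ℝ} (hW : W.IsSymm) (η : Λ → ℝ)
    (x : m → ℝ) (y : n → ℝ) :
    betaDensity (hMatrix W (Sum.elim x y ∘ e.symm)) η =
      betaDensity (hMatrix (W.submatrix (e ∘ Sum.inl) (e ∘ Sum.inl)) x)
        (fun i => η (e (Sum.inl i)) + ∑ j, W (e (Sum.inl i)) (e (Sum.inr j))) *
      betaDensity
        (hMatrix (W.submatrix (e ∘ Sum.inr) (e ∘ Sum.inr)
          + (W.submatrix (e ∘ Sum.inl) (e ∘ Sum.inr))ᵀ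
            * (hMatrix (W.submatrix (e ∘ Sum.inl) (e ∘ Sum.inl)) x)⁻¹
            * W.submatrix (e ∘ Sum.inl) (e ∘ Sum.inr)) y)
        (η ∘ e ∘ Sum.inr + (W.submatrix (e ∘ Sum.inl) (e ∘ Sum.inr))ᵀ *ᵥ
          (hMatrix (W.submatrix (e ∘ Sum.inl) (e ∘ Sum.inl)) x)⁻¹ *ᵥ (η ∘ e ∘ Sum.inl)) := by
  rw [← betaDensity_submatrix e, hMatrix_sumElim_submatrix e hW, betaDensity_fromBlocks]
  congr 2
  · ext i
    simp [mulVec, dotProduct]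
  · simp only [hMatrix, transpose_neg, Matrix.neg_mul, Matrix.mul_neg, neg_neg]
    abel
  · rw [transpose_neg, neg_mulVec, sub_neg_eq_add]
    rfl

/-- A single vertex carries a reciprocal inverse Gaussian variable. -/
lemma betaDensity_hMatrix_unit (W : Matrix Unit Unit ℝ) (η y : Unit → ℝ) :
    betaDensity (hMatrix W y) η = 2 * rigDensity (η ()) (2 * y () - W () ()) := by
  have hM : hMatrix W y = diagonal fun _ => 2 * y () - W () () := by
    ext i j
    simp [hMatrix]
  have hP : (hMatrix W y).PosDef ↔ 0 < 2 * y () - W () () := by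
    rw [hM, posDef_diagonal_iff]
    simp
  set h := 2 * y () - W () () with hh
  by_cases h0 : 0 < h
  · unfold betaDensity rigDensity
    have hs : 0 < √h := Real.sqrt_pos.2 h0
    have hsp : 0 < √Real.pi := Real.sqrt_pos.2 Real.pi_pos
    rw [if_pos (hP.2 h0), hM, ← ENNReal.ofReal_ofNat, ← ENNReal.ofReal_mul (by norm_num)]
    congr 1
    have h2 : (2 / Real.pi) ^ ((Fintype.card Unit : ℝ) / 2) = 2 * (√(2 * Real.pi))⁻¹ := by
      rw [Fintype.card_unit, Nat.cast_one, ← Real.sqrt_eq_rpow, Real.sqrt_div (by norm_num),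
        Real.sqrt_mul (by norm_num)]
      field_simp
      norm_num
    have h3 : (diagonal fun _ : Unit => h)⁻¹ = diagonal fun _ => h⁻¹ := by
      rw [inv_subsingleton]
      simp [Ring.inverse_eq_inv']
    rw [h2, h3, Real.sqrt_mul (by positivity) h]
    have h4 : -(∑ i, ∑ j, (diagonal fun _ : Unit => h) i j - 2 * ∑ i, η i
        + η ⬝ᵥ (diagonal fun _ : Unit => h⁻¹) *ᵥ η) / 2 = -(h - η ()) ^ 2 / (2 * h) := by
      simp [mulVec_diagonal, dotProduct]
      field_simp
      ring
    rw [h4]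
    simp
    field_simp
  · unfold betaDensity
    rw [if_neg (mt hP.1 h0), rigDensity_of_nonpos _ (not_lt.1 h0), mul_zero]

lemma lintegral_two_mul_comp (c : ℝ) (F : ℝ → ℝ≥0∞) :
    ∫⁻ t, 2 * F (2 * t - c) = ∫⁻ h, F h := by
  have h1 : (fun t : ℝ => 2 * t - c) '' Set.univ = Set.univ :=
    Set.eq_univ_of_forall fun h => ⟨(h + c) / 2, trivial, by ring⟩
  have h2 := lintegral_image_eq_lintegral_abs_deriv_mul (f := fun t : ℝ => 2 * t - c)
    (f' := fun _ => 2) MeasurableSet.univ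
    (fun t _ => (((hasDerivAt_id t).const_mul 2).sub_const c).hasDerivWithinAt.congr_deriv
      (mul_one 2))
    (fun a _ b _ hab => by simpa using hab) F
  rw [h1, setLIntegral_univ, setLIntegral_univ] at h2
  simpa using h2.symm

lemma lintegral_betaDensity_unit (W : Matrix Unit Unit ℝ) (η : Unit → ℝ) {F : ℝ → ℝ≥0∞}
    (hF : Measurable F) :
    ∫⁻ y, betaDensity (hMatrix W y) η * F (2 * y () - W () ())
      = ∫⁻ h, rigDensity (η ()) h * F h := by
  rw [← lintegral_two_mul_comp (W () ())]
  have h1 := volume_preserving_funUnique Unit ℝ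
  rw [← h1.lintegral_comp (by have := measurable_rigDensity (η ()); fun_prop)]
  refine lintegral_congr fun y => ?_
  rw [betaDensity_hMatrix_unit, mul_assoc]
  rfl

lemma measurable_betaDensity_hMatrix (W : Matrix Λ Λ ℝ) (η : Λ → ℝ) :
    Measurable fun β => betaDensity (hMatrix W β) η :=
  measurable_betaDensity (measurable_hMatrix (W := fun _ => W) (fun _ _ => measurable_const)
    fun i => measurable_pi_apply i) (η := fun _ => η) fun _ => measurable_const

lemma betaDensity_of_isEmpty [IsEmpty Λ] (H : Matrix Λ Λ ℝ) (η : Λ → ℝ) :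
    betaDensity H η = 1 := by
  have hH : H.PosDef := by
    rw [Subsingleton.elim H 1]
    exact PosDef.one
  simp [betaDensity, hH, dotProduct]

/-- The density of the `β`-field has total mass at most `1`, whatever the signs of the weights. -/
lemma lintegral_betaDensity_le_one {W : Matrix Λ Λ ℝ}
    (hW : W.IsSymm) (η : Λ → ℝ) : ∫⁻ β, betaDensity (hMatrix W β) η ≤ 1 := by
  have key := Fintype.induction_empty_option
    (P := fun Λ _ => ∀ [DecidableEq Λ] (W : Matrix Λ Λ ℝ) (_ : W.IsSymm) (η : Λ → ℝ),
      ∫⁻ β, betaDensity (hMatrix W β) η ≤ 1)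
    (fun α β _ e h _ W hW η => ?_) (fun W hW η => ?_) (fun α _ h _ W hW η => ?_) Λ
  · exact key W hW η
  · let _ : Fintype α := Fintype.ofEquiv _ e.symm
    let _ : DecidableEq α := e.decidableEq
    have h1 := volume_measurePreserving_piCongrLeft (fun _ : β => ℝ) e
    rw [← h1.lintegral_comp (measurable_betaDensity_hMatrix W η)]
    refine le_trans (le_of_eq (lintegral_congr fun x => ?_))
      (h (W.submatrix e e) (hW.submatrix e) (η ∘ e))
    rw [← betaDensity_submatrix e]
    congr 1
    ext i j
    simp [hMatrix, diagonal_apply, MeasurableEquiv.coe_piCongrLeft]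
  · simp_rw [betaDensity_of_isEmpty]
    simp [volume_pi]
  · let _ : DecidableEq α := Classical.decEq α
    set e := (Equiv.optionEquivSumPUnit.{0} α).symm
    rw [lintegral_pi_equiv_sum e (measurable_betaDensity_hMatrix W η)]
    simp_rw [betaDensity_hMatrix_sumElim e hW]
    refine le_trans (lintegral_mono fun x => ?_)
      (h (W.submatrix (e ∘ Sum.inl) (e ∘ Sum.inl)) (hW.submatrix _)
        fun i => η (e (Sum.inl i)) + ∑ j, W (e (Sum.inl i)) (e (Sum.inr j)))
    rw [lintegral_const_mul _ (measurable_betaDensity_hMatrix _ _)]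
    refine mul_le_of_le_one_right' ?_
    have h1 := fun W η => lintegral_betaDensity_unit W η (F := fun _ => 1) measurable_const
    simp only [mul_one] at h1
    exact (h1 _ _).trans_le (lintegral_rigDensity_le_one _)

end Integration

end VRJP

namespace VRJP

open Matrix

/-! ### Series reduction of a path -/

section Series

/-- The law of `((a, b), h)`, where `(a, b)` has law `μ × ν` and, given `(a, b)`, `h` is a reciprocal
inverse Gaussian variable with parameter `a + b`. -/
def seriesCoupling (μ ν : Measure ℝ) : Measure ((ℝ × ℝ) × ℝ) :=
  ((μ.prod ν).prod volume).withDensity fun x => rigDensity (x.1.1 + x.1.2) x.2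

/-- The law of `a b / h` under `seriesCoupling`. It is the law of the effective weight of two edges in
series with independent weights of laws `μ` and `ν`. -/
def seriesLaw (μ ν : Measure ℝ) : Measure ℝ :=
  (seriesCoupling μ ν).map fun x => x.1.1 * x.1.2 / x.2

lemma measurable_lintegral_rigDensity {X : Type*} [MeasurableSpace X] {η : X → ℝ} (hη : Measurable η)
    {F : X → ℝ → ℝ≥0∞} (hF : Measurable (Function.uncurry F)) :
    Measurable fun x => ∫⁻ h, rigDensity (η x) h * F x h := by
  refine Measurable.lintegral_prod_right' (f := fun z : X × ℝ => rigDensity (η z.1) z.2 * F z.1 z.2)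
    (Measurable.mul ?_ hF)
  exact measurable_rigDensity_uncurry.comp ((hη.comp measurable_fst).prodMk measurable_snd)

lemma lintegral_seriesLaw (μ ν : Measure ℝ) [SFinite μ] [SFinite ν] {f : ℝ → ℝ≥0∞}
    (hf : Measurable f) :
    ∫⁻ x, f x ∂(seriesLaw μ ν) =
      ∫⁻ a, ∫⁻ b, (∫⁻ h, rigDensity (a + b) h * f (a * b / h)) ∂ν ∂μ := by
  have hm : Measurable fun x : (ℝ × ℝ) × ℝ => rigDensity (x.1.1 + x.1.2) x.2 :=
    measurable_rigDensity_uncurry.comp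
      (((measurable_fst.comp measurable_fst).add (measurable_snd.comp measurable_fst)).prodMk
        measurable_snd)
  have hm' : Measurable fun x : (ℝ × ℝ) × ℝ => x.1.1 * x.1.2 / x.2 := by fun_prop
  have hm2 : Measurable fun x : (ℝ × ℝ) × ℝ =>
      rigDensity (x.1.1 + x.1.2) x.2 * f (x.1.1 * x.1.2 / x.2) := hm.mul (hf.comp hm')
  rw [seriesLaw, lintegral_map hf hm', seriesCoupling,
    lintegral_withDensity_eq_lintegral_mul _ hm (by exact hf.comp hm')]
  simp only [Pi.mul_apply]
  rw [lintegral_prod _ (hm2.aemeasurable), lintegral_prod _ hm2.lintegral_prod_right'.aemeasurable]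

/-- The weight matrix of the path `0 — 1 — 2 — ⋯` in which the edge `{i, i + 1}` has weight `w i`. -/
def chainMatrix (w : ℕ → ℝ) : Matrix ℕ ℕ ℝ :=
  fun i j => if i + 1 = j then w i else if j + 1 = i then w j else 0

lemma chainMatrix_isSymm (w : ℕ → ℝ) : (chainMatrix w).IsSymm := by
  ext i j
  simp only [transpose_apply, chainMatrix]
  grind

lemma chainMatrix_comm (w : ℕ → ℝ) (i j : ℕ) : chainMatrix w i j = chainMatrix w j i :=
  (chainMatrix_isSymm w).apply j i

/-- The inner vertices `p + 1, …, q - 1` of the path from `p` to `q`. -/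
abbrev Inner (p q : ℕ) : Type := {j : ℕ // j ∈ Finset.Ioo p q}

/-- The weights between inner vertices of the path from `p` to `q`. -/
def pathMatrix (w : ℕ → ℝ) (p q : ℕ) : Matrix (Inner p q) (Inner p q) ℝ :=
  (chainMatrix w).submatrix Subtype.val Subtype.val

/-- The weights between the inner vertices and the end points of the path from `p` to `q`. -/
def pathBoundary (w : ℕ → ℝ) (p q : ℕ) (i : Inner p q) : ℝ :=
  chainMatrix w i p + chainMatrix w i q

/-- The effective weight between the end points of the path from `p` to `q`, for a
configuration `β` on its inner vertices. -/
def pathWeight (w : ℕ → ℝ) (p q : ℕ) (β : Inner p q → ℝ) : ℝ :=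
  chainMatrix w p q +
    (fun i : Inner p q => chainMatrix w i p) ⬝ᵥ (hMatrix (pathMatrix w p q) β)⁻¹ *ᵥ
      fun i : Inner p q => chainMatrix w i q

/-- The density of the `β`-field on the inner vertices of the path from `p` to `q`. -/
def pathDensity (w : ℕ → ℝ) (p q : ℕ) (β : Inner p q → ℝ) : ℝ≥0∞ :=
  betaDensity (hMatrix (pathMatrix w p q) β) (pathBoundary w p q)

/-- The law of the effective weight of the path from `p` to `q` with the edge weights `w`. -/
def pathLaw (w : ℕ → ℝ) (p q : ℕ) : Measure ℝ :=
  ((volume : Measure (Inner p q → ℝ)).withDensity (pathDensity w p q)).map (pathWeight w p q)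

lemma pathMatrix_isSymm (w : ℕ → ℝ) (p q : ℕ) : (pathMatrix w p q).IsSymm :=
  (chainMatrix_isSymm w).submatrix _

lemma measurable_chainMatrix (i j : ℕ) : Measurable fun w : ℕ → ℝ => chainMatrix w i j := by
  unfold chainMatrix
  split_ifs <;> fun_prop

lemma measurable_hMatrix_pathMatrix (p q : ℕ) (i j : Inner p q) :
    Measurable fun x : (ℕ → ℝ) × (Inner p q → ℝ) => hMatrix (pathMatrix x.1 p q) x.2 i j :=
  measurable_hMatrix (W := fun x : (ℕ → ℝ) × (Inner p q → ℝ) => pathMatrix x.1 p q)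
    (fun i j => (measurable_chainMatrix i j).comp measurable_fst)
    (β := fun x => x.2) (fun i => (measurable_pi_apply i).comp measurable_snd) i j

lemma measurable_pathWeight_uncurry (p q : ℕ) :
    Measurable fun x : (ℕ → ℝ) × (Inner p q → ℝ) => pathWeight x.1 p q x.2 :=
  Measurable.add ((measurable_chainMatrix p q).comp measurable_fst)
    (measurable_dotProduct_inv_mulVec (measurable_hMatrix_pathMatrix p q)
      (u := fun x i => chainMatrix x.1 i p) (v := fun x i => chainMatrix x.1 i q)
      (fun i => (measurable_chainMatrix i p).comp measurable_fst)
      (fun i => (measurable_chainMatrix i q).comp measurable_fst))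

lemma measurable_pathDensity_uncurry (p q : ℕ) :
    Measurable fun x : (ℕ → ℝ) × (Inner p q → ℝ) => pathDensity x.1 p q x.2 :=
  measurable_betaDensity (measurable_hMatrix_pathMatrix p q)
    (η := fun x => pathBoundary x.1 p q) fun i => ((measurable_chainMatrix i p).comp measurable_fst).add
      ((measurable_chainMatrix i q).comp measurable_fst)

lemma measurable_pathWeight (w : ℕ → ℝ) (p q : ℕ) : Measurable (pathWeight w p q) :=
  (measurable_pathWeight_uncurry p q).comp measurable_prodMk_left

lemma measurable_pathDensity (w : ℕ → ℝ) (p q : ℕ) : Measurable (pathDensity w p q) :=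
  measurable_betaDensity_hMatrix (pathMatrix w p q) (pathBoundary w p q)

lemma lintegral_pathLaw (w : ℕ → ℝ) (p q : ℕ) {f : ℝ → ℝ≥0∞} (hf : Measurable f) :
    ∫⁻ x, f x ∂(pathLaw w p q) = ∫⁻ β, pathDensity w p q β * f (pathWeight w p q β) := by
  rw [pathLaw, lintegral_map hf (measurable_pathWeight w p q),
    lintegral_withDensity_eq_lintegral_mul _ (measurable_pathDensity w p q)
      (by exact hf.comp (measurable_pathWeight w p q))]
  rfl

lemma pathLaw_univ_le_one (w : ℕ → ℝ) (p q : ℕ) : pathLaw w p q Set.univ ≤ 1 := by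
  rw [← lintegral_one, lintegral_pathLaw w p q measurable_const]
  simpa [pathDensity] using
    lintegral_betaDensity_le_one (pathMatrix_isSymm w p q) (pathBoundary w p q)

instance (w : ℕ → ℝ) (p q : ℕ) : IsFiniteMeasure (pathLaw w p q) :=
  ⟨(pathLaw_univ_le_one w p q).trans_lt ENNReal.one_lt_top⟩

lemma pathLaw_succ (w : ℕ → ℝ) (p : ℕ) : pathLaw w p (p + 1) = Measure.dirac (w p) := by
  have : IsEmpty (Inner p (p + 1)) := by
    refine ⟨fun j => ?_⟩
    have := Finset.mem_Ioo.1 j.2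
    omega
  refine Measure.ext_of_lintegral _ fun f hf => ?_
  rw [lintegral_pathLaw w p (p + 1) hf, lintegral_dirac' _ hf]
  simp [pathDensity, betaDensity_of_isEmpty, pathWeight, chainMatrix, volume_pi, dotProduct]

/-- The inner vertices of the path from `p` to `q`, split at a vertex `m`. -/
def innerEquiv {p m q : ℕ} (hpm : p < m) (hmq : m < q) :
    (Inner p m ⊕ Inner m q) ⊕ Unit ≃ Inner p q :=
  Equiv.ofBijective
    (Sum.elim
      (Sum.elim (fun i => ⟨i, by have := Finset.mem_Ioo.1 i.2; exact Finset.mem_Ioo.2 (by omega)⟩)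
        (fun i => ⟨i, by have := Finset.mem_Ioo.1 i.2; exact Finset.mem_Ioo.2 (by omega)⟩))
      (fun _ => ⟨m, Finset.mem_Ioo.2 (by omega)⟩))
    (by
      constructor
      · rintro ((⟨i, hi⟩ | ⟨i, hi⟩) | _) ((⟨j, hj⟩ | ⟨j, hj⟩) | _) h <;>
          simp at h ⊢ <;> grind
      · rintro ⟨j, hj⟩
        have := Finset.mem_Ioo.1 hj
        rcases lt_trichotomy j m with h | h | h
        · exact ⟨Sum.inl (Sum.inl ⟨j, Finset.mem_Ioo.2 (by omega)⟩), rfl⟩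
        · exact ⟨Sum.inr (), by simp [h]⟩
        · exact ⟨Sum.inl (Sum.inr ⟨j, Finset.mem_Ioo.2 (by omega)⟩), rfl⟩)

lemma coe_innerEquiv_inl_inl {p m q : ℕ} (hpm : p < m) (hmq : m < q) (i : Inner p m) :
    (innerEquiv hpm hmq (Sum.inl (Sum.inl i)) : ℕ) = i := rfl

lemma coe_innerEquiv_inl_inr {p m q : ℕ} (hpm : p < m) (hmq : m < q) (i : Inner m q) :
    (innerEquiv hpm hmq (Sum.inl (Sum.inr i)) : ℕ) = i := rfl

lemma coe_innerEquiv_inr {p m q : ℕ} (hpm : p < m) (hmq : m < q) (i : Unit) :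
    (innerEquiv hpm hmq (Sum.inr i) : ℕ) = m := rfl

/-- The density and the effective weight of a path, split at an inner vertex `m`. The matrix `M`
consists of the self-interaction at `m` which remains when the other vertices are eliminated. -/
lemma exists_pathDensity_split (w : ℕ → ℝ) {p m q : ℕ} (hpm : p < m) (hmq : m < q)
    (x₁ : Inner p m → ℝ) (x₂ : Inner m q → ℝ) :
    ∃ M : Matrix Unit Unit ℝ, ∀ (y : Unit → ℝ) (f : ℝ → ℝ≥0∞),
      pathDensity w p q (Sum.elim (Sum.elim x₁ x₂) y ∘ (innerEquiv hpm hmq).symm) *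
          f (pathWeight w p q (Sum.elim (Sum.elim x₁ x₂) y ∘ (innerEquiv hpm hmq).symm)) =
        pathDensity w p m x₁ * (pathDensity w m q x₂ *
          (betaDensity (hMatrix M y) (fun _ => pathWeight w p m x₁ + pathWeight w m q x₂) *
            f (pathWeight w p m x₁ * pathWeight w m q x₂ / (2 * y () - M () ())))) := by
  set e := innerEquiv hpm hmq with he
  set W := pathMatrix w p q with hW
  have hWs : W.IsSymm := pathMatrix_isSymm w p q
  set A := hMatrix (W.submatrix (e ∘ Sum.inl) (e ∘ Sum.inl)) (Sum.elim x₁ x₂) with hA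
  set B := W.submatrix (e ∘ Sum.inl) (e ∘ Sum.inr) with hB
  set A₁ := hMatrix (pathMatrix w p m) x₁ with hA₁
  set A₂ := hMatrix (pathMatrix w m q) x₂ with hA₂
  have hL (i : Inner p m) : p < i ∧ (i : ℕ) < m := Finset.mem_Ioo.1 i.2
  have hR (i : Inner m q) : m < i ∧ (i : ℕ) < q := Finset.mem_Ioo.1 i.2
  have hLq (i : Inner p m) : chainMatrix w i q = 0 := by
    have := hL i
    rw [chainMatrix, if_neg (by omega), if_neg (by omega)]
  have hRp (i : Inner m q) : chainMatrix w i p = 0 := by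
    have := hR i
    rw [chainMatrix, if_neg (by omega), if_neg (by omega)]
  have hLR (i : Inner p m) (j : Inner m q) : chainMatrix w i j = 0 := by
    have := hL i
    have := hR j
    rw [chainMatrix, if_neg (by omega), if_neg (by omega)]
  have hRL (i : Inner m q) (j : Inner p m) : chainMatrix w i j = 0 := by
    rw [chainMatrix_comm, hLR]
  have hpq : chainMatrix w p q = 0 := by
    rw [chainMatrix, if_neg (by omega), if_neg (by omega)]
  have hA12 : A = fromBlocks A₁ 0 0ᵀ A₂ := by
    ext i j
    rcases i with i | i <;> rcases j with j | j
    · simp [hA, hA₁, hMatrix, diagonal_apply, hW, pathMatrix, he, coe_innerEquiv_inl_inl]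
    · simp [hA, hMatrix, hW, pathMatrix, he, coe_innerEquiv_inl_inl,
        coe_innerEquiv_inl_inr, hLR]
    · simp [hA, hMatrix, hW, pathMatrix, he, coe_innerEquiv_inl_inl,
        coe_innerEquiv_inl_inr, hRL]
    · simp [hA, hA₂, hMatrix, diagonal_apply, hW, pathMatrix, he, coe_innerEquiv_inl_inr]
  set η := pathBoundary w p q with hη
  -- the boundary weights on the two parts
  have hdens : betaDensity A (fun i => η (e (Sum.inl i)) + ∑ j, W (e (Sum.inl i)) (e (Sum.inr j)))
      = pathDensity w p m x₁ * pathDensity w m q x₂ := by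
    rw [hA12, betaDensity_fromBlocks]
    congr 2
    · ext i
      simp [hη, pathBoundary, hW, pathMatrix, he, coe_innerEquiv_inl_inl, coe_innerEquiv_inr, hLq]
    · simp [hA₂]
    · ext i
      simp [hη, pathBoundary, hW, pathMatrix, he, coe_innerEquiv_inl_inr, coe_innerEquiv_inr, hRp,
        add_comm]
  by_cases hAP : A.PosDef
  swap
  · refine ⟨0, fun y f => ?_⟩
    have h0 : pathDensity w p m x₁ * pathDensity w m q x₂ = 0 := by
      rw [← hdens, betaDensity, if_neg hAP]
    rw [← mul_assoc, h0, zero_mul, pathDensity, betaDensity_hMatrix_sumElim e hWs, hdens, h0,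
      zero_mul, zero_mul]
  -- the bilinear form of `A⁻¹` splits
  have hbil (u v : Inner p m ⊕ Inner m q → ℝ) : u ⬝ᵥ A⁻¹ *ᵥ v
      = (u ∘ Sum.inl) ⬝ᵥ A₁⁻¹ *ᵥ (v ∘ Sum.inl) + (u ∘ Sum.inr) ⬝ᵥ A₂⁻¹ *ᵥ (v ∘ Sum.inr) := by
    have h1 := dotProduct_inv_fromBlocks_mulVec A₁ 0 A₂ (hA12 ▸ hAP) u v
    rw [hA12, h1]
    simp
  have hA₁P : A₁.PosDef := ((posDef_fromBlocks_iff A₁ 0 A₂).1 (hA12 ▸ hAP)).1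
  set a : Inner p q → ℝ := fun i => chainMatrix w i p with ha
  set b : Inner p q → ℝ := fun i => chainMatrix w i q with hb
  set c : Inner p m ⊕ Inner m q → ℝ := fun i => B i () with hc
  have hBt (v : Inner p m ⊕ Inner m q → ℝ) : Bᵀ *ᵥ v = fun _ => c ⬝ᵥ v := by
    ext i
    rfl
  have hca : c ⬝ᵥ A⁻¹ *ᵥ (a ∘ e ∘ Sum.inl) + chainMatrix w m p = pathWeight w p m x₁ := by
    rw [hbil, pathWeight, chainMatrix_comm w m p, add_comm]
    congr 1
    have h1 : (a ∘ e ∘ Sum.inl) ∘ Sum.inr = 0 := by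
      ext i
      simp [ha, he, coe_innerEquiv_inl_inr, hRp]
    rw [h1, mulVec_zero, dotProduct_zero, add_zero, dotProduct_mulVec, ← mulVec_transpose,
      transpose_inv_of_posDef hA₁P, dotProduct_comm]
    rfl
  have hcb : c ⬝ᵥ A⁻¹ *ᵥ (b ∘ e ∘ Sum.inl) + chainMatrix w m q = pathWeight w m q x₂ := by
    rw [hbil, pathWeight, add_comm]
    congr 1
    have h1 : (b ∘ e ∘ Sum.inl) ∘ Sum.inl = 0 := by
      ext i
      simp [hb, he, coe_innerEquiv_inl_inl, hLq]
    rw [h1, mulVec_zero, dotProduct_zero, zero_add]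
    congr 1
  have hab : (a ∘ e ∘ Sum.inl) ⬝ᵥ A⁻¹ *ᵥ (b ∘ e ∘ Sum.inl) = 0 := by
    have h1 : (a ∘ e ∘ Sum.inl) ∘ Sum.inr = 0 := by
      ext i
      simp [ha, he, coe_innerEquiv_inl_inr, hRp]
    have h2 : (b ∘ e ∘ Sum.inl) ∘ Sum.inl = 0 := by
      ext i
      simp [hb, he, coe_innerEquiv_inl_inl, hLq]
    rw [hbil, h1, h2]
    simp
  refine ⟨W.submatrix (e ∘ Sum.inr) (e ∘ Sum.inr) + Bᵀ * A⁻¹ * B, fun y f => ?_⟩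
  set M := W.submatrix (e ∘ Sum.inr) (e ∘ Sum.inr) + Bᵀ * A⁻¹ * B with hM
  set H := hMatrix W (Sum.elim (Sum.elim x₁ x₂) y ∘ e.symm) with hH
  have hDM : pathDensity w p q (Sum.elim (Sum.elim x₁ x₂) y ∘ e.symm) =
      pathDensity w p m x₁ * pathDensity w m q x₂ *
        betaDensity (hMatrix M y) (fun _ => pathWeight w p m x₁ + pathWeight w m q x₂) := by
    rw [pathDensity, betaDensity_hMatrix_sumElim e hWs, hdens]
    congr 2
    ext i
    rw [hBt]
    have h1 : η ∘ e ∘ Sum.inl = a ∘ e ∘ Sum.inl + b ∘ e ∘ Sum.inl := rfl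
    rw [h1, mulVec_add, dotProduct_add, ← hca, ← hcb]
    simp [pathBoundary, he, coe_innerEquiv_inr]
    ring
  rw [← mul_assoc, ← mul_assoc, ← hDM]
  by_cases hHP : H.PosDef
  swap
  · rw [pathDensity, betaDensity, if_neg hHP, zero_mul, zero_mul]
  congr 2
  have hHe := hMatrix_sumElim_submatrix e hWs (Sum.elim x₁ x₂) y
  have hHP' := (posDef_submatrix_equiv e H).2 hHP
  rw [hHe] at hHP'
  have hS : hMatrix (W.submatrix (e ∘ Sum.inr) (e ∘ Sum.inr)) y - (-B)ᵀ * A⁻¹ * (-B)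
      = hMatrix M y := by
    simp only [hMatrix, transpose_neg, Matrix.neg_mul, Matrix.mul_neg, neg_neg, hM]
    abel
  have hSi : (hMatrix M y)⁻¹ = fun _ _ => (2 * y () - M () ())⁻¹ := by
    rw [inv_subsingleton]
    ext i j
    simp [Ring.inverse_eq_inv', hMatrix]
  rw [pathWeight, hpq, zero_add, ← dotProduct_inv_submatrix_mulVec e, hHe,
    dotProduct_inv_fromBlocks_mulVec _ _ _ hHP', hS, hSi]
  have h2 (g : Inner p q → ℝ) : (g ∘ e) ∘ Sum.inl = g ∘ e ∘ Sum.inl := rfl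
  rw [h2, h2, hab, zero_add, transpose_neg, neg_mulVec, neg_mulVec, hBt, hBt, ← hca, ← hcb]
  simp [dotProduct, mulVec, ha, hb, he, coe_innerEquiv_inr]
  ring

lemma pathLaw_eq_seriesLaw (w : ℕ → ℝ) {p m q : ℕ} (hpm : p < m) (hmq : m < q) :
    pathLaw w p q = seriesLaw (pathLaw w p m) (pathLaw w m q) := by
  refine Measure.ext_of_lintegral _ fun f hf => ?_
  have hG : Measurable fun x : ℝ × ℝ => ∫⁻ h, rigDensity (x.1 + x.2) h * f (x.1 * x.2 / h) :=
    measurable_lintegral_rigDensity (by fun_prop) (F := fun (x : ℝ × ℝ) h => f (x.1 * x.2 / h))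
      (hf.comp (by fun_prop))
  have hm : Measurable fun β => pathDensity w p q β * f (pathWeight w p q β) :=
    (measurable_pathDensity w p q).mul (hf.comp (measurable_pathWeight w p q))
  have hm' : Measurable fun x : Inner p m ⊕ Inner m q → ℝ => ∫⁻ y : Unit → ℝ,
      pathDensity w p q (Sum.elim x y ∘ (innerEquiv hpm hmq).symm) *
          f (pathWeight w p q (Sum.elim x y ∘ (innerEquiv hpm hmq).symm)) := by
    refine Measurable.lintegral_prod_right' (hm.comp
      (f := fun z : (Inner p m ⊕ Inner m q → ℝ) × (Unit → ℝ) =>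
        Sum.elim z.1 z.2 ∘ (innerEquiv hpm hmq).symm) ?_)
    refine measurable_pi_lambda _ fun i => ?_
    simp only [Function.comp_apply]
    rcases (innerEquiv hpm hmq).symm i with j | j <;> simp <;> fun_prop
  have hG' : Measurable fun a => ∫⁻ b, (∫⁻ h, rigDensity (a + b) h * f (a * b / h))
      ∂(pathLaw w m q) := hG.lintegral_prod_right'
  have hG'' (a : ℝ) : Measurable fun b => ∫⁻ h, rigDensity (a + b) h * f (a * b / h) :=
    measurable_lintegral_rigDensity (by fun_prop) (F := fun b h => f (a * b / h))
      (hf.comp (by fun_prop))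
  rw [lintegral_pathLaw w p q hf, lintegral_seriesLaw _ _ hf,
    lintegral_pi_equiv_sum (innerEquiv hpm hmq) hm, lintegral_pi_equiv_sum (Equiv.refl _) hm',
    lintegral_pathLaw w p m hG']
  refine lintegral_congr fun x₁ => ?_
  have hm'' : Measurable fun β => pathDensity w m q β * ∫⁻ h,
      rigDensity (pathWeight w p m x₁ + pathWeight w m q β) h *
        f (pathWeight w p m x₁ * pathWeight w m q β / h) :=
    (measurable_pathDensity w m q).mul ((hG'' _).comp (measurable_pathWeight w m q))
  rw [lintegral_pathLaw w m q (hG'' _), ← lintegral_const_mul _ hm'']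
  refine lintegral_congr fun x₂ => ?_
  obtain ⟨M, hM⟩ := exists_pathDensity_split w hpm hmq x₁ x₂
  simp only [Equiv.refl_symm, Equiv.coe_refl, Function.comp_id, hM]
  have h1 := lintegral_betaDensity_unit M
    (fun _ => pathWeight w p m x₁ + pathWeight w m q x₂)
    (F := fun h => f (pathWeight w p m x₁ * pathWeight w m q x₂ / h)) (hf.comp (by fun_prop))
  have h2 : Measurable fun y : Unit → ℝ =>
      betaDensity (hMatrix M y) (fun _ => pathWeight w p m x₁ + pathWeight w m q x₂) *
      f (pathWeight w p m x₁ * pathWeight w m q x₂ / (2 * y () - M () ())) :=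
    (measurable_betaDensity_hMatrix M _).mul (hf.comp (by fun_prop))
  rw [lintegral_const_mul _ (h2.const_mul _), lintegral_const_mul _ h2, h1]

end Series

end VRJP

namespace VRJP

open Matrix

/-! ### Block diagonal matrices -/

section BlockDiagonal

variable {I S C : Type*} [Fintype I] [DecidableEq I] [Fintype S] [DecidableEq S] {A : Matrix I I ℝ}
  {c : I → C}

/-- The inverse of a block diagonal matrix is block diagonal: a matrix is block diagonal if and only
if it commutes with the projections to the blocks. -/
lemma inv_apply_eq_zero_of_ne (hA : ∀ i j, c i ≠ c j → A i j = 0) {i j : I} (hij : c i ≠ c j) :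
    A⁻¹ i j = 0 := by
  classical
  by_cases hu : IsUnit A.det
  swap
  · rw [nonsing_inv_apply_not_isUnit A hu, Matrix.zero_apply]
  set Q : Matrix I I ℝ := diagonal fun k => if c k = c j then 1 else 0 with hQ
  have h1 : A * Q = Q * A := by
    ext k l
    simp only [hQ, mul_diagonal, diagonal_mul]
    by_cases h : c k = c l
    · simp [h]
    · simp [hA k l h]
  have h2 : A⁻¹ * Q = Q * A⁻¹ := by
    calc A⁻¹ * Q = A⁻¹ * Q * (A * A⁻¹) := by rw [mul_nonsing_inv A hu, Matrix.mul_one]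
      _ = A⁻¹ * (Q * A) * A⁻¹ := by simp only [Matrix.mul_assoc]
      _ = A⁻¹ * A * Q * A⁻¹ := by rw [← h1]; simp only [Matrix.mul_assoc]
      _ = Q * A⁻¹ := by rw [nonsing_inv_mul A hu, Matrix.one_mul]
  have h3 := congrFun (congrFun h2 i) j
  simpa [hQ, mul_diagonal, diagonal_mul, hij] using h3

/-- The bilinear form of the inverse of a block diagonal matrix, at vectors which interact in a
single block only. -/
lemma dotProduct_inv_mulVec_eq_submatrix (hA : ∀ i j, c i ≠ c j → A i j = 0) (hu : IsUnit A.det)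
    {σ : S → I} (hσ : Function.Injective σ) {t : C} (ht : ∀ i, i ∈ Set.range σ ↔ c i = t)
    {u v : I → ℝ} (huv : ∀ i j, u i ≠ 0 → v j ≠ 0 → c i = c j → c i = t) :
    u ⬝ᵥ A⁻¹ *ᵥ v = (u ∘ σ) ⬝ᵥ (A.submatrix σ σ)⁻¹ *ᵥ (v ∘ σ) := by
  have hcσ (s : S) : c (σ s) = t := (ht _).1 ⟨s, rfl⟩
  have hinv : (A.submatrix σ σ)⁻¹ = A⁻¹.submatrix σ σ := by
    refine inv_eq_left_inv ?_
    ext s s'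
    have h1 : (A⁻¹ * A) (σ s) (σ s') = (1 : Matrix S S ℝ) s s' := by
      rw [nonsing_inv_mul A hu, one_apply, one_apply]
      exact if_congr hσ.eq_iff rfl rfl
    rw [← h1, mul_apply, mul_apply]
    refine Fintype.sum_of_injective σ hσ _ _ (fun i hi => ?_) fun k => rfl
    rw [hA i (σ s') (by rw [hcσ]; exact mt (ht i).2 hi), mul_zero]
  rw [hinv]
  simp only [dotProduct, mulVec, Finset.mul_sum, Function.comp_apply, submatrix_apply]
  symm
  rw [← Fintype.sum_prod_type', ← Fintype.sum_prod_type']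
  refine Fintype.sum_of_injective (Prod.map σ σ) (hσ.prodMap hσ) _ _ (fun i hi => ?_) fun k => rfl
  by_cases hc : c i.1 = c i.2
  · by_contra h0
    have h1 : u i.1 ≠ 0 := fun h => h0 (by rw [h, zero_mul])
    have h2 : v i.2 ≠ 0 := fun h => h0 (by rw [h, mul_zero, mul_zero])
    have h3 := huv _ _ h1 h2 hc
    obtain ⟨a, ha⟩ := (ht _).2 h3
    obtain ⟨b, hb⟩ := (ht _).2 (hc.symm.trans h3)
    exact hi ⟨(a, b), Prod.ext ha hb⟩
  · rw [inv_apply_eq_zero_of_ne hA hc, zero_mul, mul_zero]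

end BlockDiagonal

/-! ### Subdivided graphs -/

namespace EdgeDirection

section Points

variable {V : Type*} {G : SimpleGraph V} (D : EdgeDirection G) {r : ℕ}

lemma tail_ne_head (e : G.edgeSet) : D.tail e ≠ D.head e := by
  have h1 : s(D.tail e, D.head e) ∈ G.edgeSet := D.ends e ▸ e.2
  exact G.ne_of_adj (G.mem_edgeSet.1 h1)

lemma point_of_mem {e : G.edgeSet} {j : ℕ} (hj : j ∈ Finset.Ioo 0 (2 ^ r)) :
    D.point r e j = Sum.inr (e, ⟨j, hj⟩) := by
  rw [point, dif_pos hj]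

lemma point_zero (e : G.edgeSet) : D.point r e 0 = Sum.inl (D.tail e) := by
  simp [point]

lemma point_two_pow (e : G.edgeSet) : D.point r e (2 ^ r) = Sum.inl (D.head e) := by
  simp [point]

lemma eq_zero_or_eq_two_pow {j : ℕ} (hj : j ≤ 2 ^ r) (h : j ∉ Finset.Ioo 0 (2 ^ r)) :
    j = 0 ∨ j = 2 ^ r := by
  rw [Finset.mem_Ioo] at h
  omega

lemma point_eq_inr_iff {e e' : G.edgeSet} {i : ℕ} {j : {j : ℕ // j ∈ Finset.Ioo 0 (2 ^ r)}} :
    D.point r e i = Sum.inr (e', j) ↔ e = e' ∧ i = j := by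
  constructor
  · intro h
    unfold point at h
    split_ifs at h with h1 h2
    have h3 := Sum.inr.inj h
    exact ⟨(Prod.ext_iff.1 h3).1, congrArg Subtype.val (Prod.ext_iff.1 h3).2⟩
  · rintro ⟨rfl, rfl⟩
    rw [point_of_mem D j.2]

lemma point_eq_of_mem {e e' : G.edgeSet} {i i' : ℕ} (hi : i ∈ Finset.Ioo 0 (2 ^ r))
    (h : D.point r e i = D.point r e' i') : e = e' ∧ i = i' := by
  rw [point_of_mem D hi] at h
  have := (D.point_eq_inr_iff).1 h.symm
  exact ⟨this.1.symm, this.2.symm⟩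

lemma point_injOn (e : G.edgeSet) {i j : ℕ} (hi : i ≤ 2 ^ r) (hj : j ≤ 2 ^ r)
    (h : D.point r e i = D.point r e j) : i = j := by
  by_cases h1 : i ∈ Finset.Ioo 0 (2 ^ r)
  · exact (D.point_eq_of_mem h1 h).2
  by_cases h2 : j ∈ Finset.Ioo 0 (2 ^ r)
  · exact (D.point_eq_of_mem h2 h.symm).2.symm
  have hne := D.tail_ne_head e
  rcases eq_zero_or_eq_two_pow hi h1 with rfl | rfl <;>
    rcases eq_zero_or_eq_two_pow hj h2 with rfl | rfl
  · rfl
  · rw [point_zero, point_two_pow] at h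
    exact absurd (Sum.inl.inj h) hne
  · rw [point_zero, point_two_pow] at h
    exact absurd (Sum.inl.inj h).symm hne
  · rfl

/-- A segment of an edge of `G` is determined by its end points. -/
lemma segment_eq {e e' : G.edgeSet} {i j i' j' : ℕ} (hij : i < j) (hj : j ≤ 2 ^ r)
    (hij' : i' < j') (hj' : j' ≤ 2 ^ r)
    (h : s(D.point r e i, D.point r e j) = s(D.point r e' i', D.point r e' j')) :
    e = e' ∧ i = i' ∧ j = j' := by
  have he : e = e' := by
    by_contra hne
    have h0 {a b : ℕ} (hab : D.point r e a = D.point r e' b) :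
        a ∉ Finset.Ioo 0 (2 ^ r) ∧ b ∉ Finset.Ioo 0 (2 ^ r) :=
      ⟨fun ha => hne (D.point_eq_of_mem ha hab).1,
        fun hb => hne (D.point_eq_of_mem hb hab.symm).1.symm⟩
    have h1 : i ∉ Finset.Ioo 0 (2 ^ r) ∧ j ∉ Finset.Ioo 0 (2 ^ r) ∧
        i' ∉ Finset.Ioo 0 (2 ^ r) ∧ j' ∉ Finset.Ioo 0 (2 ^ r) := by
      rcases Sym2.eq_iff.1 h with ⟨ha, hb⟩ | ⟨ha, hb⟩
      · exact ⟨(h0 ha).1, (h0 hb).1, (h0 ha).2, (h0 hb).2⟩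
      · exact ⟨(h0 ha).1, (h0 hb).1, (h0 hb).2, (h0 ha).2⟩
    simp only [Finset.mem_Ioo] at h1
    obtain rfl : i = 0 := by omega
    obtain rfl : i' = 0 := by omega
    obtain rfl : j = 2 ^ r := by omega
    obtain rfl : j' = 2 ^ r := by omega
    simp only [point_zero, point_two_pow] at h
    have h2 : s(D.tail e, D.head e) = s(D.tail e', D.head e') := by
      simpa using h
    rw [D.ends, D.ends] at h2
    exact hne (Subtype.ext h2)
  subst he
  rcases Sym2.eq_iff.1 h with ⟨ha, hb⟩ | ⟨ha, hb⟩
  · exact ⟨rfl, D.point_injOn e (by omega) (by omega) ha, D.point_injOn e (by omega) (by omega) hb⟩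
  · have := D.point_injOn e (by omega) (by omega) ha
    have := D.point_injOn e (by omega) (by omega) hb
    omega

lemma edgeEnds_injective : Function.Injective (D.edgeEnds r) := by
  rintro ⟨e, i⟩ ⟨e', i'⟩ h
  obtain ⟨rfl, h1, -⟩ := D.segment_eq (Nat.lt_succ_self i) i.2 (Nat.lt_succ_self i') i'.2 h
  rw [Fin.ext h1]

lemma point_mem_coarseVertices_iff {l : ℕ} (e : G.edgeSet) {i : ℕ}
    (hi : i ≤ 2 ^ r) : D.point r e i ∈ coarseVertices G l r ↔ 2 ^ (r - l) ∣ i := by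
  constructor
  · intro h
    by_cases h1 : i ∈ Finset.Ioo 0 (2 ^ r)
    · exact h e ⟨i, h1⟩ (D.point_of_mem h1)
    · rcases eq_zero_or_eq_two_pow hi h1 with rfl | rfl
      · exact dvd_zero _
      · exact pow_dvd_pow 2 (Nat.sub_le r l)
  · rintro ⟨t, rfl⟩
    exact D.point_mem_coarseVertices l r e t

end Points

section Weights

variable {V : Type*} [Fintype V] [DecidableEq V] {G : SimpleGraph V} [DecidableRel G.Adj]
  (D : EdgeDirection G) {r : ℕ} (w : SubEdge G r → ℝ)

/-- The weights along an edge `e` of `G`, as a sequence, extended by `0`. -/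
def edgeWeights (e : G.edgeSet) (i : ℕ) : ℝ :=
  if h : i < 2 ^ r then w (e, ⟨i, h⟩) else 0

lemma weightMatrix_isSymm : (D.weightMatrix r w).IsSymm := by
  ext x y
  simp only [transpose_apply, weightMatrix, Sym2.eq_swap]

lemma weightMatrix_point_succ (e : SubEdge G r) :
    D.weightMatrix r w (D.point r e.1 e.2) (D.point r e.1 (e.2 + 1)) = w e := by
  have h (f : SubEdge G r) : D.edgeEnds r f = s(D.point r e.1 e.2, D.point r e.1 (e.2 + 1)) ↔ f = e :=
    D.edgeEnds_injective.eq_iff (a := f) (b := e)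
  simp only [weightMatrix, h]
  simp

lemma weightMatrix_inr (e : G.edgeSet) (j : {j : ℕ // j ∈ Finset.Ioo 0 (2 ^ r)})
    (y : SubVertex G r) :
    D.weightMatrix r w (Sum.inr (e, j)) y =
      (if y = D.point r e (j - 1) then edgeWeights w e (j - 1) else 0)
        + if y = D.point r e (j + 1) then edgeWeights w e j else 0 := by
  obtain ⟨j, hj⟩ := j
  have hj' := Finset.mem_Ioo.1 hj
  set a : SubEdge G r := (e, ⟨j - 1, by omega⟩) with ha
  set b : SubEdge G r := (e, ⟨j, by omega⟩) with hb
  have hab : a ≠ b := by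
    intro h
    have := congrArg (fun x : SubEdge G r => (x.2 : ℕ)) h
    simp [ha, hb] at this
    omega
  have hP := D.point_of_mem (e := e) hj
  have h1 : D.edgeEnds r a = s(Sum.inr (e, ⟨j, hj⟩), D.point r e (j - 1)) := by
    simp only [edgeEnds, ha]
    rw [show j - 1 + 1 = j by omega, hP, Sym2.eq_swap]
  have h2 : D.edgeEnds r b = s(Sum.inr (e, ⟨j, hj⟩), D.point r e (j + 1)) := by
    simp only [edgeEnds, hb]
    rw [hP]
  have h3 (f : SubEdge G r) (hfa : f ≠ a) (hfb : f ≠ b) :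
      D.edgeEnds r f ≠ s(Sum.inr (e, ⟨j, hj⟩), y) := by
    obtain ⟨f, i⟩ := f
    intro h
    have h4 : Sum.inr (e, ⟨j, hj⟩) ∈ D.edgeEnds r (f, i) := h ▸ Sym2.mem_mk_left _ _
    rcases Sym2.mem_iff.1 h4 with h5 | h5
    · obtain ⟨rfl, h6⟩ := (D.point_eq_inr_iff).1 h5.symm
      exact hfb (Prod.ext rfl (Fin.ext h6))
    · obtain ⟨rfl, h6⟩ := (D.point_eq_inr_iff).1 h5.symm
      refine hfa (Prod.ext rfl (Fin.ext ?_))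
      change (i : ℕ) = j - 1
      simp only at h6
      omega
  rw [weightMatrix, Fintype.sum_eq_add a b hab fun f hf => if_neg (h3 f hf.1 hf.2), h1, h2]
  simp only [Sym2.congr_right, eq_comm (b := y)]
  congr 2
  · rw [edgeWeights, dif_pos (by omega)]
  · rw [edgeWeights, dif_pos (by omega)]

lemma weightMatrix_inr_point (e : G.edgeSet) (j : {j : ℕ // j ∈ Finset.Ioo 0 (2 ^ r)}) {i : ℕ}
    (hi : i ≤ 2 ^ r) :
    D.weightMatrix r w (Sum.inr (e, j)) (D.point r e i) = chainMatrix (edgeWeights w e) j i := by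
  have hj := Finset.mem_Ioo.1 j.2
  have h1 (k : ℕ) (hk : k ≤ 2 ^ r) : D.point r e i = D.point r e k ↔ i = k :=
    ⟨D.point_injOn e hi hk, fun h => h ▸ rfl⟩
  rw [weightMatrix_inr, if_congr (h1 (j - 1) (by omega)) rfl rfl,
    if_congr (h1 (j + 1) (by omega)) rfl rfl, chainMatrix]
  rcases lt_trichotomy i j with h | h | h
  · by_cases h' : i = j - 1
    · rw [if_pos h', if_neg (by omega), if_neg (by omega), if_pos (by omega), h', add_zero]
    · rw [if_neg h', if_neg (by omega), if_neg (by omega), if_neg (by omega), add_zero]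
  · rw [if_neg (by omega), if_neg (by omega), if_neg (by omega), if_neg (by omega), add_zero]
  · by_cases h' : i = j + 1
    · rw [if_neg (by omega), if_pos h', if_pos (by omega), zero_add]
    · rw [if_neg (by omega), if_neg h', if_neg (by omega), if_neg (by omega), zero_add]

/-- The inner vertices of the segment between the `p`-th and the `q`-th vertex of the edge `e`. -/
def segmentVertex (e : G.edgeSet) {p q : ℕ} (hq : q ≤ 2 ^ r) (j : Inner p q) : SubVertex G r :=
  Sum.inr (e, ⟨j, by have := Finset.mem_Ioo.1 j.2; exact Finset.mem_Ioo.2 (by omega)⟩)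

omit [Fintype V] [DecidableEq V] [DecidableRel G.Adj] in
lemma segmentVertex_injective (e : G.edgeSet) {p q : ℕ} (hq : q ≤ 2 ^ r) :
    Function.Injective (segmentVertex e (p := p) hq) := by
  intro i j h
  have h1 := (Prod.ext_iff.1 (Sum.inr.inj h)).2
  have h2 : (i : ℕ) = j := congrArg (fun z : {j : ℕ // j ∈ Finset.Ioo 0 (2 ^ r)} => (z : ℕ)) h1
  exact Subtype.ext h2

omit [Fintype V] [DecidableEq V] [DecidableRel G.Adj] in
lemma point_eq_segmentVertex (e : G.edgeSet) {p q : ℕ} (hq : q ≤ 2 ^ r) (j : Inner p q) :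
    D.point r e j = segmentVertex e hq j :=
  D.point_of_mem _

omit [Fintype V] [DecidableEq V] [DecidableRel G.Adj] in
lemma point_mem_range_segmentVertex (e : G.edgeSet) {p q i : ℕ} (hq : q ≤ 2 ^ r) (hi : i ≤ 2 ^ r) :
    D.point r e i ∈ Set.range (segmentVertex e (p := p) hq) ↔ p < i ∧ i < q := by
  constructor
  · rintro ⟨j, hj⟩
    rw [← D.point_eq_segmentVertex] at hj
    have hj' := Finset.mem_Ioo.1 j.2
    have := D.point_injOn e (by omega) hi hj
    omega
  · rintro h
    exact ⟨⟨i, Finset.mem_Ioo.2 h⟩, (D.point_eq_segmentVertex e hq ⟨i, Finset.mem_Ioo.2 h⟩).symm⟩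

lemma weightMatrix_segmentVertex_point (e : G.edgeSet) {p q : ℕ} (hq : q ≤ 2 ^ r) (j : Inner p q)
    {i : ℕ} (hi : i ≤ 2 ^ r) :
    D.weightMatrix r w (segmentVertex e hq j) (D.point r e i) = chainMatrix (edgeWeights w e) j i :=
  D.weightMatrix_inr_point w e _ hi

lemma weightMatrix_submatrix_segmentVertex (e : G.edgeSet) {p q : ℕ} (hq : q ≤ 2 ^ r) :
    (D.weightMatrix r w).submatrix (segmentVertex e (p := p) hq) (segmentVertex e (p := p) hq)
      = pathMatrix (edgeWeights w e) p q := by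
  ext i j
  have hj := Finset.mem_Ioo.1 j.2
  rw [submatrix_apply, ← D.point_eq_segmentVertex e hq j,
    weightMatrix_segmentVertex_point D w e hq i (by omega)]
  rfl

/-- The weights between an inner vertex of a segment and the vertices outside of the open segment
add up to the weights between this vertex and the end points of the segment. -/
lemma sum_weightMatrix_compl (e : G.edgeSet) {p q : ℕ} (hq : q ≤ 2 ^ r) (j : Inner p q)
    [Fintype {y : SubVertex G r // y ∉ Set.range (segmentVertex e (p := p) hq)}] :
    ∑ y : {y : SubVertex G r // y ∉ Set.range (segmentVertex e (p := p) hq)},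
      D.weightMatrix r w (segmentVertex e hq j) y = pathBoundary (edgeWeights w e) p q j := by
  classical
  have hj := Finset.mem_Ioo.1 j.2
  have h1 (z : SubVertex G r) (a : ℝ) :
      ∑ y : {y : SubVertex G r // y ∉ Set.range (segmentVertex e (p := p) hq)},
        (if (y : SubVertex G r) = z then a else 0)
          = if z ∈ Set.range (segmentVertex e (p := p) hq) then 0 else a := by
    split_ifs with h
    · exact Finset.sum_eq_zero fun y _ => if_neg fun (hy : (y : SubVertex G r) = z) => y.2 (by rw [hy]; exact h)
    · rw [Finset.sum_eq_single ⟨z, h⟩ (fun y _ hy => if_neg fun hz => hy (Subtype.ext hz))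
        (fun h0 => absurd (Finset.mem_univ _) h0), if_pos rfl]
  simp only [segmentVertex, weightMatrix_inr, Finset.sum_add_distrib]
  rw [h1, h1, if_congr (D.point_mem_range_segmentVertex e hq (by omega)) rfl rfl,
    if_congr (D.point_mem_range_segmentVertex e hq (by omega)) rfl rfl, pathBoundary, chainMatrix,
    chainMatrix]
  congr 1
  · by_cases h : p < j - 1 ∧ (j : ℕ) - 1 < q
    · rw [if_pos h, if_neg (by omega), if_neg (by omega)]
    · rw [if_neg h, if_neg (by omega), if_pos (by omega), show (j : ℕ) - 1 = p by omega]
  · by_cases h : p < j + 1 ∧ (j : ℕ) + 1 < q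
    · rw [if_pos h, if_neg (by omega), if_neg (by omega)]
    · rw [if_neg h, if_pos (by omega)]

end Weights

end EdgeDirection

end VRJP

namespace VRJP

open Matrix

/-! ### The effective weight of an edge -/

namespace EdgeDirection

section EffectiveWeight

variable {V : Type*} [Fintype V] [DecidableEq V] {G : SimpleGraph V} [DecidableRel G.Adj]
  (D : EdgeDirection G) {l r : ℕ} (w : SubEdge G r → ℝ)

/-- The segment of `G_l` which contains a vertex of `G_r`, if this is a new vertex. -/
def segmentOf (l : ℕ) {r : ℕ} : SubVertex G r → Option (G.edgeSet × ℕ)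
  | Sum.inl _ => none
  | Sum.inr (e, j) => some (e, j / 2 ^ (r - l))

lemma two_pow_mul_le (hlr : l ≤ r) {i : ℕ} (hi : i ≤ 2 ^ l) : 2 ^ (r - l) * i ≤ 2 ^ r := by
  calc 2 ^ (r - l) * i ≤ 2 ^ (r - l) * 2 ^ l := Nat.mul_le_mul_left _ hi
    _ = 2 ^ r := by rw [← pow_add, Nat.sub_add_cancel hlr]

lemma weightMatrix_coarsePoint (hlr : l ≤ r) (e : SubEdge G l) :
    D.weightMatrix r w (D.point r e.1 (2 ^ (r - l) * e.2)) (D.point r e.1 (2 ^ (r - l) * (e.2 + 1)))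
      = chainMatrix (edgeWeights w e.1) (2 ^ (r - l) * e.2) (2 ^ (r - l) * (e.2 + 1)) := by
  have hq : 2 ^ (r - l) * ((e.2 : ℕ) + 1) ≤ 2 ^ r := two_pow_mul_le hlr e.2.2
  have hN : 0 < 2 ^ (r - l) := by positivity
  set p := 2 ^ (r - l) * (e.2 : ℕ) with hp
  rw [mul_add, mul_one, ← hp] at hq ⊢
  rcases Nat.eq_or_lt_of_le (show 1 ≤ 2 ^ (r - l) from hN) with h | h
  · rw [← h] at hq ⊢
    rw [D.weightMatrix_point_succ w (e.1, ⟨p, by omega⟩), chainMatrix, if_pos rfl, edgeWeights,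
      dif_pos (by omega)]
  · rw [chainMatrix, if_neg (by omega), if_neg (by omega), weightMatrix]
    refine Finset.sum_eq_zero fun f _ => if_neg fun hf => ?_
    obtain ⟨-, h1, h2⟩ := D.segment_eq (Nat.lt_succ_self f.2) f.2.2 (by omega) hq hf
    omega

/-- A vertex of `Λ_l` which is joined to a new vertex is an end point of its segment. -/
lemma eq_or_eq_of_weightMatrix_ne_zero {x : SubVertex G r}
    (hx : x ∈ coarseVertices G l r) {e : G.edgeSet} {j : {j : ℕ // j ∈ Finset.Ioo 0 (2 ^ r)}}
    (hj : ¬ 2 ^ (r - l) ∣ (j : ℕ)) (h : D.weightMatrix r w (Sum.inr (e, j)) x ≠ 0) :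
    x = D.point r e (2 ^ (r - l) * (j / 2 ^ (r - l))) ∨
      x = D.point r e (2 ^ (r - l) * (j / 2 ^ (r - l) + 1)) := by
  have hj' := Finset.mem_Ioo.1 j.2
  have hN : 0 < 2 ^ (r - l) := by positivity
  rw [weightMatrix_inr] at h
  by_cases h1 : x = D.point r e (j - 1)
  · left
    have h2 : 2 ^ (r - l) ∣ (j : ℕ) - 1 :=
      (D.point_mem_coarseVertices_iff e (by omega)).1 (h1 ▸ hx)
    have h3 : (j : ℕ) / 2 ^ (r - l) = (j - 1) / 2 ^ (r - l) := by
      conv_lhs => rw [show (j : ℕ) = j - 1 + 1 by omega]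
      rw [Nat.succ_div, if_neg, add_zero]
      rwa [show (j : ℕ) - 1 + 1 = j by omega]
    rw [h1, h3, Nat.mul_div_cancel' h2]
  · by_cases h4 : x = D.point r e (j + 1)
    · right
      have h2 : 2 ^ (r - l) ∣ (j : ℕ) + 1 :=
        (D.point_mem_coarseVertices_iff e (by omega)).1 (h4 ▸ hx)
      have h3 : (j : ℕ) / 2 ^ (r - l) + 1 = (j + 1) / 2 ^ (r - l) := by
        rw [Nat.succ_div, if_pos h2]
      rw [h4, h3, Nat.mul_div_cancel' h2]
    · rw [if_neg h1, if_neg h4, add_zero] at h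
      exact absurd rfl h

open Classical in
lemma effectiveEdgeWeight_eq_dotProduct (e : SubEdge G l) (β : SubVertex G r → ℝ) :
    D.effectiveEdgeWeight l r w β e =
      D.weightMatrix r w (D.point r e.1 (2 ^ (r - l) * e.2)) (D.point r e.1 (2 ^ (r - l) * (e.2 + 1)))
      + (fun i : {x // x ∉ coarseVertices G l r} =>
          D.weightMatrix r w i.1 (D.point r e.1 (2 ^ (r - l) * e.2)))
        ⬝ᵥ ((hMatrix (D.weightMatrix r w) β).submatrix
            (Subtype.val : {x // x ∉ coarseVertices G l r} → _)
            (Subtype.val : {x // x ∉ coarseVertices G l r} → _))⁻¹ *ᵥ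
          fun i => D.weightMatrix r w i.1 (D.point r e.1 (2 ^ (r - l) * (e.2 + 1))) := by
  have hWs := D.weightMatrix_isSymm w
  simp only [effectiveEdgeWeight, effectiveWeights, Matrix.add_apply, coarsePoint]
  rw [Matrix.mul_assoc, mul_apply]
  refine congrArg₂ (· + ·) rfl (Finset.sum_congr rfl fun i _ => ?_)
  exact congrArg₂ (· * ·) (hWs.apply i.1 _) rfl

open Classical in
/-- Only the new vertices between the two end points of an edge of `G_l` contribute to its
effective weight. -/
lemma effectiveEdgeWeight_eq_pathWeight (hlr : l ≤ r) (e : SubEdge G l) {β : SubVertex G r → ℝ}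
    (hβ : (hMatrix (D.weightMatrix r w) β).PosDef)
    {p q : ℕ} (hp : p = 2 ^ (r - l) * e.2) (hqd : q = 2 ^ (r - l) * (e.2 + 1)) (hq : q ≤ 2 ^ r) :
    D.effectiveEdgeWeight l r w β e =
      pathWeight (edgeWeights w e.1) p q (β ∘ segmentVertex e.1 hq) := by
  have hxJ := D.point_mem_coarseVertices l r e.1 e.2
  have hyJ := D.point_mem_coarseVertices l r e.1 (e.2 + 1)
  have hE := D.effectiveEdgeWeight_eq_dotProduct w e β
  have hWxy := D.weightMatrix_coarsePoint w hlr e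
  set N := 2 ^ (r - l) with hN
  have hN0 : 0 < N := by positivity
  rw [← hp] at hxJ hWxy hE
  rw [← hqd] at hyJ hWxy hE
  have hpq : p < q := by
    rw [hp, hqd]
    exact Nat.mul_lt_mul_of_pos_left (Nat.lt_succ_self _) hN0
  set W := D.weightMatrix r w with hW
  have hWs : W.IsSymm := D.weightMatrix_isSymm w
  set x := D.point r e.1 p with hx
  set y := D.point r e.1 q with hy
  set A := (hMatrix W β).submatrix (Subtype.val : {x // x ∉ coarseVertices G l r} → _)
    Subtype.val with hA
  have hAP : A.PosDef := hβ.submatrix Subtype.val_injective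
  -- every vertex outside of `Λ_l` is a new vertex at a position not divisible by `N`
  have hI (i : {x // x ∉ coarseVertices G l r}) :
      ∃ f j, (i : SubVertex G r) = Sum.inr (f, j) ∧ ¬ N ∣ (j : ℕ) := by
    by_contra! h
    exact i.2 fun f j hfj => h f j hfj
  set c : {x // x ∉ coarseVertices G l r} → Option (G.edgeSet × ℕ) := fun i => segmentOf l i.1
    with hc
  -- adjacent vertices outside of `Λ_l` belong to the same edge of `G_l`, so `A` is block diagonal
  have hblock : ∀ i j, c i ≠ c j → A i j = 0 := by
    intro i j hij
    obtain ⟨f, a, hfa, ha⟩ := hI i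
    obtain ⟨g, b, hgb, hb⟩ := hI j
    have hne : (i : SubVertex G r) ≠ j := fun h => hij (by simp only [hc, h])
    have h1 : W i j = 0 := by
      by_contra h0
      simp only [hc, hfa, hgb, segmentOf, ← hN] at hij
      rw [hfa, hgb, hW, weightMatrix_inr] at h0
      have ha' := Finset.mem_Ioo.1 a.2
      by_cases h2 : Sum.inr (g, b) = D.point r f (a - 1)
      · obtain ⟨rfl, h3⟩ := (D.point_eq_inr_iff).1 h2.symm
        refine hij ?_
        have h4 : (a : ℕ) = b + 1 := by omega
        rw [h4, Nat.succ_div, if_neg (h4 ▸ ha), add_zero]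
      · by_cases h3 : Sum.inr (g, b) = D.point r f (a + 1)
        · obtain ⟨rfl, h4⟩ := (D.point_eq_inr_iff).1 h3.symm
          refine hij ?_
          rw [← h4, Nat.succ_div, if_neg (h4 ▸ hb), add_zero]
        · rw [if_neg h2, if_neg h3, add_zero] at h0
          exact h0 rfl
    simp [hA, hMatrix, hne, h1]
  have hmem (j : Inner p q) : segmentVertex e.1 hq j ∉ coarseVertices G l r := by
    have hj := Finset.mem_Ioo.1 j.2
    rw [← D.point_eq_segmentVertex, D.point_mem_coarseVertices_iff e.1 (by omega)]
    rintro ⟨t, ht⟩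
    rw [← hN] at ht
    rw [ht, hp, hqd] at hj
    have h1 := Nat.lt_of_mul_lt_mul_left hj.1
    have h2 := Nat.lt_of_mul_lt_mul_left hj.2
    omega
  set σ : Inner p q → {x // x ∉ coarseVertices G l r} := fun j => ⟨segmentVertex e.1 hq j, hmem j⟩
    with hσ
  have hσi : Function.Injective σ := fun i j h =>
    segmentVertex_injective e.1 hq (congrArg Subtype.val h)
  have hrange : ∀ i, i ∈ Set.range σ ↔ c i = some (e.1, (e.2 : ℕ)) := by
    intro i
    constructor
    · rintro ⟨j, rfl⟩
      have hj := Finset.mem_Ioo.1 j.2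
      simp only [hc, hσ, segmentVertex, segmentOf, ← hN]
      congr 2
      refine Nat.div_eq_of_lt_le ?_ ?_
      · rw [mul_comm]; omega
      · rw [mul_comm, ← hqd]; exact hj.2
    · intro hi
      obtain ⟨f, a, hfa, ha⟩ := hI i
      simp only [hc, hfa, segmentOf, ← hN, Option.some.injEq, Prod.mk.injEq] at hi
      obtain ⟨rfl, hi⟩ := hi
      have h1 : N * ((a : ℕ) / N) ≤ a := Nat.mul_div_le _ _
      have h2 : (a : ℕ) < N * (a / N + 1) := Nat.lt_mul_div_succ _ hN0
      have h3 : N * ((a : ℕ) / N) ≠ a := fun h => ha ⟨_, h.symm⟩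
      rw [hi] at h1 h2 h3
      exact ⟨⟨a, Finset.mem_Ioo.2 ⟨by omega, by omega⟩⟩, Subtype.ext hfa.symm⟩
  -- only the block of the edge `e` is joined to both of its end points
  have huv : ∀ i j, W i.1 x ≠ 0 → W j.1 y ≠ 0 → c i = c j → c i = some (e.1, (e.2 : ℕ)) := by
    intro i j hi hj hij
    obtain ⟨f, a, hfa, ha⟩ := hI i
    obtain ⟨g, b, hgb, hb⟩ := hI j
    rw [hfa] at hi
    rw [hgb] at hj
    have h1 := D.eq_or_eq_of_weightMatrix_ne_zero w hxJ ha hi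
    have h2 := D.eq_or_eq_of_weightMatrix_ne_zero w hyJ hb hj
    simp only [hc, hfa, hgb, segmentOf, ← hN, Option.some.injEq, Prod.mk.injEq] at hij ⊢
    obtain ⟨rfl, hab⟩ := hij
    rw [← hN, hab] at h1
    rw [← hN] at h2
    have hxy : x ≠ y := fun h => by
      have := D.point_injOn e.1 (by omega) hq h
      omega
    have hb' := Finset.mem_Ioo.1 b.2
    have hle : N * ((b : ℕ) / N + 1) ≤ 2 ^ r := by
      refine two_pow_mul_le hlr (Nat.succ_le_of_lt ?_)
      rw [Nat.div_lt_iff_lt_mul hN0, mul_comm, hN, ← pow_add, Nat.sub_add_cancel hlr]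
      exact hb'.2
    have hlt : N * ((b : ℕ) / N) < N * (b / N + 1) :=
      Nat.mul_lt_mul_of_pos_left (Nat.lt_succ_self _) hN0
    have h3 : s(D.point r f (N * (b / N)), D.point r f (N * (b / N + 1))) = s(x, y) := by
      rcases h1 with h1 | h1 <;> rcases h2 with h2 | h2
      · exact absurd (h1.trans h2.symm) hxy
      · rw [h1, h2]
      · rw [h1, h2, Sym2.eq_swap]
      · exact absurd (h1.trans h2.symm) hxy
    obtain ⟨h4, h5, -⟩ := D.segment_eq hlt hle hpq hq h3
    exact ⟨h4, by rw [hab]; exact Nat.eq_of_mul_eq_mul_left hN0 (h5.trans hp)⟩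
  have hkey := dotProduct_inv_mulVec_eq_submatrix (A := A) (u := fun i => W i.1 x)
    (v := fun i => W i.1 y) hblock ((isUnit_iff_isUnit_det _).1 hAP.isUnit) hσi hrange huv
  have hAσ : A.submatrix σ σ
      = hMatrix (pathMatrix (edgeWeights w e.1) p q) (β ∘ segmentVertex e.1 hq) := by
    rw [← D.weightMatrix_submatrix_segmentVertex w e.1 hq]
    ext i j
    have h1 : segmentVertex e.1 hq i = segmentVertex e.1 hq j ↔ i = j :=
      (segmentVertex_injective e.1 hq).eq_iff
    simp [hA, hσ, hMatrix, diagonal_apply, h1, hW]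
  rw [hE, hkey, hAσ, pathWeight, hWxy]
  congr 2
  · ext j
    exact D.weightMatrix_segmentVertex_point w e.1 hq j (by omega)
  · congr 1
    ext j
    exact D.weightMatrix_segmentVertex_point w e.1 hq j hq

end EffectiveWeight

end EdgeDirection

end VRJP

namespace VRJP

open Matrix

/-! ### The law of the effective weights -/

/-- The restriction of the `β`-field to a set of vertices has density at most `betaDensity`, whose
boundary vector consists of the weights to the other vertices. -/
lemma lintegral_betaLaw_le {Λ I : Type*} [Fintype Λ] [DecidableEq Λ] [Fintype I] [DecidableEq I]
    {W : Matrix Λ Λ ℝ} (hW : W.IsSymm) {σ : I → Λ} (hσ : Function.Injective σ)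
    [Fintype {y // y ∉ Set.range σ}] {F : (Λ → ℝ) → ℝ≥0∞} (hF : Measurable F)
    {g : (I → ℝ) → ℝ≥0∞} (hFg : ∀ β, (hMatrix W β).PosDef → F β = g (β ∘ σ)) :
    ∫⁻ β, F β ∂(betaLaw W) ≤
      ∫⁻ x, betaDensity (hMatrix (W.submatrix σ σ) x)
        (fun i => ∑ y : {y // y ∉ Set.range σ}, W (σ i) y) * g x := by
  classical
  let E : I ⊕ {y : Λ // y ∉ Set.range σ} ≃ Λ :=
    Equiv.ofBijective (Sum.elim σ Subtype.val) (by
      refine ⟨hσ.sumElim Subtype.val_injective fun a b h => b.2 ⟨a, h⟩, fun y => ?_⟩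
      by_cases hy : y ∈ Set.range σ
      · obtain ⟨a, ha⟩ := hy
        exact ⟨Sum.inl a, ha⟩
      · exact ⟨Sum.inr ⟨y, hy⟩, rfl⟩)
  have hEl : (E ∘ Sum.inl) = σ := rfl
  rw [betaLaw_eq, lintegral_withDensity_eq_lintegral_mul _ (measurable_betaDensity_hMatrix _ _) hF,
    lintegral_pi_equiv_sum E ((measurable_betaDensity_hMatrix _ _).mul hF)]
  refine lintegral_mono fun x => ?_
  set S := W.submatrix (E ∘ Sum.inr) (E ∘ Sum.inr)
    + (W.submatrix (E ∘ Sum.inl) (E ∘ Sum.inr))ᵀ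
      * (hMatrix (W.submatrix (E ∘ Sum.inl) (E ∘ Sum.inl)) x)⁻¹
      * W.submatrix (E ∘ Sum.inl) (E ∘ Sum.inr) with hS
  set a := betaDensity (hMatrix (W.submatrix σ σ) x)
        (fun i => ∑ y : {y // y ∉ Set.range σ}, W (σ i) y) with ha
  have hfac (y : {y : Λ // y ∉ Set.range σ} → ℝ) :
      betaDensity (hMatrix W (Sum.elim x y ∘ E.symm)) 0 = a * betaDensity (hMatrix S y) 0 := by
    rw [betaDensity_hMatrix_sumElim E hW]
    congr 2
    · ext i
      simp only [Pi.zero_apply, zero_add]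
      rfl
    · ext i
      simp
  have hpt (y : {y : Λ // y ∉ Set.range σ} → ℝ) :
      betaDensity (hMatrix W (Sum.elim x y ∘ E.symm)) 0 * F (Sum.elim x y ∘ E.symm)
        = a * g x * betaDensity (hMatrix S y) 0 := by
    have h1 : (Sum.elim x y ∘ E.symm) ∘ σ = x := by
      ext i
      change Sum.elim x y (E.symm (E (Sum.inl i))) = x i
      rw [E.symm_apply_apply, Sum.elim_inl]
    by_cases hP : (hMatrix W (Sum.elim x y ∘ E.symm)).PosDef
    · rw [hFg _ hP, h1, hfac]
      ring
    · have h2 : betaDensity (hMatrix W (Sum.elim x y ∘ E.symm)) 0 = 0 := by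
        rw [betaDensity, if_neg hP]
      rw [mul_right_comm, ← hfac, h2, zero_mul, zero_mul]
  simp only [Pi.mul_apply, hpt]
  rw [lintegral_const_mul _ (measurable_betaDensity_hMatrix _ _)]
  by_cases hP : (hMatrix (W.submatrix σ σ) x).PosDef
  swap
  · have h2 : a = 0 := by rw [ha, betaDensity, if_neg hP]
    simp [h2]
  have hSs : S.IsSymm := by
    rw [Matrix.IsSymm, hS, transpose_add, transpose_mul, transpose_mul, transpose_transpose]
    rw [hEl, transpose_inv_of_posDef hP, (hW.submatrix _).eq, Matrix.mul_assoc]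
  calc a * g x * ∫⁻ y, betaDensity (hMatrix S y) 0 ≤ a * g x * 1 := by
        gcongr
        exact lintegral_betaDensity_le_one hSs 0
    _ = a * g x := mul_one _

namespace EdgeDirection

section Law

variable {V : Type*} [Fintype V] [DecidableEq V] {G : SimpleGraph V} [DecidableRel G.Adj]
  (D : EdgeDirection G) {l r : ℕ} (w : SubEdge G r → ℝ)

lemma measurable_weightMatrix (x y : SubVertex G r) :
    Measurable fun w : SubEdge G r → ℝ => D.weightMatrix r w x y := by
  unfold weightMatrix
  refine Finset.measurable_sum _ fun e _ => ?_
  split_ifs <;> fun_prop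

lemma measurable_effectiveEdgeWeight_uncurry (l : ℕ) (e : SubEdge G l) :
    Measurable fun x : (SubEdge G r → ℝ) × (SubVertex G r → ℝ) =>
      D.effectiveEdgeWeight l r x.1 x.2 e := by
  classical
  simp only [effectiveEdgeWeight_eq_dotProduct]
  have h (x y : SubVertex G r) : Measurable
      fun z : (SubEdge G r → ℝ) × (SubVertex G r → ℝ) => D.weightMatrix r z.1 x y :=
    (D.measurable_weightMatrix x y).comp measurable_fst
  refine Measurable.add (h _ _) (measurable_dotProduct_inv_mulVec (fun i j => ?_)
    (fun i => h _ _) (fun i => h _ _))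
  exact measurable_hMatrix (W := fun z : (SubEdge G r → ℝ) × (SubVertex G r → ℝ) =>
    D.weightMatrix r z.1) h (β := fun z => z.2)
    (fun i => (measurable_pi_apply i).comp measurable_snd) i.1 j.1

/-- For given edge weights, the law of an effective weight is the one of a path. The remaining
vertices have density of total mass at most `1`, whence the inequality. -/
lemma lintegral_effectiveEdgeWeight_le (hlr : l ≤ r) (e : SubEdge G l) {f : ℝ → ℝ≥0∞}
    (hf : Measurable f) {p q : ℕ} (hp : p = 2 ^ (r - l) * e.2)
    (hqd : q = 2 ^ (r - l) * (e.2 + 1)) (hq : q ≤ 2 ^ r) :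
    ∫⁻ β, f (D.effectiveEdgeWeight l r w β e) ∂(betaLaw (D.weightMatrix r w))
      ≤ ∫⁻ x, f x ∂(pathLaw (edgeWeights w e.1) p q) := by
  classical
  have h0 := D.measurable_effectiveEdgeWeight_uncurry (r := r) l e
  have hF : Measurable fun β => D.effectiveEdgeWeight l r w β e :=
    Measurable.of_uncurry_left (f := fun w β => D.effectiveEdgeWeight l r w β e) h0
  refine (lintegral_betaLaw_le (D.weightMatrix_isSymm w) (segmentVertex_injective e.1 hq)
    (hf.comp hF) (g := fun x => f (pathWeight (edgeWeights w e.1) p q x)) fun β hβ => ?_).trans ?_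
  · simp only [Function.comp_apply]
    rw [D.effectiveEdgeWeight_eq_pathWeight w hlr e hβ hp hqd hq]
  · rw [lintegral_pathLaw _ _ _ hf]
    refine (lintegral_congr fun x => ?_).le
    rw [weightMatrix_submatrix_segmentVertex, pathDensity]
    congr 2
    ext i
    exact D.sum_weightMatrix_compl w e.1 hq i

end Law

end EdgeDirection

end VRJP

namespace VRJP

open Matrix

/-! ### Random edge weights -/

section Series

lemma chainMatrix_congr {w w' : ℕ → ℝ} {p q : ℕ} (h : ∀ i, p ≤ i → i < q → w i = w' i) {i j : ℕ}
    (hi : p ≤ i) (hi' : i ≤ q) (hj : p ≤ j) (hj' : j ≤ q) :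
    chainMatrix w i j = chainMatrix w' i j := by
  unfold chainMatrix
  split_ifs
  · exact h i hi (by omega)
  · exact h j hj (by omega)
  · rfl

lemma pathLaw_congr {w w' : ℕ → ℝ} {p q : ℕ} (hpq : p ≤ q)
    (h : ∀ i, p ≤ i → i < q → w i = w' i) : pathLaw w p q = pathLaw w' p q := by
  have hI (i : Inner p q) : p ≤ i ∧ (i : ℕ) ≤ q := by
    have := Finset.mem_Ioo.1 i.2
    omega
  have h1 : pathMatrix w p q = pathMatrix w' p q := by
    ext i j
    exact chainMatrix_congr h (hI i).1 (hI i).2 (hI j).1 (hI j).2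
  have h2 (i : Inner p q) : chainMatrix w i p = chainMatrix w' i p :=
    chainMatrix_congr h (hI i).1 (hI i).2 le_rfl hpq
  have h3 (i : Inner p q) : chainMatrix w i q = chainMatrix w' i q :=
    chainMatrix_congr h (hI i).1 (hI i).2 hpq le_rfl
  have h4 : pathDensity w p q = pathDensity w' p q := by
    funext β
    simp only [pathDensity, h1]
    congr 1
    funext i
    simp only [pathBoundary, h2, h3]
  have h5 : pathWeight w p q = pathWeight w' p q := by
    funext β
    simp only [pathWeight, h1, h2, h3, chainMatrix_congr h le_rfl hpq hpq le_rfl]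
  rw [pathLaw, pathLaw, h4, h5]

/-- The law of the effective weight of a path, as a kernel from the edge weights. -/
def pathKernel (p q : ℕ) : Kernel (ℕ → ℝ) ℝ where
  toFun w := pathLaw w p q
  measurable' := by
    refine Measure.measurable_of_measurable_coe _ fun s hs => ?_
    have h1 (w : ℕ → ℝ) : pathLaw w p q s =
        ∫⁻ β, pathDensity w p q β * s.indicator 1 (pathWeight w p q β) := by
      rw [← lintegral_indicator_one hs, lintegral_pathLaw w p q (measurable_one.indicator hs)]
    simp only [h1]
    refine Measurable.lintegral_prod_right' (f := fun x : (ℕ → ℝ) × (Inner p q → ℝ) =>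
      pathDensity x.1 p q x.2 * s.indicator 1 (pathWeight x.1 p q x.2)) ?_
    exact (measurable_pathDensity_uncurry p q).mul
      ((measurable_one.indicator hs).comp (measurable_pathWeight_uncurry p q))

instance (p q : ℕ) : IsFiniteKernel (pathKernel p q) :=
  ⟨1, ENNReal.one_lt_top, fun w => pathLaw_univ_le_one w p q⟩

/-- The law of the effective weight of `2 ^ k` edges in series with independent weights of
law `μ`. -/
def iteratedSeriesLaw (μ : Measure ℝ) : ℕ → Measure ℝ
  | 0 => μ
  | k + 1 => seriesLaw (iteratedSeriesLaw μ k) (iteratedSeriesLaw μ k)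

lemma seriesLaw_univ_le_one {μ ν : Measure ℝ} [SFinite μ] [SFinite ν] (hμ : μ Set.univ ≤ 1)
    (hν : ν Set.univ ≤ 1) : seriesLaw μ ν Set.univ ≤ 1 := by
  rw [← lintegral_one, lintegral_seriesLaw μ ν measurable_const]
  simp only [mul_one]
  calc ∫⁻ a, ∫⁻ b, (∫⁻ h, rigDensity (a + b) h) ∂ν ∂μ ≤ ∫⁻ _, ∫⁻ _, 1 ∂ν ∂μ :=
        lintegral_mono fun a => lintegral_mono fun b => lintegral_rigDensity_le_one _
    _ ≤ 1 := by
        simp only [lintegral_const, one_mul]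
        exact mul_le_one' hν hμ

lemma iteratedSeriesLaw_univ_le_one (μ : Measure ℝ) [IsProbabilityMeasure μ] (k : ℕ) :
    iteratedSeriesLaw μ k Set.univ ≤ 1 := by
  induction k with
  | zero => exact (prob_le_one : μ Set.univ ≤ 1)
  | succ k ih =>
    have : IsFiniteMeasure (iteratedSeriesLaw μ k) := ⟨ih.trans_lt ENNReal.one_lt_top⟩
    exact seriesLaw_univ_le_one ih ih

instance (μ : Measure ℝ) [IsProbabilityMeasure μ] (k : ℕ) :
    IsFiniteMeasure (iteratedSeriesLaw μ k) :=
  ⟨(iteratedSeriesLaw_univ_le_one μ k).trans_lt ENNReal.one_lt_top⟩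

/-- Mixtures of two kernels over independent random variables are independent. -/
lemma lintegral_lintegral_kernel_of_indepFun {Ω 𝓐 𝓑 : Type*} [MeasurableSpace Ω]
    [MeasurableSpace 𝓐] [MeasurableSpace 𝓑] {P : Measure Ω} [IsFiniteMeasure P]
    {A : Ω → 𝓐} {B : Ω → 𝓑} (hA : Measurable A) (hB : Measurable B) (hAB : IndepFun A B P)
    (κ₁ : Kernel 𝓐 ℝ) (κ₂ : Kernel 𝓑 ℝ) [IsFiniteKernel κ₁] [IsFiniteKernel κ₂]
    {μ₁ μ₂ : Measure ℝ} [SFinite μ₂]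
    (h₁ : ∀ f : ℝ → ℝ≥0∞, Measurable f → ∫⁻ ω, ∫⁻ x, f x ∂(κ₁ (A ω)) ∂P = ∫⁻ x, f x ∂μ₁)
    (h₂ : ∀ f : ℝ → ℝ≥0∞, Measurable f → ∫⁻ ω, ∫⁻ x, f x ∂(κ₂ (B ω)) ∂P = ∫⁻ x, f x ∂μ₂)
    {F : ℝ → ℝ → ℝ≥0∞} (hF : Measurable (Function.uncurry F)) :
    ∫⁻ ω, ∫⁻ a, ∫⁻ b, F a b ∂(κ₂ (B ω)) ∂(κ₁ (A ω)) ∂P = ∫⁻ a, ∫⁻ b, F a b ∂μ₂ ∂μ₁ := by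
  have hm2 : Measurable fun z : 𝓑 × ℝ => ∫⁻ b, F z.2 b ∂(κ₂ z.1) :=
    Measurable.lintegral_kernel_prod_right' (κ := κ₂.prodMkRight ℝ)
      (f := fun z : (𝓑 × ℝ) × ℝ => F z.1.2 z.2)
      (hF.comp ((measurable_snd.comp measurable_fst).prodMk measurable_snd))
  have hm1 : Measurable fun z : 𝓐 × 𝓑 => ∫⁻ a, ∫⁻ b, F a b ∂(κ₂ z.2) ∂(κ₁ z.1) :=
    Measurable.lintegral_kernel_prod_right' (κ := κ₁.prodMkRight 𝓑)
      (f := fun z : (𝓐 × 𝓑) × ℝ => ∫⁻ b, F z.2 b ∂(κ₂ z.1.2))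
      (hm2.comp ((measurable_snd.comp measurable_fst).prodMk measurable_snd))
  have hFa (a : ℝ) : Measurable (F a) := Measurable.of_uncurry_left hF
  calc ∫⁻ ω, ∫⁻ a, ∫⁻ b, F a b ∂(κ₂ (B ω)) ∂(κ₁ (A ω)) ∂P
      = ∫⁻ z, ∫⁻ a, ∫⁻ b, F a b ∂(κ₂ z.2) ∂(κ₁ z.1) ∂(P.map fun ω => (A ω, B ω)) := by
        rw [lintegral_map hm1 (hA.prodMk hB)]
    _ = ∫⁻ x, ∫⁻ y, ∫⁻ a, ∫⁻ b, F a b ∂(κ₂ y) ∂(κ₁ x) ∂(P.map B) ∂(P.map A) := by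
        rw [(indepFun_iff_map_prod_eq_prod_map_map hA.aemeasurable hB.aemeasurable).1 hAB,
          lintegral_prod _ hm1.aemeasurable]
    _ = ∫⁻ x, ∫⁻ a, ∫⁻ y, ∫⁻ b, F a b ∂(κ₂ y) ∂(P.map B) ∂(κ₁ x) ∂(P.map A) := by
        refine lintegral_congr fun x => ?_
        exact lintegral_lintegral_swap hm2.aemeasurable
    _ = ∫⁻ x, ∫⁻ a, ∫⁻ b, F a b ∂μ₂ ∂(κ₁ x) ∂(P.map A) := by
        refine lintegral_congr fun x => lintegral_congr fun a => ?_
        rw [lintegral_map ((hFa a).lintegral_kernel) hB, h₂ _ (hFa a)]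
    _ = ∫⁻ a, ∫⁻ b, F a b ∂μ₂ ∂μ₁ := by
        have h3 : Measurable fun a => ∫⁻ b, F a b ∂μ₂ := hF.lintegral_prod_right'
        rw [lintegral_map h3.lintegral_kernel hA, h₁ _ h3]

/-- For independent edge weights of law `μ`, the law of the effective weight of a path with `2 ^ k`
edges: the path is cut in its middle. -/
lemma lintegral_lintegral_pathLaw {Ω : Type*} [MeasurableSpace Ω] {P : Measure Ω}
    [IsProbabilityMeasure P] {n : ℕ} {X : ℕ → Ω → ℝ} (hX : ∀ i, Measurable (X i))
    (hind : iIndepFun (fun (i : Fin n) => X i) P) {μ : Measure ℝ} [IsProbabilityMeasure μ]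
    (hμ : ∀ i < n, P.map (X i) = μ) (k : ℕ) {p : ℕ} (hp : p + 2 ^ k ≤ n) {f : ℝ → ℝ≥0∞}
    (hf : Measurable f) :
    ∫⁻ ω, ∫⁻ x, f x ∂(pathLaw (fun i => X i ω) p (p + 2 ^ k)) ∂P
      = ∫⁻ x, f x ∂(iteratedSeriesLaw μ k) := by
  induction k generalizing p f with
  | zero =>
    rw [pow_zero] at hp ⊢
    simp only [pathLaw_succ, lintegral_dirac' _ hf]
    rw [iteratedSeriesLaw, ← hμ p (by omega), lintegral_map hf (hX p)]
  | succ k ih =>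
    have h2k : 0 < 2 ^ k := by positivity
    set m := p + 2 ^ k with hm
    have hq : p + 2 ^ (k + 1) = m + 2 ^ k := by rw [hm, pow_succ]; ring
    rw [hq] at hp ⊢
    -- the weights on the two halves of the path
    let A (a b : ℕ) (ω : Ω) (i : ℕ) : ℝ := if a ≤ i ∧ i < b then X i ω else 0
    have hAm (a b : ℕ) : Measurable (A a b) := by
      refine measurable_pi_lambda _ fun i => ?_
      simp only [A]
      split_ifs
      · exact hX i
      · exact measurable_const
    have hA (a b : ℕ) (hab : a ≤ b) (ω : Ω) :
        pathKernel a b (A a b ω) = pathLaw (fun i => X i ω) a b :=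
      pathLaw_congr hab fun i hi hi' => if_pos ⟨hi, hi'⟩
    let S (a b : ℕ) : Finset (Fin n) := Finset.univ.filter fun i => a ≤ (i : ℕ) ∧ (i : ℕ) < b
    let φ (a b : ℕ) (y : S a b → ℝ) (i : ℕ) : ℝ :=
      if h : ∃ hi : i < n, (⟨i, hi⟩ : Fin n) ∈ S a b then y ⟨⟨i, h.1⟩, h.2⟩ else 0
    have hφm (a b : ℕ) : Measurable (φ a b) := by
      refine measurable_pi_lambda _ fun i => ?_
      simp only [φ]
      split_ifs
      · exact measurable_pi_apply _
      · exact measurable_const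
    have hAφ (a b : ℕ) (hb : b ≤ n) : A a b = φ a b ∘ fun ω (i : S a b) => X i.1 ω := by
      funext ω i
      simp only [A, φ, S, Function.comp_apply, Finset.mem_filter, Finset.mem_univ, true_and]
      by_cases h : a ≤ i ∧ i < b
      · rw [if_pos h, dif_pos ⟨by omega, h⟩]
      · rw [if_neg h, dif_neg fun h' => h h'.2]
    have hST : Disjoint (S p m) (S m (m + 2 ^ k)) := by
      rw [Finset.disjoint_left]
      intro i hi hi'
      simp only [S, Finset.mem_filter] at hi hi'
      omega
    have hAB : IndepFun (A p m) (A m (m + 2 ^ k)) P := by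
      rw [hAφ p m (by omega), hAφ m _ hp]
      exact (hind.indepFun_finset (S p m) (S m (m + 2 ^ k)) hST fun i => hX i).comp
        (hφm _ _) (hφm _ _)
    have hG : Measurable fun x : ℝ × ℝ => ∫⁻ h, rigDensity (x.1 + x.2) h * f (x.1 * x.2 / h) :=
      measurable_lintegral_rigDensity (by fun_prop) (F := fun (x : ℝ × ℝ) h => f (x.1 * x.2 / h))
        (hf.comp (by fun_prop))
    have key := lintegral_lintegral_kernel_of_indepFun (hAm p m) (hAm m (m + 2 ^ k)) hAB
      (pathKernel p m) (pathKernel m (m + 2 ^ k)) (μ₁ := iteratedSeriesLaw μ k)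
      (μ₂ := iteratedSeriesLaw μ k)
      (fun g hg => by
        simp only [hA p m (by omega)]
        exact ih (by omega) hg)
      (fun g hg => by
        simp only [hA m (m + 2 ^ k) (by omega)]
        exact ih hp hg)
      (F := fun a b => ∫⁻ h, rigDensity (a + b) h * f (a * b / h)) hG
    rw [iteratedSeriesLaw, lintegral_seriesLaw _ _ hf, ← key]
    refine lintegral_congr fun ω => ?_
    rw [pathLaw_eq_seriesLaw _ (show p < m by omega) (show m < m + 2 ^ k by omega),
      lintegral_seriesLaw _ _ hf, hA p m (by omega), hA m _ (by omega)]

end Series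

end VRJP

namespace VRJP

/-- The law of total expectation, in terms of a conditional law. -/
lemma lintegral_eq_lintegral_condDistrib {Ω 𝓐 𝓑 : Type*} [MeasurableSpace Ω]
    [MeasurableSpace 𝓐] [MeasurableSpace 𝓑] [StandardBorelSpace 𝓑] [Nonempty 𝓑]
    {P : Measure Ω} [IsFiniteMeasure P] {A : Ω → 𝓐} {B : Ω → 𝓑} (hA : Measurable A)
    (hB : Measurable B) {ν : 𝓐 → Measure 𝓑} (hν : ∀ᵐ a ∂(P.map A), condDistrib B A P a = ν a)
    {F : 𝓐 × 𝓑 → ℝ≥0∞} (hF : Measurable F) :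
    ∫⁻ ω, F (A ω, B ω) ∂P = ∫⁻ ω, ∫⁻ b, F (A ω, b) ∂(ν (A ω)) ∂P := by
  have h1 : ∫⁻ ω, F (A ω, B ω) ∂P = ∫⁻ a, ∫⁻ b, F (a, b) ∂(condDistrib B A P a) ∂(P.map A) := by
    rw [← Measure.lintegral_compProd hF, compProd_map_condDistrib hB.aemeasurable,
      lintegral_map hF (hA.prodMk hB)]
  rw [h1, lintegral_map (Measurable.lintegral_kernel_prod_right' hF) hA]
  refine lintegral_congr_ae ?_
  filter_upwards [ae_of_ae_map hA.aemeasurable hν] with ω hω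
  rw [hω]

namespace EdgeDirection

variable {V : Type*} [Fintype V] [DecidableEq V] {G : SimpleGraph V} [DecidableRel G.Adj]
  (D : EdgeDirection G) {l r : ℕ}

lemma lintegral_effectiveEdgeWeight_le_iteratedSeriesLaw (hlr : l ≤ r)
    {Ω : Type*} [MeasurableSpace Ω] {P : Measure Ω} [IsProbabilityMeasure P]
    {W : SubEdge G r → Ω → ℝ} (hW_meas : ∀ e, Measurable (W e)) (hW_indep : iIndepFun W P)
    (e₀ : SubEdge G l) {μ : Measure ℝ} [IsProbabilityMeasure μ] (hμ : ∀ e, P.map (W e) = μ)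
    {f : ℝ → ℝ≥0∞} (hf : Measurable f) :
    ∫⁻ ω, ∫⁻ β, f (D.effectiveEdgeWeight l r (fun e => W e ω) β e₀)
        ∂(betaLaw (D.weightMatrix r fun e => W e ω)) ∂P
      ≤ ∫⁻ x, f x ∂(iteratedSeriesLaw μ (r - l)) := by
  have hq : 2 ^ (r - l) * ((e₀.2 : ℕ) + 1) ≤ 2 ^ r := two_pow_mul_le hlr e₀.2.2
  have hq' : 2 ^ (r - l) * (e₀.2 : ℕ) + 2 ^ (r - l) = 2 ^ (r - l) * ((e₀.2 : ℕ) + 1) := by ring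
  set X : ℕ → Ω → ℝ := fun i ω => edgeWeights (fun e => W e ω) e₀.1 i with hX
  have hXm (i : ℕ) : Measurable (X i) := by
    by_cases hi : i < 2 ^ r
    · simpa only [hX, edgeWeights, dif_pos hi] using hW_meas _
    · simpa only [hX, edgeWeights, dif_neg hi] using measurable_const
  have hXe (i : ℕ) (hi : i < 2 ^ r) : X i = W (e₀.1, ⟨i, hi⟩) := by
    funext ω
    simp only [hX, edgeWeights, dif_pos hi]
  have hind : iIndepFun (fun i : Fin (2 ^ r) => X i) P := by
    have h1 : (fun i : Fin (2 ^ r) => X i) = fun i => W (e₀.1, i) := by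
      funext i
      exact hXe i i.2
    rw [h1]
    exact hW_indep.precomp (Prod.mk_right_injective e₀.1)
  rw [← lintegral_lintegral_pathLaw hXm hind (fun i hi => by rw [hXe i hi, hμ]) (r - l)
    (hq'.le.trans hq) hf]
  refine lintegral_mono fun ω => ?_
  rw [hq']
  exact D.lintegral_effectiveEdgeWeight_le _ hlr e₀ hf rfl rfl hq

/-- The law of the effective weights: an edge of `G_l` consists of `2 ^ (r - l)` edges of `G_r` in
series. -/
lemma map_effectiveEdgeWeight (hlr : l ≤ r)
    {Ω : Type*} [MeasurableSpace Ω] {P : Measure Ω} [IsProbabilityMeasure P]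
    {W : SubEdge G r → Ω → ℝ} (hW_meas : ∀ e, Measurable (W e)) (hW_indep : iIndepFun W P)
    (hW_ident : ∀ e f, IdentDistrib (W e) (W f) P P)
    {β : Ω → SubVertex G r → ℝ} (hβ_meas : Measurable β)
    (hβ_law : ∀ᵐ w ∂(P.map fun ω e => W e ω),
      condDistrib β (fun ω e => W e ω) P w = betaLaw (D.weightMatrix r w))
    (e₀ : SubEdge G l) (e₁ : SubEdge G r) {T : Ω → ℝ}
    (hT : ∀ ω, T ω = D.effectiveEdgeWeight l r (fun f => W f ω) (β ω) e₀) :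
    Measurable T ∧ P.map T = iteratedSeriesLaw (P.map (W e₁)) (r - l) := by
  have hWm : Measurable fun ω e => W e ω := measurable_pi_lambda _ hW_meas
  have hμ : IsProbabilityMeasure (P.map (W e₁)) :=
    Measure.isProbabilityMeasure_map (hW_meas e₁).aemeasurable
  have hF := D.measurable_effectiveEdgeWeight_uncurry (r := r) l e₀
  generalize hΦ : (fun x : (SubEdge G r → ℝ) × (SubVertex G r → ℝ) =>
      D.effectiveEdgeWeight l r x.1 x.2 e₀) = Φ at hF
  have hT' : T = fun ω => Φ ((fun e => W e ω), β ω) := by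
    funext ω
    rw [hT, ← hΦ]
  have hTm : Measurable T := hT' ▸ hF.comp (hWm.prodMk hβ_meas)
  refine ⟨hTm, ?_⟩
  have hPT : IsProbabilityMeasure (P.map T) := Measure.isProbabilityMeasure_map hTm.aemeasurable
  -- the total masses agree, so that one inequality suffices
  have hle : P.map T ≤ iteratedSeriesLaw (P.map (W e₁)) (r - l) := by
    refine Measure.le_iff.2 fun s hs => ?_
    have hf : Measurable (s.indicator (1 : ℝ → ℝ≥0∞)) := measurable_one.indicator hs
    rw [← lintegral_indicator_one hs, ← lintegral_indicator_one hs, lintegral_map hf hTm, hT',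
      lintegral_eq_lintegral_condDistrib hWm hβ_meas hβ_law
        (F := fun x => s.indicator (1 : ℝ → ℝ≥0∞) (Φ x)) (hf.comp hF)]
    subst hΦ
    exact D.lintegral_effectiveEdgeWeight_le_iteratedSeriesLaw hlr hW_meas hW_indep e₀
      (fun e => (hW_ident e e₁).map_eq) hf
  refine Measure.eq_of_le_of_measure_univ_eq hle (le_antisymm (hle _) ?_)
  rw [hPT.measure_univ]
  exact iteratedSeriesLaw_univ_le_one _ _

end EdgeDirection

end VRJP

namespace VRJP

/-! ### Moments of a series reduction -/

section Coupling

variable {μ ν : Measure ℝ}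

lemma lintegral_seriesCoupling (μ ν : Measure ℝ) [SFinite μ] [SFinite ν]
    {F : (ℝ × ℝ) × ℝ → ℝ≥0∞} (hF : Measurable F) :
    ∫⁻ z, F z ∂(seriesCoupling μ ν) =
      ∫⁻ a, ∫⁻ b, (∫⁻ h, F ((a, b), h) * rigDensity (a + b) h) ∂ν ∂μ := by
  have hm : Measurable fun x : (ℝ × ℝ) × ℝ => rigDensity (x.1.1 + x.1.2) x.2 :=
    measurable_rigDensity_uncurry.comp
      (((measurable_fst.comp measurable_fst).add (measurable_snd.comp measurable_fst)).prodMk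
        measurable_snd)
  have hm2 : Measurable fun z : (ℝ × ℝ) × ℝ => F z * rigDensity (z.1.1 + z.1.2) z.2 := hF.mul hm
  rw [seriesCoupling, lintegral_withDensity_eq_lintegral_mul _ hm hF, mul_comm]
  simp only [Pi.mul_apply]
  rw [lintegral_prod _ hm2.aemeasurable, lintegral_prod _ hm2.lintegral_prod_right'.aemeasurable]

lemma lintegral_seriesLaw_eq_lintegral_seriesCoupling (μ ν : Measure ℝ) {f : ℝ → ℝ≥0∞}
    (hf : Measurable f) :
    ∫⁻ x, f x ∂(seriesLaw μ ν) = ∫⁻ z, f (z.1.1 * z.1.2 / z.2) ∂(seriesCoupling μ ν) := by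
  rw [seriesLaw, lintegral_map hf (by fun_prop)]

lemma lintegral_lintegral_congr_of_pos (hμ : ∀ᵐ x ∂μ, 0 < x) (hν : ∀ᵐ x ∂ν, 0 < x)
    {F F' : ℝ → ℝ → ℝ≥0∞} (h : ∀ a b, 0 < a → 0 < b → F a b = F' a b) :
    ∫⁻ a, ∫⁻ b, F a b ∂ν ∂μ = ∫⁻ a, ∫⁻ b, F' a b ∂ν ∂μ := by
  refine lintegral_congr_ae ?_
  filter_upwards [hμ] with a ha
  refine lintegral_congr_ae ?_
  filter_upwards [hν] with b hb
  exact h a b ha hb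

lemma lintegral_lintegral_mono_of_pos (hμ : ∀ᵐ x ∂μ, 0 < x) (hν : ∀ᵐ x ∂ν, 0 < x)
    {F F' : ℝ → ℝ → ℝ≥0∞} (h : ∀ a b, 0 < a → 0 < b → F a b ≤ F' a b) :
    ∫⁻ a, ∫⁻ b, F a b ∂ν ∂μ ≤ ∫⁻ a, ∫⁻ b, F' a b ∂ν ∂μ := by
  refine lintegral_mono_ae ?_
  filter_upwards [hμ] with a ha
  refine lintegral_mono_ae ?_
  filter_upwards [hν] with b hb
  exact h a b ha hb

variable [IsProbabilityMeasure μ] [IsProbabilityMeasure ν]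

/-- The first two marginals of the coupling. -/
lemma lintegral_seriesCoupling_fst (hμ : ∀ᵐ x ∂μ, 0 < x) (hν : ∀ᵐ x ∂ν, 0 < x)
    {F : ℝ × ℝ → ℝ≥0∞} (hF : Measurable F) :
    ∫⁻ z, F z.1 ∂(seriesCoupling μ ν) = ∫⁻ a, ∫⁻ b, F (a, b) ∂ν ∂μ := by
  rw [lintegral_seriesCoupling _ _ (by fun_prop)]
  refine lintegral_lintegral_congr_of_pos hμ hν fun a b ha hb => ?_
  change ∫⁻ h, F (a, b) * rigDensity (a + b) h = F (a, b)
  rw [lintegral_const_mul _ (measurable_rigDensity _), lintegral_rigDensity (add_pos ha hb), mul_one]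

lemma lintegral_seriesCoupling_left (hμ : ∀ᵐ x ∂μ, 0 < x) (hν : ∀ᵐ x ∂ν, 0 < x)
    {F : ℝ → ℝ≥0∞} (hF : Measurable F) :
    ∫⁻ z, F z.1.1 ∂(seriesCoupling μ ν) = ∫⁻ a, F a ∂μ := by
  rw [lintegral_seriesCoupling_fst hμ hν (F := fun x => F x.1) (by fun_prop)]
  simp

lemma lintegral_seriesCoupling_right (hμ : ∀ᵐ x ∂μ, 0 < x) (hν : ∀ᵐ x ∂ν, 0 < x)
    {F : ℝ → ℝ≥0∞} (hF : Measurable F) :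
    ∫⁻ z, F z.1.2 ∂(seriesCoupling μ ν) = ∫⁻ b, F b ∂ν := by
  rw [lintegral_seriesCoupling_fst hμ hν (F := fun x => F x.2) (by fun_prop)]
  simp

lemma isProbabilityMeasure_seriesCoupling (hμ : ∀ᵐ x ∂μ, 0 < x) (hν : ∀ᵐ x ∂ν, 0 < x) :
    IsProbabilityMeasure (seriesCoupling μ ν) := by
  refine ⟨?_⟩
  rw [← lintegral_one, lintegral_seriesCoupling_left hμ hν measurable_const]
  simp

lemma isProbabilityMeasure_seriesLaw (hμ : ∀ᵐ x ∂μ, 0 < x) (hν : ∀ᵐ x ∂ν, 0 < x) :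
    IsProbabilityMeasure (seriesLaw μ ν) := by
  have := isProbabilityMeasure_seriesCoupling hμ hν
  exact Measure.isProbabilityMeasure_map (by fun_prop)

lemma ae_seriesCoupling_pos (hμ : ∀ᵐ x ∂μ, 0 < x) (hν : ∀ᵐ x ∂ν, 0 < x) :
    ∀ᵐ z ∂(seriesCoupling μ ν), 0 < z.1.1 ∧ 0 < z.1.2 ∧ 0 < z.2 := by
  have hs : MeasurableSet {z : (ℝ × ℝ) × ℝ | 0 < z.1.1 ∧ 0 < z.1.2 ∧ 0 < z.2} := by
    refine MeasurableSet.inter ?_ (MeasurableSet.inter ?_ ?_)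
    · exact measurableSet_lt measurable_const (measurable_fst.comp measurable_fst)
    · exact measurableSet_lt measurable_const (measurable_snd.comp measurable_fst)
    · exact measurableSet_lt measurable_const measurable_snd
  rw [ae_iff, ← Set.compl_ofPred, ← lintegral_indicator_one hs.compl,
    lintegral_seriesCoupling _ _ (measurable_one.indicator hs.compl),
    lintegral_lintegral_congr_of_pos hμ hν (F' := fun _ _ => 0)]
  · simp
  · intro a b ha hb
    rw [← lintegral_zero]
    refine lintegral_congr fun h => ?_
    rcases le_or_gt h 0 with hh | hh
    · rw [rigDensity_of_nonpos _ hh, mul_zero]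
    · rw [Set.indicator_of_notMem, zero_mul]
      exact fun h' => h' ⟨ha, hb, hh⟩

lemma ae_seriesLaw_pos (hμ : ∀ᵐ x ∂μ, 0 < x) (hν : ∀ᵐ x ∂ν, 0 < x) :
    ∀ᵐ x ∂(seriesLaw μ ν), 0 < x := by
  have h : Measurable fun z : (ℝ × ℝ) × ℝ => z.1.1 * z.1.2 / z.2 := by fun_prop
  refine (ae_map_iff h.aemeasurable measurableSet_Ioi).2 ?_
  filter_upwards [ae_seriesCoupling_pos hμ hν] with z hz
  exact div_pos (mul_pos hz.1 hz.2.1) hz.2.2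

/-- A bound for the expectation of a function of `h`, uniform in its parameter. -/
lemma lintegral_seriesCoupling_le (hμ : ∀ᵐ x ∂μ, 0 < x) (hν : ∀ᵐ x ∂ν, 0 < x)
    {F : (ℝ × ℝ) × ℝ → ℝ≥0∞} (hF : Measurable F) {c : ℝ≥0∞}
    (h : ∀ a b, 0 < a → 0 < b → ∫⁻ h, F ((a, b), h) * rigDensity (a + b) h ≤ c) :
    ∫⁻ z, F z ∂(seriesCoupling μ ν) ≤ c := by
  rw [lintegral_seriesCoupling _ _ hF]
  refine (lintegral_lintegral_mono_of_pos hμ hν (F' := fun _ _ => c) h).trans ?_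
  simp

lemma lintegral_seriesCoupling_div_le (hμ : ∀ᵐ x ∂μ, 0 < x) (hν : ∀ᵐ x ∂ν, 0 < x) :
    ∫⁻ z, ENNReal.ofReal ((z.1.1 + z.1.2) / z.2) ∂(seriesCoupling μ ν) ≤ 1 :=
  lintegral_seriesCoupling_le hμ hν (by fun_prop) fun _ _ ha hb =>
    (lintegral_div_mul_rigDensity (add_pos ha hb)).le

lemma lintegral_seriesCoupling_rpow_neg_le (hμ : ∀ᵐ x ∂μ, 0 < x) (hν : ∀ᵐ x ∂ν, 0 < x) {α : ℝ}
    (hα : 0 ≤ α) (hα' : α < 1 / 2) :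
    ∫⁻ z, ENNReal.ofReal (z.2 ^ (-α)) ∂(seriesCoupling μ ν) ≤ ENNReal.ofReal (cAlpha α) :=
  lintegral_seriesCoupling_le hμ hν (by fun_prop) fun _ _ ha hb =>
    lintegral_rpow_neg_mul_rigDensity_le hα hα' (add_pos ha hb)

lemma lintegral_seriesCoupling_div_two_add_le (hμ : ∀ᵐ x ∂μ, 0 < x) (hν : ∀ᵐ x ∂ν, 0 < x) :
    ∫⁻ z, ENNReal.ofReal (z.2 / (2 + 2 * (z.1.1 + z.1.2))) ∂(seriesCoupling μ ν) ≤ 1 := by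
  refine lintegral_seriesCoupling_le hμ hν (by fun_prop) fun a b ha hb => ?_
  have hs : 0 < 2 + 2 * (a + b) := by positivity
  have h1 (h : ℝ) : ENNReal.ofReal (h / (2 + 2 * (a + b))) * rigDensity (a + b) h
      = ENNReal.ofReal (2 + 2 * (a + b))⁻¹ * (ENNReal.ofReal h * rigDensity (a + b) h) := by
    rw [div_eq_inv_mul, ENNReal.ofReal_mul (by positivity), mul_assoc]
  simp only [h1]
  have hm : Measurable fun h : ℝ => ENNReal.ofReal h * rigDensity (a + b) h :=
    ENNReal.measurable_ofReal.mul (measurable_rigDensity _)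
  rw [lintegral_const_mul _ hm]
  refine (mul_le_mul_right (lintegral_mul_rigDensity_le (add_pos ha hb)) _).trans ?_
  rw [← ENNReal.ofReal_mul (by positivity), inv_mul_cancel₀ hs.ne', ENNReal.ofReal_one]

end Coupling

section Moment

variable {μ : Measure ℝ} [IsProbabilityMeasure μ]

/-- `∫ x ^ α` decreases by the factor `2 ^ (-α)`: for given `a, b` the mean of `a b / h` is
`a b / (a + b)`, which is at most half the geometric mean of `a` and `b`. -/
lemma lintegral_rpow_seriesLaw_le (hμ : ∀ᵐ x ∂μ, 0 < x) {α : ℝ} (hα : α ∈ Set.Icc (0 : ℝ) 1) :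
    ∫⁻ x, ENNReal.ofReal (x ^ α) ∂(seriesLaw μ μ)
      ≤ ENNReal.ofReal ((2 : ℝ) ^ (-α)) * ∫⁻ x, ENNReal.ofReal (x ^ α) ∂μ := by
  obtain ⟨hα0, hα1⟩ := hα
  have hm : Measurable fun x : ℝ => ENNReal.ofReal (x ^ α) := by fun_prop
  rw [lintegral_seriesLaw_eq_lintegral_seriesCoupling _ _ hm,
    lintegral_seriesCoupling _ _ (by fun_prop)]
  set k := ENNReal.ofReal ((2 : ℝ) ^ (-α) / 2) with hk
  have key (a b : ℝ) (ha : 0 < a) (hb : 0 < b) :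
      ∫⁻ h, ENNReal.ofReal ((a * b / h) ^ α) * rigDensity (a + b) h
        ≤ k * (ENNReal.ofReal (a ^ α) + ENNReal.ofReal (b ^ α)) := by
    have hη : 0 < a + b := add_pos ha hb
    set c := a * b / (a + b) with hc
    have hc0 : 0 < c := by positivity
    have hm1 : Measurable fun h : ℝ => ENNReal.ofReal ((a + b) / h) * rigDensity (a + b) h :=
      (Measurable.ennreal_ofReal (by fun_prop)).mul (measurable_rigDensity _)
    have hpt (h : ℝ) : ENNReal.ofReal ((a * b / h) ^ α) * rigDensity (a + b) h
        ≤ ENNReal.ofReal (c ^ α) * (ENNReal.ofReal (1 - α) * rigDensity (a + b) h +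
          ENNReal.ofReal α * (ENNReal.ofReal ((a + b) / h) * rigDensity (a + b) h)) := by
      rcases le_or_gt h 0 with hh | hh
      · simp [rigDensity_of_nonpos _ hh]
      rw [← mul_assoc (ENNReal.ofReal α), ← add_mul, ← mul_assoc]
      gcongr
      rw [← ENNReal.ofReal_mul hα0, ← ENNReal.ofReal_add (by linarith) (by positivity),
        ← ENNReal.ofReal_mul (by positivity)]
      refine ENNReal.ofReal_le_ofReal ?_
      have h1 : a * b / h = c * ((a + b) / h) := by
        rw [hc]
        field_simp
      have h2 := rpow_one_add_le_one_add_mul_self (s := (a + b) / h - 1)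
        (by have : 0 < (a + b) / h := by positivity
            linarith) hα0 hα1
      rw [h1, Real.mul_rpow hc0.le (by positivity)]
      refine mul_le_mul_of_nonneg_left ?_ (by positivity)
      rw [add_sub_cancel] at h2
      linarith
    have hck : c ^ α ≤ (2 : ℝ) ^ (-α) / 2 * (a ^ α + b ^ α) := by
      have h1 : c ≤ 2⁻¹ * (√a * √b) := by
        rw [hc, div_le_iff₀ hη]
        have := Real.mul_self_sqrt ha.le
        have := Real.mul_self_sqrt hb.le
        have h5 : 0 < √a * √b := by positivity
        nlinarith [mul_nonneg h5.le (sq_nonneg (√a - √b))]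
      have h2 : c ^ α ≤ (2 : ℝ) ^ (-α) * (√a ^ α * √b ^ α) := by
        rw [Real.rpow_neg two_pos.le, ← Real.inv_rpow two_pos.le,
          ← Real.mul_rpow (by positivity) (by positivity),
          ← Real.mul_rpow (by positivity) (by positivity)]
        exact Real.rpow_le_rpow hc0.le h1 hα0
      have h3 (t : ℝ) (ht : 0 < t) : t ^ α = (√t ^ α) ^ 2 := by
        rw [sq, ← Real.mul_rpow (by positivity) (by positivity), Real.mul_self_sqrt ht.le]
      rw [h3 a ha, h3 b hb]
      have h4 : 0 < (2 : ℝ) ^ (-α) := by positivity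
      nlinarith [mul_nonneg h4.le (sq_nonneg (√a ^ α - √b ^ α))]
    calc ∫⁻ h, ENNReal.ofReal ((a * b / h) ^ α) * rigDensity (a + b) h
        ≤ ∫⁻ h, ENNReal.ofReal (c ^ α) * (ENNReal.ofReal (1 - α) * rigDensity (a + b) h +
          ENNReal.ofReal α * (ENNReal.ofReal ((a + b) / h) * rigDensity (a + b) h)) :=
          lintegral_mono hpt
      _ = ENNReal.ofReal (c ^ α) * (ENNReal.ofReal (1 - α) + ENNReal.ofReal α) := by
          rw [lintegral_const_mul' _ _ ENNReal.ofReal_ne_top,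
            lintegral_add_left ((measurable_rigDensity _).const_mul _),
            lintegral_const_mul _ (measurable_rigDensity _), lintegral_const_mul _ hm1,
            lintegral_rigDensity hη, lintegral_div_mul_rigDensity hη, mul_one, mul_one]
      _ = ENNReal.ofReal (c ^ α) := by
          rw [← ENNReal.ofReal_add (by linarith) hα0, sub_add_cancel, ENNReal.ofReal_one, mul_one]
      _ ≤ ENNReal.ofReal ((2 : ℝ) ^ (-α) / 2 * (a ^ α + b ^ α)) := ENNReal.ofReal_le_ofReal hck
      _ = _ := by
          rw [ENNReal.ofReal_mul (by positivity), ENNReal.ofReal_add (by positivity)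
            (by positivity)]
  refine (lintegral_lintegral_mono_of_pos hμ hμ key).trans ?_
  have h1 (a : ℝ) : ∫⁻ b, k * (ENNReal.ofReal (a ^ α) + ENNReal.ofReal (b ^ α)) ∂μ
      = k * (ENNReal.ofReal (a ^ α) + ∫⁻ x, ENNReal.ofReal (x ^ α) ∂μ) := by
    rw [lintegral_const_mul _ (by fun_prop), lintegral_add_left measurable_const]
    simp
  simp only [h1]
  rw [lintegral_const_mul _ (by fun_prop), lintegral_add_left hm, lintegral_const, measure_univ,
    mul_one, ← two_mul, ← mul_assoc, hk, mul_comm _ (2 : ℝ≥0∞),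
    ← ENNReal.ofReal_ofNat 2, ← ENNReal.ofReal_mul two_pos.le, mul_div_cancel₀ _ two_ne_zero]

/-- `∫ x ^ α` is at most `C_α` times its square: `h` dominates the value for `η = 0`. -/
lemma lintegral_rpow_seriesLaw_le_sq (hμ : ∀ᵐ x ∂μ, 0 < x) {α : ℝ}
    (hα : α ∈ Set.Ico (0 : ℝ) (1 / 2)) :
    ∫⁻ x, ENNReal.ofReal (x ^ α) ∂(seriesLaw μ μ)
      ≤ ENNReal.ofReal (cAlpha α) * (∫⁻ x, ENNReal.ofReal (x ^ α) ∂μ) ^ 2 := by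
  have hm : Measurable fun x : ℝ => ENNReal.ofReal (x ^ α) := by fun_prop
  rw [lintegral_seriesLaw_eq_lintegral_seriesCoupling _ _ hm,
    lintegral_seriesCoupling _ _ (by fun_prop)]
  have key (a b : ℝ) (ha : 0 < a) (hb : 0 < b) :
      ∫⁻ h, ENNReal.ofReal ((a * b / h) ^ α) * rigDensity (a + b) h
        ≤ ENNReal.ofReal (a ^ α) * (ENNReal.ofReal (b ^ α) * ENNReal.ofReal (cAlpha α)) := by
    have hpt (h : ℝ) : ENNReal.ofReal ((a * b / h) ^ α) * rigDensity (a + b) h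
        = ENNReal.ofReal (a ^ α) * (ENNReal.ofReal (b ^ α) *
          (ENNReal.ofReal (h ^ (-α)) * rigDensity (a + b) h)) := by
      rcases le_or_gt h 0 with hh | hh
      · simp [rigDensity_of_nonpos _ hh]
      rw [Real.div_rpow (by positivity) hh.le, Real.mul_rpow ha.le hb.le, div_eq_mul_inv,
        ← Real.rpow_neg hh.le, ENNReal.ofReal_mul (by positivity),
        ENNReal.ofReal_mul (by positivity)]
      ring
    have hm1 : Measurable fun h : ℝ => ENNReal.ofReal (h ^ (-α)) * rigDensity (a + b) h :=
      (Measurable.ennreal_ofReal (by fun_prop)).mul (measurable_rigDensity _)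
    simp only [hpt]
    rw [lintegral_const_mul _ (hm1.const_mul _), lintegral_const_mul _ hm1]
    gcongr
    exact lintegral_rpow_neg_mul_rigDensity_le hα.1 hα.2 (add_pos ha hb)
  refine (lintegral_lintegral_mono_of_pos hμ hμ key).trans_eq ?_
  have h1 (a : ℝ) : ∫⁻ b, ENNReal.ofReal (a ^ α) * (ENNReal.ofReal (b ^ α) *
      ENNReal.ofReal (cAlpha α)) ∂μ = ENNReal.ofReal (a ^ α) *
      ((∫⁻ x, ENNReal.ofReal (x ^ α) ∂μ) * ENNReal.ofReal (cAlpha α)) := by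
    rw [lintegral_const_mul _ (by fun_prop), lintegral_mul_const _ hm]
  simp only [h1]
  rw [lintegral_mul_const _ hm]
  ring

end Moment

end VRJP

namespace VRJP

open Real

/-! ### Logarithmic moments of a series reduction -/

section LogMoment

/-- An inequality between real numbers, rearranged such that only sums of non-negative numbers
occur. -/
lemma ofReal_add_le_of_add_le {x y₁ y₂ s c d : ℝ} (hs : 0 ≤ s) (hc : 0 ≤ c) (hd : 0 ≤ d)
    (h : x + c ≤ s * (y₁ + y₂) + d) :
    ENNReal.ofReal x + ENNReal.ofReal s * (ENNReal.ofReal (-y₁) + ENNReal.ofReal (-y₂))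
        + ENNReal.ofReal c
      ≤ ENNReal.ofReal (-x) + ENNReal.ofReal s * (ENNReal.ofReal y₁ + ENNReal.ofReal y₂)
        + ENNReal.ofReal d := by
  have hp (t : ℝ) : ENNReal.ofReal t = ENNReal.ofReal (max t 0) := by
    rcases le_total t 0 with ht | ht
    · rw [max_eq_right ht, ENNReal.ofReal_of_nonpos ht, ENNReal.ofReal_zero]
    · rw [max_eq_left ht]
  have hn (t : ℝ) : t = max t 0 - max (-t) 0 := by
    rcases le_total t 0 with ht | ht
    · rw [max_eq_right ht, max_eq_left (by linarith)]
      ring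
    · rw [max_eq_left ht, max_eq_right (by linarith)]
      ring
  have h0 (t : ℝ) : 0 ≤ max t 0 := le_max_right _ _
  have h1 := h0 x
  have h2 := h0 (-x)
  have h3 := h0 y₁
  have h4 := h0 (-y₁)
  have h5 := h0 y₂
  have h6 := h0 (-y₂)
  rw [hp x, hp (-x), hp y₁, hp (-y₁), hp y₂, hp (-y₂), ← ENNReal.ofReal_add h4 h6,
    ← ENNReal.ofReal_add h3 h5, ← ENNReal.ofReal_mul hs, ← ENNReal.ofReal_mul hs,
    ← ENNReal.ofReal_add h1 (by positivity), ← ENNReal.ofReal_add h2 (by positivity),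
    ← ENNReal.ofReal_add (by positivity) hc, ← ENNReal.ofReal_add (by positivity) hd]
  refine ENNReal.ofReal_le_ofReal ?_
  have e : s * (y₁ + y₂) = s * (max y₁ 0 + max y₂ 0) - s * (max (-y₁) 0 + max (-y₂) 0) := by
    conv_lhs => rw [hn y₁, hn y₂]
    ring
  have := hn x
  linarith

variable {μ : Measure ℝ} [IsProbabilityMeasure μ]

/-- The integrated form of `ofReal_add_le_of_add_le`, for the logarithms of `a b / h`, `a` and
`b`. -/
lemma lintegral_log_seriesLaw_add_le (hμ : ∀ᵐ x ∂μ, 0 < x) {s c : ℝ} (hs : 0 ≤ s) (hc : 0 ≤ c)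
    {d : (ℝ × ℝ) × ℝ → ℝ} (hd : Measurable d) {D : ℝ≥0∞}
    (hD : ∫⁻ z, ENNReal.ofReal (d z) ∂(seriesCoupling μ μ) ≤ D)
    (h : ∀ a b h : ℝ, 0 < a → 0 < b → 0 < h → 0 ≤ d ((a, b), h) ∧
      log (a * b / h) + c ≤ s * (log a + log b) + d ((a, b), h)) :
    (∫⁻ x, ENNReal.ofReal (log x) ∂(seriesLaw μ μ))
        + ENNReal.ofReal (2 * s) * (∫⁻ x, ENNReal.ofReal (-log x) ∂μ) + ENNReal.ofReal c
      ≤ (∫⁻ x, ENNReal.ofReal (-log x) ∂(seriesLaw μ μ))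
        + ENNReal.ofReal (2 * s) * (∫⁻ x, ENNReal.ofReal (log x) ∂μ) + D := by
  have hQ := isProbabilityMeasure_seriesCoupling hμ hμ
  have hm : Measurable fun x : ℝ => ENNReal.ofReal (log x) := by fun_prop
  have hm' : Measurable fun x : ℝ => ENNReal.ofReal (-log x) := by fun_prop
  have hpt : ∀ᵐ z ∂(seriesCoupling μ μ),
      ENNReal.ofReal (log (z.1.1 * z.1.2 / z.2))
        + ENNReal.ofReal s * (ENNReal.ofReal (-log z.1.1) + ENNReal.ofReal (-log z.1.2))
        + ENNReal.ofReal c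
      ≤ ENNReal.ofReal (-log (z.1.1 * z.1.2 / z.2))
        + ENNReal.ofReal s * (ENNReal.ofReal (log z.1.1) + ENNReal.ofReal (log z.1.2))
        + ENNReal.ofReal (d z) := by
    filter_upwards [ae_seriesCoupling_pos hμ hμ] with z hz
    obtain ⟨h1, h2⟩ := h z.1.1 z.1.2 z.2 hz.1 hz.2.1 hz.2.2
    exact ofReal_add_le_of_add_le hs hc h1 h2
  have key := lintegral_mono_ae hpt
  have hs2 : ENNReal.ofReal (2 * s) = ENNReal.ofReal s + ENNReal.ofReal s := by
    rw [two_mul, ENNReal.ofReal_add hs hs]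
  rw [lintegral_add_right _ measurable_const, lintegral_add_right _ (by fun_prop),
    lintegral_const_mul _ (by fun_prop), lintegral_add_right _ (by fun_prop),
    lintegral_add_right _ (by fun_prop), lintegral_add_right _ (by fun_prop),
    lintegral_const_mul _ (by fun_prop), lintegral_add_right _ (by fun_prop),
    lintegral_seriesCoupling_left hμ hμ hm, lintegral_seriesCoupling_right hμ hμ hm,
    lintegral_seriesCoupling_left hμ hμ hm', lintegral_seriesCoupling_right hμ hμ hm',
    lintegral_const, measure_univ, mul_one] at key
  rw [lintegral_seriesLaw_eq_lintegral_seriesCoupling _ _ hm,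
    lintegral_seriesLaw_eq_lintegral_seriesCoupling _ _ hm', hs2, add_mul, add_mul, ← mul_add,
    ← mul_add]
  exact key.trans (by gcongr)

/-- The concavity of the logarithm and `a b / (a + b) ≤ √(a b) / 2`, in terms of positive and
negative parts. -/
lemma lintegral_log_seriesLaw_le (hμ : ∀ᵐ x ∂μ, 0 < x) :
    (∫⁻ x, ENNReal.ofReal (log x) ∂(seriesLaw μ μ)) + (∫⁻ x, ENNReal.ofReal (-log x) ∂μ)
        + ENNReal.ofReal (log 2)
      ≤ (∫⁻ x, ENNReal.ofReal (-log x) ∂(seriesLaw μ μ))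
        + ∫⁻ x, ENNReal.ofReal (log x) ∂μ := by
  have h2 : 0 ≤ log 2 := log_nonneg one_le_two
  have key := lintegral_log_seriesLaw_add_le hμ (s := 1 / 2) (c := log 2 + 1) (by norm_num)
    (by linarith) (d := fun z => (z.1.1 + z.1.2) / z.2) (by fun_prop)
    (lintegral_seriesCoupling_div_le hμ hμ) fun a b h ha hb hh => by
      refine ⟨by positivity, ?_⟩
      have h3 : a * b / h = (a * b / (a + b)) * ((a + b) / h) := by field_simp
      have h4 : log (a * b / (a + b)) ≤ (log a + log b) / 2 - log 2 := by
        have h5 : a * b / (a + b) ≤ √(a * b) / 2 := by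
          rw [div_le_iff₀ (by positivity), sqrt_mul ha.le]
          have := mul_self_sqrt ha.le
          have := mul_self_sqrt hb.le
          have h5 : 0 < √a * √b := by positivity
          nlinarith [mul_nonneg h5.le (sq_nonneg (√a - √b))]
        refine (log_le_log (by positivity) h5).trans_eq ?_
        rw [log_div (by positivity) two_ne_zero, log_sqrt (by positivity),
          log_mul ha.ne' hb.ne']
      have h6 := log_le_sub_one_of_pos (show 0 < (a + b) / h by positivity)
      rw [h3, log_mul (by positivity) (by positivity)]
      dsimp only
      linarith
  rw [ENNReal.ofReal_add h2 zero_le_one, ENNReal.ofReal_one, ← add_assoc] at key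
  norm_num at key
  exact key

/-- The comparison of `h` with its value for `η = 0`, whose logarithm has expectation `-c₂`, in terms
of positive and negative parts. -/
lemma lintegral_log_seriesLaw_le_two_mul (hμ : ∀ᵐ x ∂μ, 0 < x) :
    (∫⁻ x, ENNReal.ofReal (log x) ∂(seriesLaw μ μ)) + 2 * (∫⁻ x, ENNReal.ofReal (-log x) ∂μ)
      ≤ (∫⁻ x, ENNReal.ofReal (-log x) ∂(seriesLaw μ μ))
        + 2 * (∫⁻ x, ENNReal.ofReal (log x) ∂μ) + ENNReal.ofReal cTwo := by
  refine ENNReal.le_of_forall_pos_le_add fun ε hε _ => ?_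
  obtain ⟨α, hα0, hα1, hα⟩ := exists_log_cAlpha_div_le (NNReal.coe_pos.2 hε)
  have hC := cAlpha_pos hα1
  have hQ := isProbabilityMeasure_seriesCoupling hμ hμ
  have hc2 := cTwo_pos
  have hε' : (0 : ℝ) < ε := NNReal.coe_pos.2 hε
  have hD : ∫⁻ z, ENNReal.ofReal (z.2 ^ (-α) * (cAlpha α * α)⁻¹ + (cTwo + ε))
      ∂(seriesCoupling μ μ) ≤ ENNReal.ofReal (1 / α) + ENNReal.ofReal (cTwo + ε) := by
    calc ∫⁻ z, ENNReal.ofReal (z.2 ^ (-α) * (cAlpha α * α)⁻¹ + (cTwo + ε)) ∂(seriesCoupling μ μ)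
        ≤ ∫⁻ z, ENNReal.ofReal (z.2 ^ (-α)) * ENNReal.ofReal (cAlpha α * α)⁻¹
            + ENNReal.ofReal (cTwo + ε) ∂(seriesCoupling μ μ) := by
          refine lintegral_mono fun z => ENNReal.ofReal_add_le.trans ?_
          rw [ENNReal.ofReal_mul' (by positivity)]
      _ ≤ ENNReal.ofReal (cAlpha α) * ENNReal.ofReal (cAlpha α * α)⁻¹
            + ENNReal.ofReal (cTwo + ε) := by
          rw [lintegral_add_right _ measurable_const, lintegral_mul_const _ (by fun_prop),
            lintegral_const, measure_univ, mul_one]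
          gcongr
          exact lintegral_seriesCoupling_rpow_neg_le hμ hμ hα0.le hα1
      _ = _ := by
          rw [← ENNReal.ofReal_mul hC.le]
          congr 2
          field_simp
  have key := lintegral_log_seriesLaw_add_le hμ (s := 1) (c := 1 / α) zero_le_one
    (by positivity) (d := fun z => z.2 ^ (-α) * (cAlpha α * α)⁻¹ + (cTwo + ε)) (by fun_prop)
    hD fun a b h ha hb hh => by
      refine ⟨by positivity, ?_⟩
      have h1 := log_le_sub_one_of_pos (show 0 < h ^ (-α) / cAlpha α by positivity)
      rw [log_div (by positivity) hC.ne', log_rpow hh] at h1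
      rw [log_div (by positivity) hh.ne', log_mul ha.ne' hb.ne', one_mul]
      have h2 : -log h + 1 / α ≤ h ^ (-α) * (cAlpha α * α)⁻¹ + log (cAlpha α) / α := by
        have h3 : h ^ (-α) * (cAlpha α * α)⁻¹ + log (cAlpha α) / α - (-log h + 1 / α)
            = (h ^ (-α) / cAlpha α - 1 - (-α * log h - log (cAlpha α))) / α := by
          field_simp
          ring
        have h4 : 0 ≤ (h ^ (-α) / cAlpha α - 1 - (-α * log h - log (cAlpha α))) / α :=
          div_nonneg (by linarith) hα0.le
        linarith
      dsimp only
      linarith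
  rw [mul_one, ENNReal.ofReal_ofNat, add_comm (ENNReal.ofReal (1 / α)) (ENNReal.ofReal _),
    ← add_assoc, ENNReal.ofReal_add hc2.le hε'.le, ENNReal.ofReal_coe_nnreal] at key
  rw [← add_assoc] at key
  exact (ENNReal.add_le_add_iff_right ENNReal.ofReal_ne_top).1 key

lemma lintegral_log_seriesLaw_ne_top (hμ : ∀ᵐ x ∂μ, 0 < x)
    (h : ∫⁻ x, ENNReal.ofReal (log x) ∂μ ≠ ∞) :
    ∫⁻ x, ENNReal.ofReal (log x) ∂(seriesLaw μ μ) ≠ ∞ := by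
  have hm : Measurable fun x : ℝ => ENNReal.ofReal (log x) := by fun_prop
  have hle : ∫⁻ x, ENNReal.ofReal (log x) ∂(seriesLaw μ μ) ≤
      ∫⁻ z, ENNReal.ofReal (log z.1.1) + ENNReal.ofReal (log z.1.2)
        + ENNReal.ofReal 4 * ENNReal.ofReal (z.2 ^ (-(1 / 4) : ℝ)) ∂(seriesCoupling μ μ) := by
    rw [lintegral_seriesLaw_eq_lintegral_seriesCoupling _ _ hm]
    refine lintegral_mono_ae ?_
    filter_upwards [ae_seriesCoupling_pos hμ hμ] with z ⟨ha, hb, hh⟩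
    rw [log_div (by positivity) hh.ne', log_mul ha.ne' hb.ne', sub_eq_add_neg,
      ← ENNReal.ofReal_mul (by norm_num)]
    refine ENNReal.ofReal_add_le.trans (add_le_add ENNReal.ofReal_add_le
      (ENNReal.ofReal_le_ofReal ?_))
    -- `-log h ≤ 4 h ^ (-1/4)`, where any exponent in `(-1/2, 0)` would do
    have h1 := log_le_sub_one_of_pos (show 0 < z.2 ^ (-(1 / 4) : ℝ) by positivity)
    rw [log_rpow hh] at h1
    linarith
  refine ne_top_of_le_ne_top ?_ hle
  rw [lintegral_add_right _ (by fun_prop), lintegral_add_right _ (by fun_prop),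
    lintegral_const_mul _ (by fun_prop), lintegral_seriesCoupling_left hμ hμ hm,
    lintegral_seriesCoupling_right hμ hμ hm]
  refine ENNReal.add_ne_top.2 ⟨ENNReal.add_ne_top.2 ⟨h, h⟩, ENNReal.mul_ne_top
    ENNReal.ofReal_ne_top (ne_top_of_le_ne_top ENNReal.ofReal_ne_top
    (lintegral_seriesCoupling_rpow_neg_le hμ hμ (by norm_num) (by norm_num)))⟩

lemma lintegral_neg_log_seriesLaw_ne_top (hμ : ∀ᵐ x ∂μ, 0 < x)
    (h : ∫⁻ x, ENNReal.ofReal (-log x) ∂μ ≠ ∞) :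
    ∫⁻ x, ENNReal.ofReal (-log x) ∂(seriesLaw μ μ) ≠ ∞ := by
  have hm : Measurable fun x : ℝ => ENNReal.ofReal (-log x) := by fun_prop
  have hQ := isProbabilityMeasure_seriesCoupling hμ hμ
  have hle : ∫⁻ x, ENNReal.ofReal (-log x) ∂(seriesLaw μ μ) ≤
      ∫⁻ z, ENNReal.ofReal (-log z.1.1) + ENNReal.ofReal (-log z.1.2)
        + ENNReal.ofReal (z.2 / (2 + 2 * (z.1.1 + z.1.2))) + ENNReal.ofReal (3 * log 2)
        ∂(seriesCoupling μ μ) := by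
    rw [lintegral_seriesLaw_eq_lintegral_seriesCoupling _ _ hm]
    refine lintegral_mono_ae ?_
    filter_upwards [ae_seriesCoupling_pos hμ hμ] with z ⟨ha, hb, hh⟩
    -- `-log t` is replaced by its positive part
    have hlog (t : ℝ) (ht : 0 < t) : log (1 + 1 / t) ≤ log 2 + max (-log t) 0 := by
      rcases le_total t 1 with h1 | h1
      · have h2 : 1 + 1 / t ≤ 2 * t⁻¹ := by
          have := one_le_one_div ht h1
          rw [← one_div]
          linarith
        have h3 := log_le_log (by positivity) h2
        rw [log_mul two_ne_zero (by positivity), log_inv] at h3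
        exact h3.trans (by gcongr; exact le_max_left _ _)
      · have h2 : 1 + 1 / t ≤ 2 := by
          have := (div_le_one ht).2 h1
          linarith
        have h3 := log_le_log (by positivity) h2
        have := le_max_right (-log t) 0
        linarith
    have hp (t : ℝ) : ENNReal.ofReal t = ENNReal.ofReal (max t 0) := by
      rcases le_total t 0 with ht | ht
      · rw [max_eq_right ht, ENNReal.ofReal_of_nonpos ht, ENNReal.ofReal_zero]
      · rw [max_eq_left ht]
    have hma := le_max_right (-log z.1.1) 0
    have hmb := le_max_right (-log z.1.2) 0
    have hl2 := log_nonneg one_le_two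
    -- `s` bounds the conditional mean of `h`, so that `log h ≤ log s + h / s - 1` is integrable
    set s := 2 + 2 * (z.1.1 + z.1.2) with hs
    have hs0 : 0 < s := by positivity
    rw [hp (-log z.1.1), hp (-log z.1.2), ← ENNReal.ofReal_add hma hmb,
      ← ENNReal.ofReal_add (by positivity) (by positivity),
      ← ENNReal.ofReal_add (by positivity) (by positivity)]
    refine ENNReal.ofReal_le_ofReal ?_
    have h1 := log_le_sub_one_of_pos (show 0 < z.2 / s by positivity)
    have h2 : s / (z.1.1 * z.1.2) ≤ 2 * ((1 + 1 / z.1.1) * (1 + 1 / z.1.2)) := by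
      rw [div_le_iff₀ (by positivity), hs]
      have h3 : 2 * ((1 + 1 / z.1.1) * (1 + 1 / z.1.2)) * (z.1.1 * z.1.2)
          = 2 * ((z.1.1 + 1) * (z.1.2 + 1)) := by field_simp
      rw [h3]
      nlinarith [mul_pos ha hb]
    have h3 := log_le_log (by positivity) h2
    rw [log_mul two_ne_zero (by positivity), log_mul (by positivity) (by positivity)] at h3
    have h4 : -log (z.1.1 * z.1.2 / z.2) = log (z.2 / s) + log (s / (z.1.1 * z.1.2)) := by
      rw [← log_mul (by positivity) (by positivity), ← log_inv]
      congr 1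
      field_simp
    have h5 := hlog _ ha
    have h6 := hlog _ hb
    linarith
  refine ne_top_of_le_ne_top ?_ hle
  rw [lintegral_add_right _ (by fun_prop), lintegral_add_right _ (by fun_prop),
    lintegral_add_right _ (by fun_prop), lintegral_seriesCoupling_left hμ hμ hm,
    lintegral_seriesCoupling_right hμ hμ hm, lintegral_const, measure_univ, mul_one]
  exact ENNReal.add_ne_top.2 ⟨ENNReal.add_ne_top.2 ⟨ENNReal.add_ne_top.2 ⟨h, h⟩,
    ne_top_of_le_ne_top ENNReal.one_ne_top (lintegral_seriesCoupling_div_two_add_le hμ hμ)⟩,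
    ENNReal.ofReal_ne_top⟩

end LogMoment

end VRJP

namespace VRJP

/-! ### Iterated series reductions -/

section Iterate

lemma hasExpectation_map {Ω : Type*} [MeasurableSpace Ω] {P : Measure Ω} {T : Ω → ℝ}
    (hT : Measurable T) {f : ℝ → ℝ} (hf : Measurable f) :
    HasExpectation (P.map T) f ↔ HasExpectation P fun ω => f (T ω) := by
  rw [HasExpectation, HasExpectation, lintegral_map (by fun_prop) hT,
    lintegral_map (by fun_prop) hT]

lemma expectation_map {Ω : Type*} [MeasurableSpace Ω] {P : Measure Ω} {T : Ω → ℝ}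
    (hT : Measurable T) {f : ℝ → ℝ} (hf : Measurable f) :
    expectation (P.map T) f = expectation P fun ω => f (T ω) := by
  rw [expectation, expectation, lintegral_map (by fun_prop) hT, lintegral_map (by fun_prop) hT]

lemma integrable_iff_lintegral_ofReal_ne_top {Ω : Type*} [MeasurableSpace Ω] {P : Measure Ω}
    {f : Ω → ℝ} (hf : Measurable f) : Integrable f P ↔
      ∫⁻ ω, ENNReal.ofReal (f ω) ∂P ≠ ∞ ∧ ∫⁻ ω, ENNReal.ofReal (-f ω) ∂P ≠ ∞ := by
  have h1 : ∫⁻ ω, ‖f ω‖ₑ ∂P = ∫⁻ ω, ENNReal.ofReal (f ω) ∂P + ∫⁻ ω, ENNReal.ofReal (-f ω) ∂P := by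
    rw [← lintegral_add_left (by fun_prop)]
    refine lintegral_congr fun ω => ?_
    rw [← ofReal_norm, Real.norm_eq_abs]
    rcases le_total (f ω) 0 with h | h
    · rw [abs_of_nonpos h, ENNReal.ofReal_of_nonpos h, zero_add]
    · rw [abs_of_nonneg h, ENNReal.ofReal_of_nonpos (neg_nonpos.2 h), add_zero]
  rw [← ENNReal.add_ne_top, ← h1]
  exact ⟨fun h => h.2.ne, fun h => ⟨hf.aestronglyMeasurable, h.lt_top⟩⟩

lemma expectation_eq_integral {Ω : Type*} [MeasurableSpace Ω] {P : Measure Ω} {f : Ω → ℝ}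
    (hf : Measurable f) (hi : Integrable f P) : expectation P f = ((∫ ω, f ω ∂P : ℝ) : EReal) := by
  obtain ⟨h1, h2⟩ := (integrable_iff_lintegral_ofReal_ne_top hf).1 hi
  rw [integral_eq_lintegral_pos_part_sub_lintegral_neg_part hi, expectation, EReal.coe_sub,
    EReal.coe_ennreal_toReal h1, EReal.coe_ennreal_toReal h2]

variable {μ : Measure ℝ} [IsProbabilityMeasure μ]

lemma hasExpectation_log_seriesLaw (hμ : ∀ᵐ x ∂μ, 0 < x) (h : HasExpectation μ Real.log) :
    HasExpectation (seriesLaw μ μ) Real.log :=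
  h.imp (lintegral_log_seriesLaw_ne_top hμ) (lintegral_neg_log_seriesLaw_ne_top hμ)

lemma ereal_sub_le_of_add_le {u v u' v' : ℝ≥0∞} {k : ℕ} {s t : ℝ} (hs : 0 ≤ s) (ht : 0 ≤ t)
    (hu : u ≠ ∞) (hu' : u' ≠ ∞) (hv : v' ≠ ∞ → v ≠ ∞)
    (h : u' + k * v + ENNReal.ofReal s ≤ v' + k * u + ENNReal.ofReal t) :
    (u' : EReal) - v' ≤ (((k : ℝ) : EReal)) * ((u : EReal) - v) + ((t - s : ℝ) : EReal) := by
  by_cases hv' : v' = ∞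
  · rw [hv']
    lift u' to NNReal using hu'
    simp
  lift v to NNReal using hv hv'
  lift v' to NNReal using hv'
  lift u' to NNReal using hu'
  lift u to NNReal using hu
  have h1 := ENNReal.toReal_mono (by finiteness) h
  rw [ENNReal.toReal_add (by finiteness) (by finiteness),
    ENNReal.toReal_add (by finiteness) (by finiteness),
    ENNReal.toReal_add (by finiteness) (by finiteness),
    ENNReal.toReal_add (by finiteness) (by finiteness),
    ENNReal.toReal_mul, ENNReal.toReal_mul, ENNReal.toReal_ofReal hs, ENNReal.toReal_ofReal ht] at h1
  simp only [ENNReal.coe_toReal, ENNReal.toReal_natCast] at h1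
  have h2 : (u' : ℝ) - v' ≤ k * ((u : ℝ) - v) + (t - s) := by linarith
  simp only [EReal.coe_nnreal_eq_coe_real]
  exact_mod_cast h2

/-- The two bounds for the logarithmic moment of a series reduction. -/
lemma expectation_log_seriesLaw_le (hμ : ∀ᵐ x ∂μ, 0 < x) (h : HasExpectation μ Real.log) :
    expectation (seriesLaw μ μ) Real.log
        ≤ expectation μ Real.log + ((-Real.log 2 : ℝ) : EReal) ∧
      expectation (seriesLaw μ μ) Real.log
        ≤ ((2 : ℝ) : EReal) * expectation μ Real.log + ((cTwo : ℝ) : EReal) := by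
  have hl2 : 0 ≤ Real.log 2 := Real.log_nonneg one_le_two
  have h1 := lintegral_log_seriesLaw_le hμ
  have h2 := lintegral_log_seriesLaw_le_two_mul hμ
  have h3 := lintegral_log_seriesLaw_ne_top hμ
  unfold expectation
  set u := ∫⁻ x, ENNReal.ofReal (Real.log x) ∂μ with hu
  set v := ∫⁻ x, ENNReal.ofReal (-Real.log x) ∂μ with hv
  set u' := ∫⁻ x, ENNReal.ofReal (Real.log x) ∂(seriesLaw μ μ) with hu'
  set v' := ∫⁻ x, ENNReal.ofReal (-Real.log x) ∂(seriesLaw μ μ) with hv'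
  by_cases htop : u = ∞
  · have hvt : v ≠ ∞ := h.resolve_left fun h' => h' htop
    have hE : ((∞ : ℝ≥0∞) : EReal) - (v : EReal) = ⊤ := by
      rw [← EReal.coe_ennreal_toReal hvt]
      simp
    rw [htop, hE, EReal.coe_mul_top_of_pos two_pos]
    simp
  have hvv : v' ≠ ∞ → v ≠ ∞ := fun hv'' => by
    refine ne_top_of_le_ne_top (ENNReal.add_ne_top.2 ⟨hv'', htop⟩) (le_trans ?_ h1)
    exact (le_add_self).trans le_self_add
  constructor
  · have := ereal_sub_le_of_add_le (k := 1) (t := 0) hl2 le_rfl htop (h3 htop) hvv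
      (by simpa using h1)
    simpa using this
  · have := ereal_sub_le_of_add_le (k := 2) (s := 0) le_rfl cTwo_pos.le htop (h3 htop) hvv
      (by simpa using h2)
    simpa using this

lemma iteratedSeriesLaw_pos (hμ : ∀ᵐ x ∂μ, 0 < x) (k : ℕ) :
    IsProbabilityMeasure (iteratedSeriesLaw μ k) ∧ ∀ᵐ x ∂(iteratedSeriesLaw μ k), 0 < x := by
  induction k with
  | zero => exact ⟨by assumption, hμ⟩
  | succ k ih =>
    obtain ⟨h1, h2⟩ := ih
    exact ⟨isProbabilityMeasure_seriesLaw h2 h2, ae_seriesLaw_pos h2 h2⟩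

lemma lintegral_rpow_iteratedSeriesLaw_le (hμ : ∀ᵐ x ∂μ, 0 < x) {α : ℝ}
    (hα : α ∈ Set.Icc (0 : ℝ) 1) (k : ℕ) :
    ∫⁻ x, ENNReal.ofReal (x ^ α) ∂(iteratedSeriesLaw μ k)
      ≤ ENNReal.ofReal ((2 : ℝ) ^ (-α)) ^ k * ∫⁻ x, ENNReal.ofReal (x ^ α) ∂μ := by
  induction k with
  | zero => simp [iteratedSeriesLaw]
  | succ k ih =>
    obtain ⟨h1, h2⟩ := iteratedSeriesLaw_pos hμ k
    refine (lintegral_rpow_seriesLaw_le h2 hα).trans ?_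
    rw [pow_succ', mul_assoc]
    gcongr

/-- The bound `momentTerm`: first `k` steps with the factor `2 ^ (-α)`, then `j` squarings. -/
lemma cAlpha_mul_lintegral_rpow_iteratedSeriesLaw_le (hμ : ∀ᵐ x ∂μ, 0 < x) {α : ℝ}
    (hα : α ∈ Set.Ico (0 : ℝ) (1 / 2)) (k j : ℕ) :
    ENNReal.ofReal (cAlpha α) * ∫⁻ x, ENNReal.ofReal (x ^ α) ∂(iteratedSeriesLaw μ (k + j))
      ≤ (ENNReal.ofReal (cAlpha α) * ENNReal.ofReal ((2 : ℝ) ^ (-α)) ^ k *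
          ∫⁻ x, ENNReal.ofReal (x ^ α) ∂μ) ^ 2 ^ j := by
  induction j with
  | zero =>
    rw [pow_zero, pow_one, mul_assoc, add_zero]
    gcongr
    exact lintegral_rpow_iteratedSeriesLaw_le hμ ⟨hα.1, by linarith [hα.2]⟩ k
  | succ j ih =>
    obtain ⟨h1, h2⟩ := iteratedSeriesLaw_pos hμ (k + j)
    calc ENNReal.ofReal (cAlpha α) *
          ∫⁻ x, ENNReal.ofReal (x ^ α) ∂(iteratedSeriesLaw μ (k + (j + 1)))
        ≤ ENNReal.ofReal (cAlpha α) * (ENNReal.ofReal (cAlpha α) *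
            (∫⁻ x, ENNReal.ofReal (x ^ α) ∂(iteratedSeriesLaw μ (k + j))) ^ 2) := by
          gcongr
          exact lintegral_rpow_seriesLaw_le_sq h2 hα
      _ = (ENNReal.ofReal (cAlpha α) *
            ∫⁻ x, ENNReal.ofReal (x ^ α) ∂(iteratedSeriesLaw μ (k + j))) ^ 2 := by ring
      _ ≤ _ := by
          rw [pow_succ 2 j, pow_mul]
          gcongr

lemma hasExpectation_log_iteratedSeriesLaw (hμ : ∀ᵐ x ∂μ, 0 < x) (h : HasExpectation μ Real.log)
    (k : ℕ) : HasExpectation (iteratedSeriesLaw μ k) Real.log := by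
  induction k with
  | zero => exact h
  | succ k ih =>
    obtain ⟨h1, h2⟩ := iteratedSeriesLaw_pos hμ k
    exact hasExpectation_log_seriesLaw h2 ih

lemma integrable_log_iteratedSeriesLaw (hμ : ∀ᵐ x ∂μ, 0 < x) (h : Integrable Real.log μ)
    (k : ℕ) : Integrable Real.log (iteratedSeriesLaw μ k) := by
  induction k with
  | zero => exact h
  | succ k ih =>
    obtain ⟨h1, h2⟩ := iteratedSeriesLaw_pos hμ k
    rw [integrable_iff_lintegral_ofReal_ne_top Real.measurable_log] at ih ⊢
    exact ⟨lintegral_log_seriesLaw_ne_top h2 ih.1, lintegral_neg_log_seriesLaw_ne_top h2 ih.2⟩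

lemma logTerm_coe (x : ℝ) (l r m : ℕ) : logTerm (x : EReal) l r m =
    ((2 ^ (m - l) * (x - ((r - m : ℕ) : ℝ) * Real.log 2 + cTwo) - cTwo : ℝ) : EReal) := by
  simp only [logTerm, EReal.coe_sub, EReal.coe_mul, EReal.coe_add]

/-- The bound `logTerm`: first `r - m` steps which decrease the expectation by `log 2`, then `m - l`
steps which double it, up to the constant `c₂`. -/
lemma expectation_log_iteratedSeriesLaw_le (hμ : ∀ᵐ x ∂μ, 0 < x) (h : HasExpectation μ Real.log)
    {l r m : ℕ} (hlm : l ≤ m) (hmr : m ≤ r) :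
    expectation (iteratedSeriesLaw μ (r - l)) Real.log
      ≤ logTerm (expectation μ Real.log) l r m := by
  have step (k : ℕ) : expectation (iteratedSeriesLaw μ (k + 1)) Real.log
        ≤ expectation (iteratedSeriesLaw μ k) Real.log + ((-Real.log 2 : ℝ) : EReal) ∧
      expectation (iteratedSeriesLaw μ (k + 1)) Real.log
        ≤ ((2 : ℝ) : EReal) * expectation (iteratedSeriesLaw μ k) Real.log
          + ((cTwo : ℝ) : EReal) := by
    obtain ⟨h1, h2⟩ := iteratedSeriesLaw_pos hμ k
    exact expectation_log_seriesLaw_le h2 (hasExpectation_log_iteratedSeriesLaw hμ h k)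
  generalize hL : expectation μ Real.log = L
  induction L with
  | bot =>
    have hbot (k : ℕ) : expectation (iteratedSeriesLaw μ k) Real.log = ⊥ := by
      induction k with
      | zero => exact hL
      | succ k ih => simpa [ih] using (step k).1
    rw [hbot]
    exact bot_le
  | top =>
    have h2 : (0 : ℝ) < 2 ^ (m - l) := by positivity
    rw [logTerm, EReal.top_sub_coe, EReal.top_add_coe, EReal.coe_mul_top_of_pos h2,
      EReal.top_sub_coe]
    exact le_top
  | coe x =>
    have h1 (k : ℕ) : expectation (iteratedSeriesLaw μ k) Real.log
        ≤ ((x - k * Real.log 2 : ℝ) : EReal) := by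
      induction k with
      | zero => simp [iteratedSeriesLaw, hL]
      | succ k ih =>
        refine ((step k).1.trans (add_le_add_left ih _)).trans_eq ?_
        rw [← EReal.coe_add]
        congr 1
        push_cast
        ring
    have h2 (k j : ℕ) : expectation (iteratedSeriesLaw μ (k + j)) Real.log
        ≤ ((2 ^ j * (x - k * Real.log 2 + cTwo) - cTwo : ℝ) : EReal) := by
      induction j with
      | zero => simpa using h1 k
      | succ j ih =>
        refine ((step (k + j)).2.trans (add_le_add_left
          (mul_le_mul_of_nonneg_left ih (by norm_num)) _)).trans_eq ?_
        rw [← EReal.coe_mul, ← EReal.coe_add]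
        congr 1
        ring
    rw [logTerm_coe]
    have h3 := h2 (r - m) (m - l)
    rwa [show r - m + (m - l) = r - l by omega] at h3

end Iterate

end VRJP

namespace VRJP

/-! ### The minimizers -/

section Minimizer

/-- A function which decreases before `m₀` and increases after `m₀` is minimized at `m₀`. -/
lemma minimizedAt_of_step {γ : Type*} [Preorder γ] {f : ℕ → γ} {l r : ℕ} {m₀ : ℤ}
    (hdec : ∀ m, l ≤ m → m < r → (m : ℤ) < m₀ → f (m + 1) ≤ f m)
    (hinc : ∀ m, l ≤ m → m < r → m₀ ≤ m → f m ≤ f (m + 1)) : MinimizedAt f l r m₀ := by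
  have h1 (a b : ℕ) (hla : l ≤ a) (hab : a ≤ b) (hbr : b ≤ r) (hb : (b : ℤ) ≤ m₀) : f b ≤ f a := by
    induction b, hab using Nat.le_induction with
    | base => exact le_rfl
    | succ b hab ih =>
      exact (hdec b (by omega) (by omega) (by omega)).trans (ih (by omega) (by omega))
  have h2 (a b : ℕ) (hla : l ≤ a) (hab : a ≤ b) (hbr : b ≤ r) (ha : m₀ ≤ a) : f a ≤ f b := by
    induction b, hab using Nat.le_induction with
    | base => exact le_rfl
    | succ b hab ih =>
      exact (ih (by omega)).trans (hinc b (by omega) (by omega) (by omega))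
  refine ⟨fun m hm h => isMinOn_iff.2 fun n hn => ?_, fun h => isMinOn_iff.2 fun n hn => ?_,
    fun h => isMinOn_iff.2 fun n hn => ?_⟩
  · rcases le_total m n with hmn | hnm
    · exact h2 m n hm.1 hmn hn.2 h.ge
    · exact h1 n m hn.1 hnm hm.2 h.le
  · exact h2 l n le_rfl hn.1 hn.2 h.le
  · exact h1 n r hn.1 hn.2 le_rfl h.le

/-- The common form of both bounds. Passing from `m` to `m + 1` changes `2 ^ (m - l) (A - (r - m) δ)`
by `2 ^ (m - l) (A - (r - m - 2) δ)`. -/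
lemma minimizedAt_comp_of_monotone {γ : Type*} [Preorder γ] {φ : ℝ → γ} (hφ : Monotone φ)
    (l r : ℕ) (A : ℝ) {δ : ℝ} (hδ : 0 < δ) :
    MinimizedAt (fun m => φ (2 ^ (m - l) * (A - ((r - m : ℕ) : ℝ) * δ))) l r
      ((r : ℤ) - 2 - ⌊A / δ⌋) := by
  have hstep (m : ℕ) (hlm : l ≤ m) (hmr : m < r) :
      (2 : ℝ) ^ (m + 1 - l) * (A - ((r - (m + 1) : ℕ) : ℝ) * δ)
        = 2 ^ (m - l) * (A - ((r - m : ℕ) : ℝ) * δ)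
          + 2 ^ (m - l) * (A - ((r : ℝ) - m - 2) * δ) := by
    rw [Nat.cast_sub hmr.le, Nat.cast_sub (by omega : m + 1 ≤ r),
      show m + 1 - l = (m - l) + 1 by omega, pow_succ]
    push_cast
    ring
  refine minimizedAt_of_step (fun m hlm hmr h => hφ ?_) fun m hlm hmr h => hφ ?_
  · have h1 : ⌊A / δ⌋ < (r : ℤ) - m - 2 := by omega
    have h2 : A / δ < (r : ℝ) - m - 2 := by exact_mod_cast Int.floor_lt.1 h1
    rw [div_lt_iff₀ hδ] at h2
    rw [hstep m hlm hmr]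
    have : (2 : ℝ) ^ (m - l) * (A - ((r : ℝ) - m - 2) * δ) ≤ 0 :=
      mul_nonpos_of_nonneg_of_nonpos (by positivity) (by linarith)
    linarith
  · have h1 : (r : ℤ) - m - 2 ≤ ⌊A / δ⌋ := by omega
    have h2 : (r : ℝ) - m - 2 ≤ A / δ := by exact_mod_cast Int.le_floor.1 h1
    rw [le_div_iff₀ hδ] at h2
    rw [hstep m hlm hmr]
    have : 0 ≤ (2 : ℝ) ^ (m - l) * (A - ((r : ℝ) - m - 2) * δ) :=
      mul_nonneg (by positivity) (by linarith)
    linarith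

lemma momentTerm_eq_ofReal_exp {α : ℝ} (hα : α < 1 / 2) {M : ℝ} (hM : 0 < M) (l r m : ℕ) :
    momentTerm α (ENNReal.ofReal M) l r m = ENNReal.ofReal (Real.exp
      (2 ^ (m - l) * (Real.log (cAlpha α * M) - ((r - m : ℕ) : ℝ) * (α * Real.log 2)))) := by
  have hC := cAlpha_pos hα
  rw [momentTerm, ← ENNReal.ofReal_pow (by positivity), ← ENNReal.ofReal_mul hC.le,
    ← ENNReal.ofReal_mul (by positivity), ← ENNReal.ofReal_pow (by positivity)]
  congr 1
  rw [show ((2 : ℝ) ^ (m - l)) = ((2 ^ (m - l) : ℕ) : ℝ) by push_cast; rfl, Real.exp_nat_mul,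
    Real.exp_sub, Real.exp_log (by positivity), Real.exp_nat_mul, Real.rpow_neg two_pos.le,
    Real.rpow_def_of_pos two_pos, mul_comm α, inv_pow]
  congr 1
  field_simp

lemma minimizedAt_momentTerm {α : ℝ} (hα : α ∈ Set.Ioo (0 : ℝ) (1 / 2)) {M : ℝ} (hM : 0 < M)
    (l r : ℕ) :
    MinimizedAt (momentTerm α (ENNReal.ofReal M) l r) l r
      ((r : ℤ) - 2 - ⌊α⁻¹ * Real.logb 2 (cAlpha α * M)⌋) := by
  have h1 := minimizedAt_comp_of_monotone
    (φ := fun t => ENNReal.ofReal (Real.exp t))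
    (fun s t hst => ENNReal.ofReal_le_ofReal (Real.exp_le_exp.2 hst)) l r
    (Real.log (cAlpha α * M)) (mul_pos hα.1 (Real.log_pos one_lt_two))
  have h2 : Real.log (cAlpha α * M) / (α * Real.log 2) = α⁻¹ * Real.logb 2 (cAlpha α * M) := by
    rw [Real.logb, mul_comm α, ← div_div, div_eq_inv_mul]
  rw [h2] at h1
  convert h1 using 1
  funext m
  exact momentTerm_eq_ofReal_exp hα.2 hM l r m

lemma minimizedAt_logTerm (x : ℝ) (l r : ℕ) :
    MinimizedAt (logTerm (x : EReal) l r) l r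
      ((r : ℤ) - 2 - ⌊(Real.log 2)⁻¹ * (x + cTwo)⌋) := by
  have h1 := minimizedAt_comp_of_monotone (φ := fun t => ((t - cTwo : ℝ) : EReal))
    (fun s t hst => EReal.coe_le_coe_iff.2 (by linarith)) l r (x + cTwo) (Real.log_pos one_lt_two)
  rw [div_eq_inv_mul] at h1
  convert h1 using 1
  funext m
  rw [logTerm_coe]
  congr 3
  ring

end Minimizer

end VRJP

end

theorem mainTheorem4
    {V : Type*} [Fintype V] [DecidableEq V] (G : SimpleGraph V) [DecidableRel G.Adj]
    (D : VRJP.EdgeDirection G) (l r : ℕ) (hlr : l ≤ r)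
    {Ω : Type*} [MeasurableSpace Ω] (P : Measure Ω) [IsProbabilityMeasure P]
    -- i.i.d. positive edge weights on `G_r`
    (W : VRJP.SubEdge G r → Ω → ℝ)
    (hW_meas : ∀ e, Measurable (W e))
    (hW_pos : ∀ e, ∀ᵐ ω ∂P, 0 < W e ω)
    (hW_indep : iIndepFun W P)
    (hW_ident : ∀ e f, IdentDistrib (W e) (W f) P P)
    -- the `β`-field: given the weights `W`, its conditional law is `ν^W` on `Λ_r`
    (β : Ω → VRJP.SubVertex G r → ℝ)
    (hβ_meas : Measurable β)
    (hβ_law : ∀ᵐ w ∂(P.map fun ω e => W e ω),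
      condDistrib β (fun ω e => W e ω) P w = VRJP.betaLaw (D.weightMatrix r w))
    -- the effective weights on `G_l`
    (Wl : VRJP.SubEdge G l → Ω → ℝ)
    (hWl : ∀ e ω, Wl e ω = D.effectiveEdgeWeight l r (fun f => W f ω) (β ω) e)
    (e₀ : VRJP.SubEdge G l) (e₁ : VRJP.SubEdge G r) :
    -- first bound for the moments
    (∀ α ∈ Set.Icc (0 : ℝ) 1,
      ∫⁻ ω, ENNReal.ofReal (Wl e₀ ω ^ α) ∂P
        ≤ ENNReal.ofReal ((2 : ℝ) ^ (-α)) ^ (r - l) * ∫⁻ ω, ENNReal.ofReal (W e₁ ω ^ α) ∂P) ∧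
    -- combined bound for the moments
    (∀ α ∈ Set.Ico (0 : ℝ) (1 / 2),
      ∫⁻ ω, ENNReal.ofReal (Wl e₀ ω ^ α) ∂P
        ≤ (ENNReal.ofReal (VRJP.cAlpha α))⁻¹ *
          (Finset.Icc l r).inf' (Finset.nonempty_Icc.2 hlr)
            (VRJP.momentTerm α (∫⁻ ω, ENNReal.ofReal (W e₁ ω ^ α) ∂P) l r)) ∧
    -- combined bound for the logarithmic moment
    (VRJP.HasExpectation P (fun ω => Real.log (W e₁ ω)) →
      VRJP.HasExpectation P (fun ω => Real.log (Wl e₀ ω)) ∧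
      VRJP.expectation P (fun ω => Real.log (Wl e₀ ω))
        ≤ (Finset.Icc l r).inf' (Finset.nonempty_Icc.2 hlr)
            (VRJP.logTerm (VRJP.expectation P (fun ω => Real.log (W e₁ ω))) l r)) ∧
    (Integrable (fun ω => Real.log (W e₁ ω)) P → Integrable (fun ω => Real.log (Wl e₀ ω)) P) ∧
    -- the minimizer `m₀`
    (∀ α ∈ Set.Ioo (0 : ℝ) (1 / 2), ∫⁻ ω, ENNReal.ofReal (W e₁ ω ^ α) ∂P ≠ ∞ →
      VRJP.MinimizedAt
        (VRJP.momentTerm α (∫⁻ ω, ENNReal.ofReal (W e₁ ω ^ α) ∂P) l r) l r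
        ((r : ℤ) - 2 - ⌊α⁻¹ * Real.logb 2 (VRJP.cAlpha α * ∫ ω, W e₁ ω ^ α ∂P)⌋)) ∧
    -- the minimizer `m₁`
    (Integrable (fun ω => Real.log (W e₁ ω)) P →
      VRJP.MinimizedAt
        (VRJP.logTerm (VRJP.expectation P (fun ω => Real.log (W e₁ ω))) l r) l r
        ((r : ℤ) - 2 - ⌊(Real.log 2)⁻¹ * (∫ ω, Real.log (W e₁ ω) ∂P + VRJP.cTwo)⌋)) := by
  obtain ⟨hTm, hTlaw⟩ := D.map_effectiveEdgeWeight hlr hW_meas hW_indep hW_ident hβ_meas hβ_law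
    e₀ e₁ (hWl e₀)
  have hWm := hW_meas e₁
  have hpos : ∀ᵐ x ∂(P.map (W e₁)), 0 < x :=
    (ae_map_iff hWm.aemeasurable measurableSet_Ioi).2 (hW_pos e₁)
  have hμ : IsProbabilityMeasure (P.map (W e₁)) :=
    Measure.isProbabilityMeasure_map hWm.aemeasurable
  have hm (α : ℝ) : Measurable fun x : ℝ => ENNReal.ofReal (x ^ α) := by fun_prop
  have hlog := Real.measurable_log
  refine ⟨fun α hα => ?_, fun α hα => ?_, fun h => ?_, fun h => ?_, fun α hα hfin => ?_,
    fun h => ?_⟩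
  · rw [← lintegral_map (hm α) hTm, ← lintegral_map (hm α) hWm, hTlaw]
    exact VRJP.lintegral_rpow_iteratedSeriesLaw_le hpos hα _
  · have hC : ENNReal.ofReal (VRJP.cAlpha α) ≠ 0 :=
      (ENNReal.ofReal_pos.2 (VRJP.cAlpha_pos hα.2)).ne'
    rw [mul_comm, ← div_eq_mul_inv, ENNReal.le_div_iff_mul_le (Or.inl hC)
      (Or.inl ENNReal.ofReal_ne_top), mul_comm, ← lintegral_map (hm α) hTm,
      ← lintegral_map (hm α) hWm, hTlaw]
    refine Finset.le_inf' _ _ fun m hmem => ?_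
    have hmem' := Finset.mem_Icc.1 hmem
    have h1 := VRJP.cAlpha_mul_lintegral_rpow_iteratedSeriesLaw_le hpos hα (r - m) (m - l)
    rwa [show r - m + (m - l) = r - l by omega] at h1
  · rw [← VRJP.hasExpectation_map hWm hlog] at h
    rw [← VRJP.hasExpectation_map hTm hlog, ← VRJP.expectation_map hTm hlog,
      ← VRJP.expectation_map hWm hlog, hTlaw]
    refine ⟨VRJP.hasExpectation_log_iteratedSeriesLaw hpos h _,
      Finset.le_inf' _ _ fun m hmem => ?_⟩
    have hmem' := Finset.mem_Icc.1 hmem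
    exact VRJP.expectation_log_iteratedSeriesLaw_le hpos h hmem'.1 hmem'.2
  · have h1 : Integrable Real.log (P.map (W e₁)) :=
      (integrable_map_measure hlog.aestronglyMeasurable hWm.aemeasurable).2 h
    have h2 := VRJP.integrable_log_iteratedSeriesLaw hpos h1 (r - l)
    rw [← hTlaw] at h2
    exact (integrable_map_measure hlog.aestronglyMeasurable hTm.aemeasurable).1 h2
  · have hnn : 0 ≤ᵐ[P] fun ω => W e₁ ω ^ α := by
      filter_upwards [hW_pos e₁] with ω hω
      exact Real.rpow_nonneg hω.le α
    have hWα : Measurable fun ω => W e₁ ω ^ α := by fun_prop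
    have h0 : ∫⁻ ω, ENNReal.ofReal (W e₁ ω ^ α) ∂P ≠ 0 := by
      intro h0
      rw [lintegral_eq_zero_iff hWα.ennreal_ofReal] at h0
      obtain ⟨ω, h1, h2⟩ := ((hW_pos e₁).and h0).exists
      exact (ENNReal.ofReal_pos.2 (Real.rpow_pos_of_pos h1 α)).ne' h2
    have h1 : ∫ ω, W e₁ ω ^ α ∂P = (∫⁻ ω, ENNReal.ofReal (W e₁ ω ^ α) ∂P).toReal :=
      integral_eq_lintegral_of_nonneg_ae hnn hWα.aestronglyMeasurable
    have h2 := VRJP.minimizedAt_momentTerm hα (ENNReal.toReal_pos h0 hfin) l r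
    rwa [← h1, h1, ENNReal.ofReal_toReal hfin, ← h1] at h2
  · rw [VRJP.expectation_eq_integral (f := fun ω => Real.log (W e₁ ω)) (hlog.comp hWm) h]
    exact VRJP.minimizedAt_logTerm _ l r
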